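/- Let $k$ be a field of characteristic $0$. A variety over $k$ is a geometrically integral separated scheme of finite type over $k$, and a surface is a variety of dimension $2$. Let $X$ be a smooth projective surface over $k$, and let $\pi_1,\pi_2\colon X\to\mathbb{P}^1_k$ be two conic fibrations, that is, $k$-morphisms such that every scheme-theoretic fiber is isomorphic to a plane conic (the zero scheme in $\mathbb{P}^2$ of a nonzero quadratic form over the residue field). Assume that for all $P,Q\in\mathbb{P}^1(\overline{k})$ the fibers have positive intersection number $\pi_1^{-1}(P)\cdot\pi_2^{-1}(Q)>0$ on $X_{\overline{k}}$. Let $P_0\in X(k)$ be a rational point such that the fiber $\pi_1^{-1}(\pi_1(P_0))$ is smooth over $k$. Define $k$-schemes $C_n$ with morphisms $f_n\colon C_n\to X$ as follows: $C_0=\operatorname{Spec} k$ and $f_0$ is the inclusion of the point $P_0$; for $n\ge 1$ let $i=1$ if $n$ is odd and $i=2$ if $n$ is even, let $C_n = C_{n-1}\times_{\mathbb{P}^1_k} X$ be the fiber product of $\pi_i\circ f_{n-1}\colon C_{n-1}\to\mathbb{P}^1_k$ and $\pi_i\colon X\to\mathbb{P}^1_k$, and let $f_n\colon C_n\to X$ be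 the second projection. Then: (i) for every $n\ge 2$, the morphism $f_n\colon C_n\to X$ is flat, projective and surjective; (ii) for every $n\ge 0$, the scheme $C_n$ is geometrically integral over $k$ of dimension $n$; (iii) for every $n\ge 0$, $C_n$ is a projective variety over $k$ which is rational, i.e. birational over $k$ to $\mathbb{A}^n_k$. -/

import Mathlib

open AlgebraicGeometry CategoryTheory Limits

universe u

noncomputable section

namespace ConicFibrations

attribute [local instance] MvPolynomial.gradedAlgebra

/-! ### Projective space over a field -/

/-- The standard grading of the polynomial ring `F[x₀, …, x_N]`. -/
abbrev stdGrading (N : ℕ) (F : Type u) [Field F] :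
    ℕ → Submodule F (MvPolynomial (Fin (N + 1)) F) :=
  MvPolynomial.homogeneousSubmodule (Fin (N + 1)) F

/-- Projective `N`-space over the field `F`, i.e. `Proj F[x₀, …, x_N]`. -/
def ProjSpace (N : ℕ) (F : Type u) [Field F] : Scheme.{u} :=
  Proj (stdGrading N F)

/-- The structure morphism of projective `N`-space over `F`. -/
def ProjSpace.toSpec (N : ℕ) (F : Type u) [Field F] : ProjSpace N F ⟶ Spec (.of F) :=
  Proj.toSpecZero (stdGrading N F) ≫
    Spec.map (CommRingCat.ofHom (algebraMap F (stdGrading N F 0)))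

theorem X_mem_stdGrading (N : ℕ) (F : Type u) [Field F] (j : Fin (N + 1)) :
    (MvPolynomial.X j : MvPolynomial (Fin (N + 1)) F) ∈ stdGrading N F 1 :=
  MvPolynomial.isHomogeneous_X F j

/-- The standard affine chart `D₊(x_j)` of projective space. -/
def ProjSpace.chart (N : ℕ) (F : Type u) [Field F] (j : Fin (N + 1)) :
    (ProjSpace N F).affineOpens :=
  ⟨Proj.basicOpen (stdGrading N F) (MvPolynomial.X j),
    Proj.isAffineOpen_basicOpen (stdGrading N F) (MvPolynomial.X j)
      (X_mem_stdGrading N F j) Nat.one_pos⟩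

/-- The function `q / x_j ^ d` on the chart `D₊(x_j)`, for a form `q` of degree `d`. -/
def ProjSpace.dehomogenize (N : ℕ) (F : Type u) [Field F] (d : ℕ)
    (q : MvPolynomial (Fin (N + 1)) F) (hq : q.IsHomogeneous d) (j : Fin (N + 1)) :
    Γ(ProjSpace N F, (ProjSpace.chart N F j).1) :=
  (Proj.awayToSection (stdGrading N F) (MvPolynomial.X j)).hom
    (HomogeneousLocalization.Away.mk (stdGrading N F) (X_mem_stdGrading N F j) d q
      (by simpa using hq))

/-! ### Projective morphisms, varieties, surfaces -/

/-- A scheme over the field `k` is projective if it is isomorphic over `k` to a closed subscheme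
of some projective space over `k`. -/
def IsProjectiveScheme {k : Type u} [Field k] {X : Scheme.{u}} (s : X ⟶ Spec (.of k)) : Prop :=
  ∃ (N : ℕ) (i : X ⟶ ProjSpace N k), IsClosedImmersion i ∧ i ≫ ProjSpace.toSpec N k = s

/-- A morphism `f : X ⟶ Y`, where `Y` is a `k`-scheme with structure morphism `s`, is projective if
it factors as a closed immersion into `Y ×ₖ ℙᴺₖ` (which is `ℙᴺ` over `Y`) for some `N`, followed by
the projection to `Y`. -/
def IsProjectiveMorphism {k : Type u} [Field k] {X Y : Scheme.{u}} (s : Y ⟶ Spec (.of k))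
    (f : X ⟶ Y) : Prop :=
  ∃ (N : ℕ) (i : X ⟶ pullback s (ProjSpace.toSpec N k)),
    IsClosedImmersion i ∧ i ≫ pullback.fst s (ProjSpace.toSpec N k) = f

/-- A variety over the field `k`: a geometrically integral separated scheme of finite type. -/
structure IsVariety {k : Type u} [Field k] {X : Scheme.{u}} (s : X ⟶ Spec (.of k)) : Prop where
  geometricallyIntegral : GeometricallyIntegral s
  isSeparated : IsSeparated s
  locallyOfFiniteType : LocallyOfFiniteType s
  quasiCompact : QuasiCompact s

/-- A smooth projective surface over the field `k`. -/
structure IsSmoothProjectiveSurface {k : Type u} [Field k] {X : Scheme.{u}}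
    (s : X ⟶ Spec (.of k)) : Prop where
  isVariety : IsVariety s
  dim_eq : topologicalKrullDim X = 2
  smooth : Smooth s
  projective : IsProjectiveScheme s

/-- A `k`-scheme of dimension `n` is rational if it is birational over `k` to affine `n`-space. -/
def IsRationalOfDim {k : Type u} [Field k] {X : Scheme.{u}} (s : X ⟶ Spec (.of k)) (n : ℕ) :
    Prop :=
  Scheme.BirationalOver s (𝔸(ULift.{u} (Fin n); Spec (.of k)) ↘ Spec (.of k))

/-! ### Conic fibrations -/

/-- An `F`-scheme is isomorphic to a plane conic if it is isomorphic over `F` to the closed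
subscheme `q = 0` of `ℙ²` for a nonzero quadratic form `q`. -/
def IsPlaneConic {F : Type u} [Field F] {Z : Scheme.{u}} (s : Z ⟶ Spec (.of F)) : Prop :=
  ∃ (q : MvPolynomial (Fin 3) F) (hq : q.IsHomogeneous 2) (i : Z ⟶ ProjSpace 2 F),
    q ≠ 0 ∧ IsClosedImmersion i ∧ i ≫ ProjSpace.toSpec 2 F = s ∧
    ∀ j : Fin 3, i.ker.ideal (ProjSpace.chart 2 F j) =
      Ideal.span {ProjSpace.dehomogenize 2 F 2 q hq j}

/-- A conic fibration of the `k`-scheme `X`: a `k`-morphism to the projective line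
all of whose scheme-theoretic fibers are plane conics (over the residue fields). -/
structure IsConicFibration {k : Type u} [Field k] {X : Scheme.{u}} (s : X ⟶ Spec (.of k))
    (π : X ⟶ ProjSpace 1 k) : Prop where
  comp_toSpec : π ≫ ProjSpace.toSpec 1 k = s
  fiber_isPlaneConic : ∀ y : ProjSpace 1 k,
    IsPlaneConic (F := (ProjSpace 1 k).residueField y) (π.fiberToSpecResidueField y)

/-! ### Intersection numbers -/

/-- `e` is a local equation at the point `x` of the effective Cartier divisor `i : E ⟶ S`: on some
affine open neighbourhood of `x` the ideal of `E` is generated by a nonzerodivisor whose germ at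
`x` is `e`. -/
def IsLocalEquation {E S : Scheme.{u}} (i : E ⟶ S) (x : S) (e : S.presheaf.stalk x) : Prop :=
  ∃ (U : S.affineOpens) (hx : x ∈ U.1) (t : Γ(S, U.1)),
    t ∈ nonZeroDivisors Γ(S, U.1) ∧ i.ker.ideal U = Ideal.span {t} ∧
    (S.presheaf.germ U.1 x hx).hom t = e

/-- `d` is the degree on the integral curve `j : V ⟶ S` of the line bundle `𝒪(E)`, where
`i : E ⟶ S` is an effective Cartier divisor and `V` is proper over an algebraically closed field.

Let `ξ` be the generic point of `V` and let `e` be a local equation of `E` at `ξ`. A local equation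
of `E` at a point `x` of `V` has the form `u x * e` in the local ring of `S` at `ξ`, with a unit
`u x`. The restrictions of the `u x` to the function field of `V` are the local equations of the
divisor on `V` of a nonzero rational section of `𝒪(E)|_V`, and `d` is the degree of this divisor.
(If `V` is not contained in `E`, one may take `e = 1`, and `d` is the number of points of `V ∩ E`
with multiplicities.) -/
def IsDegreeOnCurve {E S V : Scheme.{u}} (i : E ⟶ S) (j : V ⟶ S) [IsIntegral V]
    [IsLocallyNoetherian V] (d : ℤ) : Prop :=
  ∃ (e : S.presheaf.stalk (j (genericPoint V)))
    (u : V → (S.presheaf.stalk (j (genericPoint V)))ˣ),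
    IsLocalEquation i (j (genericPoint V)) e ∧
    (∀ x : V, ∃ e' : S.presheaf.stalk (j x), IsLocalEquation i (j x) e' ∧
      (S.presheaf.stalkSpecializes
        ((genericPoint_specializes x).map j.continuous)).hom e' = u x * e) ∧
    d = ∑ᶠ x : V, V.ord ((j.stalkMap (genericPoint V)).hom (u x : S.presheaf.stalk _)) x

/-- `n` is the intersection number `D · E` of two effective Cartier divisors `i₁ : D ⟶ S` and
`i₂ : E ⟶ S` on a surface `S` which is proper over an algebraically closed field: the sum, over the
irreducible components `V` of `D` (with their reduced structure), of the multiplicity of `V` in `D`,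
i.e. the length of the local ring of `D` at the generic point of `V`, times the degree of `𝒪(E)`
on `V`. -/
def IsIntersectionNumber {D E S : Scheme.{u}} (i₁ : D ⟶ S) (i₂ : E ⟶ S) (n : ℤ) : Prop :=
  ∃ m : irreducibleComponents D → ℤ,
    (∀ Z : irreducibleComponents D,
      ∃ (V : Scheme.{u}) (_ : IsIntegral V) (_ : IsLocallyNoetherian V) (j : V ⟶ D) (d : ℤ),
        IsClosedImmersion j ∧ Set.range j = (Z : Set D) ∧ IsDegreeOnCurve i₂ (j ≫ i₁) d ∧
        m Z = ((Module.length (D.presheaf.stalk (j (genericPoint V)))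
          (D.presheaf.stalk (j (genericPoint V)))).toNat : ℤ) * d) ∧
    n = ∑ᶠ Z : irreducibleComponents D, m Z

/-- The morphism `Spec k̄ ⟶ Spec k`. -/
def specAlgClosure (k : Type u) [Field k] : Spec (.of (AlgebraicClosure k)) ⟶ Spec (.of k) :=
  Spec.map (CommRingCat.ofHom (algebraMap k (AlgebraicClosure k)))

/-- The base change `π_{k̄}` of a `k`-morphism `π : X ⟶ Y` to an algebraic closure of `k`. -/
def geomMap {k : Type u} [Field k] {X Y : Scheme.{u}} (s : X ⟶ Spec (.of k))
    (t : Y ⟶ Spec (.of k)) (π : X ⟶ Y) (h : π ≫ t = s) :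
    pullback s (specAlgClosure k) ⟶ pullback t (specAlgClosure k) :=
  pullback.map s (specAlgClosure k) t (specAlgClosure k) π (𝟙 _) (𝟙 _) (by simp [h]) (by simp)

/-- Any two geometric fibers of the two conic fibrations have positive intersection number on
`X_{k̄}`. The points of `ℙ¹(k̄)` are the closed points of `ℙ¹` over `k̄`. The intersection number
is unique, hence the quantification over its values `n`. -/
def FibersMeetPositively {k : Type u} [Field k] {X : Scheme.{u}} {s : X ⟶ Spec (.of k)}
    {π₁ π₂ : X ⟶ ProjSpace 1 k} (h₁ : IsConicFibration s π₁) (h₂ : IsConicFibration s π₂) : Prop :=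
  ∀ P Q : ↥(pullback (ProjSpace.toSpec 1 k) (specAlgClosure k)),
    IsClosed {P} → IsClosed {Q} →
    ∀ n : ℤ, IsIntersectionNumber
      ((geomMap s (ProjSpace.toSpec 1 k) π₁ h₁.comp_toSpec).fiberι P)
      ((geomMap s (ProjSpace.toSpec 1 k) π₂ h₂.comp_toSpec).fiberι Q) n → 0 < n

/-! ### The iterated fiber products -/

/-- The schemes `C_n` with the morphisms `f_n : C_n ⟶ X`, as objects over `X`: `f_0` is the given
point, and `C_{n+1}` is the fiber product of `π_i ∘ f_n : C_n ⟶ B` and `π_i : X ⟶ B`, where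
`i = 1` if `n + 1` is odd and `i = 2` if `n + 1` is even; `f_{n+1}` is the projection to `X`. -/
def iteratedFiberProduct {X B C₀ : Scheme.{u}} (π₁ π₂ : X ⟶ B) (P₀ : C₀ ⟶ X) : ℕ → Over X
  | 0 => Over.mk P₀
  | n + 1 =>
    let π := if Odd (n + 1) then π₁ else π₂
    Over.mk (pullback.snd ((iteratedFiberProduct π₁ π₂ P₀ n).hom ≫ π) π)

/-- The scheme `C_n`. -/
abbrev auxC {X B C₀ : Scheme.{u}} (π₁ π₂ : X ⟶ B) (P₀ : C₀ ⟶ X) (n : ℕ) : Scheme.{u} :=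
  (iteratedFiberProduct π₁ π₂ P₀ n).left

/-- The morphism `f_n : C_n ⟶ X`. -/
abbrev auxF {X B C₀ : Scheme.{u}} (π₁ π₂ : X ⟶ B) (P₀ : C₀ ⟶ X) (n : ℕ) :
    auxC π₁ π₂ P₀ n ⟶ X :=
  (iteratedFiberProduct π₁ π₂ P₀ n).hom

end ConicFibrations

end

/-!
A fiber of a conic fibration is given by a ternary quadratic form. In characteristic different from
`2` it is a smooth conic as soon as it is normal: otherwise the form is degenerate, and the conic is
a cone over the kernel of its Hessian matrix, which is not normal at a vertex. Therefore the generic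
fibers of `π₁` and `π₂` are smooth conics, since `X` is normal, and so is the fiber of `π₁` through
`P₀`, since it is smooth.

If the generic point of `C_n` lies over a point of `ℙ¹` with smooth fiber, then the generic fiber of
`C_{n+1} ⟶ C_n` is a smooth conic which has a rational point, induced by `f_n`. Projection from this
point shows that the function field of `C_{n+1}` is a rational function field in one variable over
that of `C_n`. As `C_{n+1}` is flat over `C_n`, it is integral if its generic fiber is, and all this
persists over extensions of `k`.

It remains to see that `C_n` dominates `ℙ¹` for `n ≥ 1`. The image of `C_1` in `X` is the fiber of
`π₁` through `P₀`. If it did not dominate `ℙ¹` under `π₂`, some geometric fiber of `π₂` would not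
meet it, and their intersection number would be `0`. From then on `C_n ⟶ ℙ¹` is dominant and
proper, thus surjective, and flat because `ℙ¹` is a regular curve; hence `f_{n+1}` is flat and
surjective, and `C_{n+1}` again dominates `ℙ¹`.
-/

noncomputable section

namespace ConicFibrations

attribute [local instance] MvPolynomial.gradedAlgebra

/-! ### Normality of smooth schemes over a field -/

section Normality

open TensorProduct

/-- A commutative ring is von Neumann regular if every element has a quasi-inverse. Products of
fields are the examples that matter here. -/
def IsVonNeumannRegular (T : Type*) [CommRing T] : Prop := ∀ t : T, ∃ u, t * u * t = t

namespace IsVonNeumannRegular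

theorem of_surjective {A B : Type*} [CommRing A] [CommRing B] (hA : IsVonNeumannRegular A)
    (f : A →+* B) (hf : Function.Surjective f) : IsVonNeumannRegular B := by
  intro b
  obtain ⟨a, rfl⟩ := hf b
  obtain ⟨u, hu⟩ := hA a
  exact ⟨f u, by rw [← map_mul, ← map_mul, hu]⟩

theorem of_isLocalization {A B : Type*} [CommRing A] [CommRing B] [Algebra A B]
    (hA : IsVonNeumannRegular A) (M : Submonoid A) [IsLocalization M B] :
    IsVonNeumannRegular B := by
  intro b
  obtain ⟨a, s, rfl⟩ := IsLocalization.exists_mk'_eq M b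
  obtain ⟨u, hu⟩ := hA a
  refine ⟨IsLocalization.mk' B (u * s) (1 : M), ?_⟩
  rw [← IsLocalization.mk'_mul, ← IsLocalization.mk'_mul, IsLocalization.mk'_eq_iff_eq]
  congr 1
  push_cast
  linear_combination (s : A) ^ 2 * hu

theorem of_etale (K A : Type u) [Field K] [CommRing A] [Algebra K A] [Algebra.Etale K A] :
    IsVonNeumannRegular A := by
  obtain ⟨I, _, L, _, _, e, -⟩ := (Algebra.Etale.iff_exists_algEquiv_prod K A).mp inferInstance
  have hprod : IsVonNeumannRegular (∀ i, L i) := fun t =>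
    ⟨fun i => (t i)⁻¹, funext fun i => mul_inv_mul_cancel (t i)⟩
  exact hprod.of_surjective (e.symm : (∀ i, L i) →+* A) e.symm.surjective

theorem isField {T : Type*} [CommRing T] [Nontrivial T] (hT : IsVonNeumannRegular T)
    (hidem : ∀ e : T, IsIdempotentElem e → e = 0 ∨ e = 1) : IsField T where
  exists_pair_ne := exists_pair_ne T
  mul_comm := mul_comm
  mul_inv_cancel {t} ht := by
    obtain ⟨u, hu⟩ := hT t
    have he : IsIdempotentElem (t * u) := by
      rw [IsIdempotentElem]
      linear_combination u * hu
    refine ⟨u, (hidem _ he).resolve_left fun h0 => ht ?_⟩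
    rw [← hu, h0, zero_mul]

end IsVonNeumannRegular

theorem isIntegral_of_isIdempotentElem (R : Type*) {A : Type*} [CommRing R] [CommRing A]
    [Algebra R A] {e : A} (he : IsIdempotentElem e) : IsIntegral R e :=
  ⟨Polynomial.X ^ 2 - Polynomial.X, by monicity!, by simp [sq, he.eq]⟩

theorem eq_zero_or_eq_one_of_isIdempotentElem {O : Type*} [CommRing O] [IsLocalRing O] {e : O}
    (he : IsIdempotentElem e) : e = 0 ∨ e = 1 := by
  rcases IsLocalRing.isUnit_or_isUnit_one_sub_self e with h | h
  · exact .inr ((IsIdempotentElem.iff_eq_one_of_isUnit h).mp he)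
  · refine .inl (h.mul_right_eq_zero.mp ?_)
    rw [sub_mul, one_mul, he.eq, sub_self]

/-- A commutative ring is a normal domain if it is an integrally closed integral domain. -/
structure IsNormalDomain (O : Type*) [CommRing O] : Prop where
  isDomain : IsDomain O
  isIntegrallyClosed : IsIntegrallyClosed O

theorem IsNormalDomain.of_ringEquiv {O O' : Type*} [CommRing O] [CommRing O']
    (h : IsNormalDomain O) (e : O ≃+* O') : IsNormalDomain O' :=
  have := h.isIntegrallyClosed
  ⟨e.symm.toMulEquiv.isDomain_iff.mpr h.isDomain, .of_equiv e⟩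

theorem isNormalDomain_of_isIntegrallyClosedIn {O T : Type*} [CommRing O] [IsLocalRing O]
    [CommRing T] [Algebra O T] [IsIntegrallyClosedIn O T] (hT : IsVonNeumannRegular T) :
    IsNormalDomain O := by
  have hinj : Function.Injective (algebraMap O T) :=
    IsIntegralClosure.algebraMap_injective O O T
  have := hinj.nontrivial
  have hidem (e : T) (he : IsIdempotentElem e) : e = 0 ∨ e = 1 := by
    obtain ⟨e, rfl⟩ :=
      IsIntegrallyClosedIn.isIntegral_iff.mp (isIntegral_of_isIdempotentElem O he)
    have he' : IsIdempotentElem e := hinj (by rw [map_mul, he.eq])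
    exact (eq_zero_or_eq_one_of_isIdempotentElem he').imp (by simp +contextual)
      (by simp +contextual)
  let _ : Field T := (hT.isField hidem).toField
  have : FaithfulSMul O T := (faithfulSMul_iff_algebraMap_injective O T).mpr hinj
  exact ⟨hinj.isDomain, .of_isIntegrallyClosedIn O T⟩

section EtaleOverNormal

variable (P A O : Type u) [CommRing P] [CommRing A] [CommRing O] [Algebra P A]
  [Algebra A O] [Algebra P O] [IsScalarTower P A O] [Algebra.Etale P A]

theorem isVonNeumannRegular_tensorProduct_fractionRing [IsDomain P] (M : Submonoid A)
    [IsLocalization M O] :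
    IsVonNeumannRegular (O ⊗[P] FractionRing P) := by
  let K := FractionRing P
  have hA : IsVonNeumannRegular (A ⊗[P] K) :=
    (IsVonNeumannRegular.of_etale K (K ⊗[P] A)).of_surjective
      (Algebra.TensorProduct.comm P K A : K ⊗[P] A →+* A ⊗[P] K)
      (Algebra.TensorProduct.comm P K A).surjective
  let φ : A ⊗[P] K →ₐ[A] O ⊗[P] K :=
    Algebra.TensorProduct.map (Algebra.ofId A O) (AlgHom.id P K)
  algebraize [φ.toRingHom]
  have : IsScalarTower A (A ⊗[P] K) (O ⊗[P] K) := .of_algHom φ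
  have := IsLocalization.tensorProduct_tensorProduct P K M O (by
    ext; simp [RingHom.algebraMap_toAlgebra, φ])
  exact hA.of_isLocalization (Algebra.algebraMapSubmonoid (A ⊗[P] K) M)

theorem isIntegrallyClosedIn_tensorProduct_fractionRing [IsIntegrallyClosed P] (M : Submonoid A)
    [IsLocalization M O] : IsIntegrallyClosedIn O (O ⊗[P] FractionRing P) := by
  let K := FractionRing P
  have : Module.Flat A O := IsLocalization.flat O M
  have : Module.Flat P O := .trans P A O
  have hbij : Function.Bijective (TensorProduct.toIntegralClosure P O K) :=
    TensorProduct.toIntegralClosure_bijective_of_tower (S := A)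
      TensorProduct.toIntegralClosure_bijective_of_smooth
      (TensorProduct.toIntegralClosure_bijective_of_isLocalization M)
  refine isIntegrallyClosedIn_iff.mpr ⟨?_, fun {t} ht => ?_⟩
  · exact Algebra.TensorProduct.includeLeft_injective (R := P) (S := P) (A := O) (B := K)
      (IsFractionRing.injective P K)
  obtain ⟨y, hy⟩ := hbij.2 ⟨t, ht⟩
  obtain rfl : (TensorProduct.toIntegralClosure P O K y : O ⊗[P] K) = t := by rw [hy]
  clear hy ht
  change _ ∈ Set.range _
  induction y with
  | zero => exact ⟨0, by simp⟩
  | add x y hx hy =>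
    obtain ⟨a, ha⟩ := hx
    obtain ⟨b, hb⟩ := hy
    exact ⟨a + b, by rw [map_add, ha, hb, map_add]; rfl⟩
  | tmul a b =>
    obtain ⟨_, hb⟩ := b
    obtain ⟨c, rfl⟩ := IsIntegrallyClosed.isIntegral_iff.mp hb
    refine ⟨c • a, ?_⟩
    change (c • a) ⊗ₜ[P] (1 : K) = a ⊗ₜ[P] (algebraMap P K c)
    rw [Algebra.algebraMap_eq_smul_one, TensorProduct.smul_tmul]

end EtaleOverNormal

/-- Near `p` the algebra is étale over a polynomial ring `P`. The local ring at `p` is integrally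
closed in its base change to `Frac P`, which is a localization of a finite product of fields and
has no idempotents but `0` and `1`, as these are integral over the local ring. -/
theorem isNormalDomain_localization_of_smooth (k B : Type u) [Field k] [CommRing B] [Algebra k B]
    [Algebra.Smooth k B] (p : Ideal B) [p.IsPrime] :
    IsNormalDomain (Localization.AtPrime p) := by
  obtain ⟨f, hf, n, _, _, _⟩ :=
    Algebra.IsSmoothAt.exists_isStandardEtale_mvPolynomial (R := k) (p := p)
  let P := MvPolynomial (Fin n) k
  let A := Localization.Away f
  let O := Localization.AtPrime p
  have hle : Submonoid.powers f ≤ p.primeCompl := Submonoid.powers_le.mpr hf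
  let _ : Algebra A O := IsLocalization.localizationAlgebraOfSubmonoidLe A O _ _ hle
  have : IsScalarTower B A O :=
    IsLocalization.localization_isScalarTower_of_submonoid_le A O _ _ hle
  let M : Submonoid A := p.primeCompl.map (algebraMap B A)
  have : IsLocalization M O := IsLocalization.isLocalization_of_submonoid_le A O _ _ hle
  let _ : Algebra P O := ((algebraMap A O).comp (algebraMap P A)).toAlgebra
  have : IsScalarTower P A O := .of_algebraMap_eq fun _ => rfl
  have : Algebra.Etale P A := inferInstance
  have := isIntegrallyClosedIn_tensorProduct_fractionRing P A O M
  exact isNormalDomain_of_isIntegrallyClosedIn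
    (isVonNeumannRegular_tensorProduct_fractionRing P A O M)

/-- A scheme is normal if its local rings are normal domains. -/
def IsNormalScheme (X : Scheme.{u}) : Prop := ∀ x : X, IsNormalDomain (X.presheaf.stalk x)

theorem isNormalScheme_of_smooth {k : Type u} [Field k] {X : Scheme.{u}} (s : X ⟶ Spec (.of k))
    [Smooth s] : IsNormalScheme X := by
  intro x
  obtain ⟨_, ⟨U, hU, rfl⟩, hxU, -⟩ := X.isBasis_affineOpens.exists_subset_of_mem_open
    (Set.mem_univ x) isOpen_univ
  let φ : k →+* Γ(X, U) := ((Scheme.ΓSpecIso (.of k)).inv ≫ s.appLE ⊤ U le_top).hom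
  have hφ : φ.Smooth :=
    RingHom.Smooth.respectsIso.2 _ (Scheme.ΓSpecIso (.of k)).symm.commRingCatIsoToRingEquiv
      (s.smooth_appLE (isAffineOpen_top _) hU le_top)
  algebraize [φ]
  let := TopCat.Presheaf.algebra_section_stalk X.presheaf (⟨x, hxU⟩ : U)
  have := hU.isLocalization_stalk ⟨x, hxU⟩
  let p := (hU.primeIdealOf ⟨x, hxU⟩).asIdeal
  exact (isNormalDomain_localization_of_smooth k Γ(X, U) p).of_ringEquiv
    (IsLocalization.algEquiv p.primeCompl _ _).toRingEquiv

/-- On spectra, the stalk map is a faithfully flat monomorphism. -/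
theorem isIso_stalkMap_of_flat_of_mono {Y S : Scheme.{u}} (f : Y ⟶ S) [Flat f] [Mono f] (y : Y) :
    IsIso (f.stalkMap y) := by
  have hflat : (f.stalkMap y).hom.Flat := Flat.stalkMap f y
  have : Flat (Spec.map (f.stalkMap y)) := Flat.SpecMap_iff.mpr hflat
  have : Surjective (Spec.map (f.stalkMap y)) := by
    constructor
    algebraize [(f.stalkMap y).hom]
    have : IsLocalHom (algebraMap (S.presheaf.stalk (f y)) (Y.presheaf.stalk y)) :=
      inferInstanceAs (IsLocalHom (f.stalkMap y).hom)
    have := Module.FaithfullyFlat.of_flat_of_isLocalHom (A := S.presheaf.stalk (f y))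
      (B := Y.presheaf.stalk y)
    exact PrimeSpectrum.comap_surjective_of_faithfullyFlat
  have : Mono (Spec.map (f.stalkMap y)) := by
    have : Mono (Spec.map (f.stalkMap y) ≫ S.fromSpecStalk (f y)) := by
      rw [Scheme.SpecMap_stalkMap_fromSpecStalk f (x := y)]
      infer_instance
    exact mono_of_mono _ (S.fromSpecStalk (f y))
  rw [ConcreteCategory.isIso_iff_bijective, ← isIso_SpecMap_iff]
  exact Flat.isIso_of_surjective_of_mono (Spec.map (f.stalkMap y))

theorem IsNormalScheme.of_flat_mono {Y S : Scheme.{u}} (hS : IsNormalScheme S) (f : Y ⟶ S)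
    [Flat f] [Mono f] : IsNormalScheme Y := fun y =>
  have := isIso_stalkMap_of_flat_of_mono f y
  (hS (f y)).of_ringEquiv (asIso (f.stalkMap y)).commRingCatIsoToRingEquiv

end Normality

/-! ### Ternary quadratic forms and affine conics -/

section Vertex

theorem dvd_of_sq_add_mul_add_sq_eq_zero {O : Type*} [CommRing O] [IsDomain O]
    [IsIntegrallyClosed O] {x y b c : O} (h : x ^ 2 + b * (x * y) + c * y ^ 2 = 0) : y ∣ x := by
  let K := FractionRing O
  by_cases hy : y = 0
  · simp_all
  have hyK : algebraMap O K y ≠ 0 := by simpa using hy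
  have hroot : Polynomial.eval₂ (algebraMap O K) (algebraMap O K x / algebraMap O K y)
      (.X ^ 2 + .C b * .X + .C c) = 0 := by
    have hK := congrArg (algebraMap O K) h
    simp only [map_add, map_mul, map_pow, map_zero] at hK
    simp only [Polynomial.eval₂_add, Polynomial.eval₂_mul, Polynomial.eval₂_X_pow,
      Polynomial.eval₂_C, Polynomial.eval₂_X]
    rw [div_pow, ← mul_div_assoc, div_add_div _ _ (pow_ne_zero 2 hyK) hyK, ← eq_neg_iff_add_eq_zero,
      div_eq_iff (mul_ne_zero (pow_ne_zero 2 hyK) hyK)]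
    linear_combination algebraMap O K y * hK
  obtain ⟨w, hw⟩ := IsIntegrallyClosed.algebraMap_eq_of_integral (R := O) (K := K)
    ⟨_, by monicity!, hroot⟩
  exact ⟨w, IsFractionRing.injective O K (by rw [map_mul, hw, mul_div_cancel₀ _ hyK])⟩

/-- The cone `a x² + b x y + c y² = 0` is not normal at its vertex: a normal local ring there would
contain a quotient `x / y` or `y / x`, although `x` and `y` are independent modulo squares. -/
theorem IsNormalDomain.eq_zero_of_quadratic_relation {F O : Type*} [Field F] [CommRing O]
    [Algebra F O] (hO : IsNormalDomain O) (φ : O →ₐ[F] TrivSqZeroExt F (F × F)) {x y : O}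
    (hx : φ x = .inr (1, 0)) (hy : φ y = .inr (0, 1)) {a b c : F}
    (h : a • x ^ 2 + b • (x * y) + c • y ^ 2 = 0) : a = 0 ∧ b = 0 ∧ c = 0 := by
  have := hO.isDomain
  have := hO.isIntegrallyClosed
  have ha : a = 0 := by
    by_contra ha
    obtain ⟨w, hw⟩ : y ∣ x := by
      refine dvd_of_sq_add_mul_add_sq_eq_zero (b := algebraMap F O (a⁻¹ * b))
        (c := algebraMap F O (a⁻¹ * c)) ?_
      have h' := congrArg (a⁻¹ • ·) h
      simpa only [smul_add, smul_smul, inv_mul_cancel₀ ha, one_smul, smul_zero,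
        ← Algebra.smul_def] using h'
    have h1 := congrArg (fun z => z.snd.1) (hx.symm.trans (congrArg φ hw))
    simp [hy] at h1
  have hy0 : y ≠ 0 := by
    rintro rfl
    simpa using congrArg (fun z => z.snd.2) hy
  have hlin : b • x + c • y = 0 := by
    refine (mul_eq_zero_iff_left hy0).mp ?_
    rw [← h, ha, zero_smul, zero_add, mul_add, mul_smul_comm, mul_smul_comm, mul_comm y x, pow_two]
  have hlin' := congrArg φ hlin
  simp only [map_add, map_smul, hx, hy, map_zero, ← TrivSqZeroExt.inr_smul,
    ← TrivSqZeroExt.inr_add] at hlin'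
  exact ⟨ha, by simpa [Prod.ext_iff] using congrArg TrivSqZeroExt.snd hlin'⟩

end Vertex

/-- The ternary quadratic form `a x₀² + b x₁² + c x₂² + d x₁ x₂ + e x₀ x₂ + f x₀ x₁`, given by its
coefficients. -/
@[ext]
structure TernaryForm (R : Type*) where
  a : R
  b : R
  c : R
  d : R
  e : R
  f : R

namespace TernaryForm

open MvPolynomial

section CommRing

variable {R : Type*} [CommRing R]

instance : Zero (TernaryForm R) := ⟨⟨0, 0, 0, 0, 0, 0⟩⟩

theorem zero_def : (0 : TernaryForm R) = ⟨0, 0, 0, 0, 0, 0⟩ := rfl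

/-- The dehomogenization of a ternary form with respect to the last variable. -/
def poly (Q : TernaryForm R) : MvPolynomial (Fin 2) R :=
  C Q.a * X 0 ^ 2 + C Q.f * (X 0 * X 1) + C Q.b * X 1 ^ 2 + C Q.e * X 0 + C Q.d * X 1 + C Q.c

/-- The ternary form as a polynomial. -/
def homogenization (Q : TernaryForm R) : MvPolynomial (Fin 3) R :=
  C Q.a * X 0 ^ 2 + C Q.b * X 1 ^ 2 + C Q.c * X 2 ^ 2 + C Q.d * (X 1 * X 2) +
    C Q.e * (X 0 * X 2) + C Q.f * (X 0 * X 1)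

/-- The discriminant of a ternary form, half the determinant of its Hessian matrix. -/
def disc (Q : TernaryForm R) : R :=
  4 * Q.a * Q.b * Q.c + Q.d * Q.e * Q.f - Q.a * Q.d ^ 2 - Q.b * Q.e ^ 2 - Q.c * Q.f ^ 2

/-- The ternary form with its variables renamed such that the last variable of `Q.chart j` is the
`j`-th variable of `Q` and the order of the other two variables is kept; so `(Q.chart j).poly` is
the equation of the conic on the chart `x_j ≠ 0`. -/
def chart (Q : TernaryForm R) : Fin 3 → TernaryForm R :=
  ![⟨Q.b, Q.c, Q.a, Q.e, Q.f, Q.d⟩, ⟨Q.a, Q.c, Q.b, Q.d, Q.f, Q.e⟩, Q]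

/-- The image of a ternary form under a map of the coefficients. -/
def map {S : Type*} (φ : R → S) (Q : TernaryForm R) : TernaryForm S :=
  ⟨φ Q.a, φ Q.b, φ Q.c, φ Q.d, φ Q.e, φ Q.f⟩

theorem disc_chart (Q : TernaryForm R) (j : Fin 3) : (Q.chart j).disc = Q.disc := by
  fin_cases j <;> simp [chart, disc] <;> ring

theorem chart_eq_zero_iff {Q : TernaryForm R} {j : Fin 3} : Q.chart j = 0 ↔ Q = 0 := by
  fin_cases j <;> simp [chart, TernaryForm.ext_iff, zero_def] <;> tauto

theorem disc_map {S : Type*} [CommRing S] (φ : R →+* S) (Q : TernaryForm R) :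
    (Q.map φ).disc = φ Q.disc := by
  simp [disc, map, map_ofNat]

theorem poly_map {S : Type*} [CommRing S] (φ : R →+* S) (Q : TernaryForm R) :
    (Q.map φ).poly = MvPolynomial.map φ Q.poly := by
  simp [poly, map]

theorem map_eq_zero_iff {S : Type*} [CommRing S] {φ : R →+* S} (hφ : Function.Injective φ)
    {Q : TernaryForm R} : Q.map φ = 0 ↔ Q = 0 := by
  simp only [TernaryForm.ext_iff, map, zero_def, _root_.map_eq_zero_iff φ hφ]

theorem map_chart {R S : Type*} (φ : R → S) (Q : TernaryForm R) (j : Fin 3) :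
    (Q.map φ).chart j = (Q.chart j).map φ := by
  fin_cases j <;> rfl

theorem aeval_poly {S : Type*} [CommRing S] [Algebra R S] (Q : TernaryForm R) (x y : S) :
    aeval ![x, y] Q.poly = algebraMap R S Q.a * x ^ 2 + algebraMap R S Q.f * (x * y) +
      algebraMap R S Q.b * y ^ 2 + algebraMap R S Q.e * x + algebraMap R S Q.d * y +
      algebraMap R S Q.c := by
  simp [poly]

theorem poly_injective : Function.Injective (poly : TernaryForm R → MvPolynomial (Fin 2) R) := by
  intro Q Q' h
  obtain ⟨s, hs0, hs1, hX⟩ : ∃ s : Fin 2 →₀ ℕ, s 0 = 1 ∧ s 1 = 1 ∧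
      (X 0 * X 1 : MvPolynomial (Fin 2) R) = monomial s 1 :=
    ⟨Finsupp.single 0 1 + Finsupp.single 1 1, by simp, by simp, by simp [X, monomial_mul]⟩
  have hcoeff (m : Fin 2 →₀ ℕ) := congrArg (coeff m) h
  simp only [poly, coeff_add, coeff_C_mul, hX, coeff_monomial, coeff_X_pow, coeff_X,
    coeff_C] at hcoeff
  ext
  · simpa [Finsupp.ext_iff, Finsupp.single_apply, hs0, hs1] using hcoeff (Finsupp.single 0 2)
  · simpa [Finsupp.ext_iff, Finsupp.single_apply, hs0, hs1] using hcoeff (Finsupp.single 1 2)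
  · simpa [Finsupp.ext_iff, Finsupp.single_apply, hs0, hs1] using hcoeff 0
  · simpa [Finsupp.ext_iff, Finsupp.single_apply, hs0, hs1] using hcoeff (Finsupp.single 1 1)
  · simpa [Finsupp.ext_iff, Finsupp.single_apply, hs0, hs1] using hcoeff (Finsupp.single 0 1)
  · simpa [Finsupp.ext_iff, Finsupp.single_apply, hs0, hs1] using hcoeff s

theorem C_eq_poly (r : R) : C r = (⟨0, 0, r, 0, 0, 0⟩ : TernaryForm R).poly := by
  simp [poly]

theorem linear_mul_linear (p q r p' q' r' : R) :
    (C p * X 0 + C q * X 1 + C r) * (C p' * X 0 + C q' * X 1 + C r') =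
      (⟨p * p', q * q', r * r', q * r' + q' * r, p * r' + p' * r, p * q' + p' * q⟩ :
        TernaryForm R).poly := by
  simp only [poly, C_add, C_mul]
  ring

theorem totalDegree_poly_le (Q : TernaryForm R) : Q.poly.totalDegree ≤ 2 := by
  rw [← mem_restrictTotalDegree]
  have hmem {n : Fin 2 →₀ ℕ} (hn : n 0 + n 1 ≤ 2) (r : R) :
      monomial n r ∈ restrictTotalDegree (Fin 2) R 2 := by
    rw [mem_restrictTotalDegree]
    refine (totalDegree_monomial_le _ _).trans ?_
    rwa [Finsupp.sum_fintype _ _ (by simp), Fin.sum_univ_two]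
  have hpoly : Q.poly = monomial (Finsupp.single 0 2) Q.a +
      monomial (Finsupp.single 0 1 + Finsupp.single 1 1) Q.f + monomial (Finsupp.single 1 2) Q.b +
      monomial (Finsupp.single 0 1) Q.e + monomial (Finsupp.single 1 1) Q.d + monomial 0 Q.c := by
    simp [poly, X, monomial_pow, C_mul_monomial, monomial_mul]
  rw [hpoly]
  refine add_mem (add_mem (add_mem (add_mem (add_mem ?_ ?_) ?_) ?_) ?_) ?_ <;>
    exact hmem (by simp) _

theorem exists_linear_of_totalDegree_le_one {g : MvPolynomial (Fin 2) R}
    (hg : g.totalDegree ≤ 1) : ∃ p q r, g = C p * X 0 + C q * X 1 + C r := by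
  refine ⟨coeff (Finsupp.single 0 1) g, coeff (Finsupp.single 1 1) g, coeff 0 g, ?_⟩
  ext m
  by_cases hm : m = Finsupp.single 0 1 ∨ m = Finsupp.single 1 1 ∨ m = 0
  · rcases hm with rfl | rfl | rfl <;>
      simp [coeff_X, coeff_C, Finsupp.ext_iff, Finsupp.single_apply]
  · have hcoeff : coeff m g = 0 := by
      by_contra h
      have hle := (le_totalDegree (mem_support_iff.mpr h)).trans hg
      rw [Finsupp.sum_fintype _ _ (by simp), Fin.sum_univ_two] at hle
      simp only [Finsupp.ext_iff, Fin.forall_fin_two, Finsupp.single_apply, Finsupp.coe_zero,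
        Pi.zero_apply] at hm
      grind
    push Not at hm
    simp [hcoeff, coeff_X, coeff_C, hm.1.symm, hm.2.1.symm, hm.2.2.symm]

theorem exists_eq_homogenization {q : MvPolynomial (Fin 3) R} (hq : q.IsHomogeneous 2) :
    ∃ Q : TernaryForm R, q = Q.homogenization := by
  let s (i j : Fin 3) : Fin 3 →₀ ℕ := Finsupp.single i 1 + Finsupp.single j 1
  have hs (i j : Fin 3) : (X i * X j : MvPolynomial (Fin 3) R) = monomial (s i j) 1 := by
    simp [X, monomial_mul, s]
  refine ⟨⟨coeff (s 0 0) q, coeff (s 1 1) q, coeff (s 2 2) q, coeff (s 1 2) q, coeff (s 0 2) q,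
    coeff (s 0 1) q⟩, ?_⟩
  simp only [homogenization, pow_two, hs]
  ext m
  simp only [coeff_add, coeff_C_mul, coeff_monomial]
  by_cases hm : m 0 + m 1 + m 2 = 2
  · have hcases : m = s 0 0 ∨ m = s 1 1 ∨ m = s 2 2 ∨ m = s 1 2 ∨ m = s 0 2 ∨ m = s 0 1 := by
      simp only [s, Finsupp.ext_iff, Fin.forall_fin_succ, Finsupp.add_apply, Finsupp.single_apply]
      grind
    rcases hcases with rfl | rfl | rfl | rfl | rfl | rfl <;>
      simp [s, Finsupp.ext_iff, Fin.forall_fin_succ, Finsupp.single_apply]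
  · have hcoeff : coeff m q = 0 := by
      by_contra h
      refine hm ?_
      simpa [Finsupp.weight_apply, Finsupp.sum_fintype, Fin.sum_univ_three] using hq h
    have hne (i j) : s i j ≠ m := by
      rintro rfl
      refine hm ?_
      fin_cases i <;> fin_cases j <;> simp [s]
    simp [hcoeff, hne]

theorem homogenization_zero : (0 : TernaryForm R).homogenization = 0 := by
  simp [homogenization, zero_def]

theorem aeval_insertNth_homogenization (Q : TernaryForm R) (j : Fin 3) :
    aeval (j.insertNth (α := fun _ => MvPolynomial (Fin 2) R) 1 X) Q.homogenization =
      (Q.chart j).poly := by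
  have hX (i : Fin 2) :
      j.insertNth (α := fun _ => MvPolynomial (Fin 2) R) 1 X (j.succAbove i) = X i :=
    Fin.insertNth_apply_succAbove ..
  have h1 : j.insertNth (α := fun _ => MvPolynomial (Fin 2) R) 1 X j = 1 :=
    Fin.insertNth_apply_same ..
  have hX0 := hX 0
  have hX1 := hX 1
  generalize j.insertNth (α := fun _ => MvPolynomial (Fin 2) R) 1 X = x at *
  simp only [homogenization, poly, map_add, map_mul, map_pow, aeval_X, algHom_C, algebraMap_eq]
  fin_cases j <;> simp_all [chart, Fin.succAbove] <;> ring

end CommRing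

section Field

variable {F : Type*} [Field F]

theorem isUnit_poly_iff {Q : TernaryForm F} :
    IsUnit Q.poly ↔ ∃ r ≠ 0, Q = ⟨0, 0, r, 0, 0, 0⟩ := by
  simp only [isUnit_iff_eq_C_of_isReduced, C_eq_poly, poly_injective.eq_iff, isUnit_iff_ne_zero,
    ne_eq]

theorem exists_not_isUnit_poly (Q : TernaryForm F) : ∃ j, ¬ IsUnit (Q.chart j).poly := by
  by_contra! h
  obtain ⟨r, hr, h0⟩ := isUnit_poly_iff.mp (h 0)
  obtain ⟨s, -, h2⟩ := isUnit_poly_iff.mp (h 2)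
  rw [TernaryForm.ext_iff] at h0 h2
  exact hr (h0.2.2.1.symm.trans h2.1)

theorem irreducible_poly {Q : TernaryForm F} (hQ : Q.disc ≠ 0) : Irreducible Q.poly := by
  have hQ0 : Q.poly ≠ 0 := by
    intro h
    rw [← C_0, C_eq_poly] at h
    exact hQ (by simp [poly_injective h, disc])
  refine ⟨fun h => ?_, fun g h hgh => ?_⟩
  · obtain ⟨r, -, rfl⟩ := isUnit_poly_iff.mp h
    exact hQ (by simp [disc])
  have hg0 : g ≠ 0 := fun h0 => hQ0 (by rw [hgh, h0, zero_mul])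
  have hh0 : h ≠ 0 := fun h0 => hQ0 (by rw [hgh, h0, mul_zero])
  have hdeg := Q.totalDegree_poly_le
  rw [hgh, totalDegree_mul_of_isDomain hg0 hh0] at hdeg
  by_contra! hunit
  have hunit_of {g : MvPolynomial (Fin 2) F} (hg0 : g ≠ 0) (hg : g.totalDegree = 0) :
      IsUnit g := by
    rw [totalDegree_eq_zero_iff_eq_C.mp hg] at hg0 ⊢
    exact (isUnit_iff_ne_zero.mpr (C_ne_zero.mp hg0)).map C
  have hg1 : g.totalDegree ≠ 0 := fun h0 => hunit.1 (hunit_of hg0 h0)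
  have hh1 : h.totalDegree ≠ 0 := fun h0 => hunit.2 (hunit_of hh0 h0)
  obtain ⟨p, q, r, rfl⟩ := exists_linear_of_totalDegree_le_one (g := g) (by lia)
  obtain ⟨p', q', r', rfl⟩ := exists_linear_of_totalDegree_le_one (g := h) (by lia)
  rw [linear_mul_linear] at hgh
  rw [poly_injective hgh] at hQ
  exact hQ (by simp only [disc]; ring)

theorem isPrime_span_poly {Q : TernaryForm F} (hQ : Q.disc ≠ 0) :
    (Ideal.span {Q.poly}).IsPrime :=
  (Ideal.span_singleton_prime (irreducible_poly hQ).ne_zero).mpr (irreducible_poly hQ).prime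

theorem one_lt_totalDegree_poly {Q : TernaryForm F} (hQ : Q.disc ≠ 0) :
    1 < Q.poly.totalDegree := by
  by_contra! h
  obtain ⟨p, q, r, hlin⟩ := exists_linear_of_totalDegree_le_one h
  have hQ' : Q = ⟨0, 0, r, q, p, 0⟩ := poly_injective (by rw [hlin]; simp [poly])
  exact hQ (by simp [hQ', disc])

theorem X_sub_C_notMem_span_poly {Q : TernaryForm F} (hQ : Q.disc ≠ 0) (i : Fin 2) (x : F) :
    (X i - C x : MvPolynomial (Fin 2) F) ∉ Ideal.span {Q.poly} := by
  rw [Ideal.mem_span_singleton]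
  rintro ⟨g, hg⟩
  have hX : (X i - C x : MvPolynomial (Fin 2) F) ≠ 0 := by
    intro h
    simpa using congrArg (eval fun _ => x + 1) h
  have hQ0 : Q.poly ≠ 0 := left_ne_zero_of_mul (hg ▸ hX)
  have hg0 : g ≠ 0 := right_ne_zero_of_mul (hg ▸ hX)
  have hdeg : (X i - C x : MvPolynomial (Fin 2) F).totalDegree ≤ 1 :=
    (totalDegree_sub_C_le _ _).trans_eq (totalDegree_X i)
  rw [hg, totalDegree_mul_of_isDomain hQ0 hg0] at hdeg
  have := one_lt_totalDegree_poly hQ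
  lia

theorem poly_eq_of_isVertex [NeZero (2 : F)] (Q : TernaryForm F) (x y : F)
    (h₁ : 2 * Q.a * x + Q.f * y + Q.e = 0) (h₂ : Q.f * x + 2 * Q.b * y + Q.d = 0)
    (h₃ : Q.e * x + Q.d * y + 2 * Q.c = 0) :
    Q.poly = C Q.a * (X 0 - C x) ^ 2 + C Q.f * ((X 0 - C x) * (X 1 - C y)) +
      C Q.b * (X 1 - C y) ^ 2 := by
  have h₄ : Q.a * x ^ 2 + Q.f * (x * y) + Q.b * y ^ 2 = Q.c :=
    mul_left_cancel₀ (two_ne_zero : (2 : F) ≠ 0) (by linear_combination x * h₁ + y * h₂ - h₃)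
  have he := congrArg (C (σ := Fin 2)) (eq_neg_of_add_eq_zero_right h₁)
  have hd := congrArg (C (σ := Fin 2)) (eq_neg_of_add_eq_zero_right h₂)
  have hc := congrArg (C (σ := Fin 2)) h₄
  simp only [C_add, C_mul, C_neg, C_pow, map_ofNat] at he hd hc
  rw [poly, he, hd, ← hc]
  ring

/-- The kernel of the Hessian matrix of a degenerate form consists of vertices of the conic. -/
theorem exists_vertex [NeZero (2 : F)] {Q : TernaryForm F} (hQ : Q.disc = 0) :
    ∃ (j : Fin 3) (x y : F), (Q.chart j).poly =
      C (Q.chart j).a * (X 0 - C x) ^ 2 + C (Q.chart j).f * ((X 0 - C x) * (X 1 - C y)) +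
        C (Q.chart j).b * (X 1 - C y) ^ 2 := by
  let M : Matrix (Fin 3) (Fin 3) F := !![2 * Q.a, Q.f, Q.e; Q.f, 2 * Q.b, Q.d; Q.e, Q.d, 2 * Q.c]
  have hM : M.det = 2 * Q.disc := by
    simp only [M, Matrix.det_fin_three, disc, Matrix.of_apply, Matrix.cons_val]
    ring
  obtain ⟨v, hv0, hv⟩ := Matrix.exists_mulVec_eq_zero_iff.mpr (hM.trans (by rw [hQ, mul_zero]))
  have hv₀ := congrFun hv 0
  have hv₁ := congrFun hv 1
  have hv₂ := congrFun hv 2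
  simp only [M, Matrix.mulVec, dotProduct, Fin.sum_univ_three, Matrix.of_apply, Matrix.cons_val,
    Pi.zero_apply] at hv₀ hv₁ hv₂
  obtain ⟨j, hj⟩ := Function.ne_iff.mp hv0
  refine ⟨j, v (j.succAbove 0) / v j, v (j.succAbove 1) / v j, poly_eq_of_isVertex _ _ _ ?_ ?_ ?_⟩
  all_goals
    fin_cases j <;> simp [chart, Fin.succAbove] at hj ⊢ <;> field_simp <;> grind

/-- The projection of the conic `Q` from its point `(x, y)`: the chord through `(x, y)` with slope
`t` meets the conic in exactly one further point. -/
theorem eq_div_of_chord {Q : TernaryForm F} (hQ : Q.disc ≠ 0) {x y u t : F}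
    (h₀ : aeval ![x, y] Q.poly = 0) (h₁ : aeval ![x + u, y + t * u] Q.poly = 0) (hu : u ≠ 0) :
    u = -(2 * Q.a * x + Q.f * y + Q.e + (Q.f * x + 2 * Q.b * y + Q.d) * t) /
      (Q.a + Q.f * t + Q.b * t ^ 2) := by
  simp only [aeval_poly, Algebra.algebraMap_self, RingHom.id_apply] at h₀ h₁
  set δ := 2 * Q.a * x + Q.f * y + Q.e with hδ
  set ε := Q.f * x + 2 * Q.b * y + Q.d with hε
  have hchord : u * (Q.a + Q.f * t + Q.b * t ^ 2) = -(δ + ε * t) :=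
    mul_left_cancel₀ hu (by rw [hδ, hε]; linear_combination h₁ - h₀)
  have hdisc : Q.disc = δ * ε * Q.f - Q.a * ε ^ 2 - Q.b * δ ^ 2 := by
    rw [disc, hδ, hε]
    linear_combination (4 * Q.a * Q.b - Q.f ^ 2) * h₀
  rw [eq_div_iff fun h => hQ ?_, hchord]
  rw [h, mul_zero] at hchord
  rw [hdisc]
  linear_combination (ε * Q.f - Q.b * (δ - ε * t)) * hchord - ε ^ 2 * h

theorem mem_of_slope_mem {L : Type*} [Field L] [Algebra F L] {Q : TernaryForm F}
    (hQ : Q.disc ≠ 0) {x y : F} (hxy : aeval ![x, y] Q.poly = 0) {u v : L}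
    (huv : aeval ![u, v] Q.poly = 0) (hu : u ≠ algebraMap F L x) {E : IntermediateField F L}
    (hE : (v - algebraMap F L y) / (u - algebraMap F L x) ∈ E) : u ∈ E ∧ v ∈ E := by
  have hu0 : u - algebraMap F L x ≠ 0 := sub_ne_zero.mpr hu
  obtain ⟨t, ht⟩ : ∃ t, t = (v - algebraMap F L y) / (u - algebraMap F L x) := ⟨_, rfl⟩
  have hv : v - algebraMap F L y = t * (u - algebraMap F L x) := by rw [ht, div_mul_cancel₀ _ hu0]
  rw [← ht] at hE
  have hF (r : F) : algebraMap F L r ∈ E := E.algebraMap_mem r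
  have hQL : (Q.map (algebraMap F L)).disc ≠ 0 := by simpa [disc_map] using hQ
  have haeval (z w : L) : aeval ![z, w] (Q.map (algebraMap F L)).poly = aeval ![z, w] Q.poly := by
    rw [poly_map, aeval_map_algebraMap]
  have hchord := eq_div_of_chord hQL (x := algebraMap F L x) (y := algebraMap F L y) (t := t)
    (by rw [haeval, aeval_poly]; rw [aeval_poly] at hxy
        simpa using congrArg (algebraMap F L) hxy)
    (by rwa [haeval, ← hv, add_sub_cancel, add_sub_cancel]) hu0
  have hsub : u - algebraMap F L x ∈ E := by
    rw [hchord]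
    have h2 : (2 : L) ∈ E := ofNat_mem E 2
    exact E.div_mem (E.neg_mem (add_mem (add_mem (add_mem (mul_mem (mul_mem h2 (hF _)) (hF _))
        (mul_mem (hF _) (hF _))) (hF _)) (mul_mem (add_mem (add_mem (mul_mem (hF _) (hF _))
        (mul_mem (mul_mem h2 (hF _)) (hF _))) (hF _)) hE)))
      (add_mem (add_mem (hF _) (mul_mem (hF _) hE)) (mul_mem (hF _) (pow_mem hE 2)))
  refine ⟨?_, ?_⟩
  · simpa using add_mem hsub (hF x)
  · rw [← sub_add_cancel v (algebraMap F L y), hv]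
    exact add_mem (mul_mem hE hsub) (hF y)

/-- The coordinate ring of the affine conic `Q.poly = 0`. -/
abbrev CoordRing (Q : TernaryForm F) : Type _ :=
  MvPolynomial (Fin 2) F ⧸ Ideal.span {Q.poly}

namespace CoordRing

variable {Q : TernaryForm F}

theorem mk_poly : Ideal.Quotient.mk (Ideal.span {Q.poly}) Q.poly = 0 :=
  Ideal.Quotient.eq_zero_iff_mem.mpr (Ideal.mem_span_singleton_self _)

/-- The universal property of the coordinate ring of a conic. -/
def lift {A : Type*} [CommRing A] (φ : MvPolynomial (Fin 2) F →+* A) (h : φ Q.poly = 0) :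
    Q.CoordRing →+* A :=
  Ideal.Quotient.lift _ φ ((Ideal.span_singleton_le_iff_mem (RingHom.ker φ)).mpr h)

theorem lift_mk {A : Type*} [CommRing A] (φ : MvPolynomial (Fin 2) F →+* A) (h : φ Q.poly = 0)
    (p : MvPolynomial (Fin 2) F) : lift φ h (Ideal.Quotient.mk _ p) = φ p := rfl

theorem hom_ext {A : Type*} [CommRing A] {f g : Q.CoordRing →+* A}
    (hC : ∀ r, f (algebraMap F _ r) = g (algebraMap F _ r))
    (hX : ∀ i, f (Ideal.Quotient.mk _ (X i)) = g (Ideal.Quotient.mk _ (X i))) : f = g :=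
  Ideal.Quotient.ringHom_ext (MvPolynomial.ringHom_ext hC hX)

end CoordRing

section Parametrization

open CoordRing

variable {Q : TernaryForm F}

theorem mk_X_sub_C_ne_zero (hQ : Q.disc ≠ 0) (i : Fin 2) (x : F) :
    Ideal.Quotient.mk (Ideal.span {Q.poly}) (X i - C x) ≠ 0 := fun h =>
  X_sub_C_notMem_span_poly hQ i x (Ideal.Quotient.eq_zero_iff_mem.mp h)

theorem not_isField_coordRing (hQ : Q.disc ≠ 0) {x y : F} (hxy : aeval ![x, y] Q.poly = 0) :
    ¬ IsField Q.CoordRing := fun h => by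
  let _ := h.toField
  refine mk_X_sub_C_ne_zero hQ 0 x (RingHom.injective (lift (aeval ![x, y]).toRingHom hxy) ?_)
  rw [lift_mk, map_zero]
  simp

variable (L : Type*) [Field L] [Algebra Q.CoordRing L] [IsFractionRing Q.CoordRing L]
  [Algebra F L] [IsScalarTower F Q.CoordRing L]

theorem eq_top_of_forall_mem {E : IntermediateField F L}
    (hE : ∀ i, algebraMap Q.CoordRing L (Ideal.Quotient.mk _ (X i)) ∈ E) : E = ⊤ := by
  have hmem (p : MvPolynomial (Fin 2) F) :
      algebraMap Q.CoordRing L (Ideal.Quotient.mk _ p) ∈ E := by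
    induction p using MvPolynomial.induction_on with
    | C r =>
      change algebraMap Q.CoordRing L (algebraMap F _ r) ∈ E
      rw [← IsScalarTower.algebraMap_apply]
      exact E.algebraMap_mem r
    | add p q hp hq =>
      rw [map_add, map_add]
      exact add_mem hp hq
    | mul_X p i hp =>
      rw [map_mul, map_mul]
      exact mul_mem hp (hE i)
  refine eq_top_iff.mpr fun z _ => ?_
  obtain ⟨p, q, -, rfl⟩ := IsFractionRing.div_surjective (A := Q.CoordRing) z
  obtain ⟨p, rfl⟩ := Ideal.Quotient.mk_surjective p
  obtain ⟨q, rfl⟩ := Ideal.Quotient.mk_surjective q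
  exact E.div_mem (hmem p) (hmem q)

theorem not_isAlgebraic_fractionField (hQ : Q.disc ≠ 0) {x y : F}
    (hxy : aeval ![x, y] Q.poly = 0) : ¬ Algebra.IsAlgebraic F L := fun _ => by
  have := isPrime_span_poly hQ
  have : Algebra.IsIntegral F Q.CoordRing := ⟨fun z =>
    (isIntegral_algHom_iff (IsScalarTower.toAlgHom F Q.CoordRing L)
      (IsFractionRing.injective Q.CoordRing L)).mp (Algebra.IsAlgebraic.isAlgebraic _).isIntegral⟩
  exact not_isField_coordRing hQ hxy (isField_of_isIntegral_of_isField' (Field.toIsField F))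

/-- The parameter is the slope of the lines through the rational point. -/
theorem nonempty_ratFunc_algEquiv (hQ : Q.disc ≠ 0) {x y : F} (hxy : aeval ![x, y] Q.poly = 0) :
    Nonempty (RatFunc F ≃ₐ[F] L) := by
  let g : MvPolynomial (Fin 2) F →ₐ[F] L :=
    (IsScalarTower.toAlgHom F Q.CoordRing L).comp (Ideal.Quotient.mkₐ F _)
  have hg : aeval ![g (X 0), g (X 1)] Q.poly = 0 := by
    have haeval : aeval ![g (X 0), g (X 1)] = g :=
      MvPolynomial.algHom_ext fun i => by fin_cases i <;> simp
    rw [haeval]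
    exact (congrArg (algebraMap Q.CoordRing L) mk_poly).trans (map_zero _)
  have hx : g (X 0) ≠ algebraMap F L x := fun h => by
    refine mk_X_sub_C_ne_zero hQ 0 x (IsFractionRing.injective Q.CoordRing L ?_)
    rw [map_zero]
    exact (map_sub g _ _).trans (sub_eq_zero.mpr (h.trans (g.commutes x).symm))
  have htop {E : IntermediateField F L}
      (hE : (g (X 1) - algebraMap F L y) / (g (X 0) - algebraMap F L x) ∈ E) : E = ⊤ := by
    obtain ⟨h0, h1⟩ := mem_of_slope_mem hQ hxy hg hx hE
    exact eq_top_of_forall_mem L (Fin.forall_fin_two.mpr ⟨h0, h1⟩)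
  have htrans : Transcendental F
      ((g (X 1) - algebraMap F L y) / (g (X 0) - algebraMap F L x)) := fun halg => by
    have h := htop (mem_algebraicClosure_iff.mpr halg)
    exact not_isAlgebraic_fractionField L hQ hxy
      ⟨fun z => mem_algebraicClosure_iff.mp (h ▸ IntermediateField.mem_top)⟩
  exact ⟨(RatFunc.algEquivOfTranscendental _ htrans).trans
    ((IntermediateField.equivOfEq (htop (IntermediateField.mem_adjoin_simple_self F _))).trans
      IntermediateField.topEquiv)⟩

end Parametrization

/-- At its vertex such a conic has multiplicity two, so evaluation there extends to the second-order
thickening `F[ε₁, ε₂] / (ε₁, ε₂) ^ 2`. -/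
theorem eq_zero_of_vertex {Q : TernaryForm F} {x y : F}
    (hv : Q.poly = C Q.a * (X 0 - C x) ^ 2 + C Q.f * ((X 0 - C x) * (X 1 - C y)) +
      C Q.b * (X 1 - C y) ^ 2)
    (h : ∀ (p : Ideal Q.CoordRing) [p.IsPrime], IsNormalDomain (Localization.AtPrime p)) :
    Q = 0 := by
  let ψ : MvPolynomial (Fin 2) F →ₐ[F] TrivSqZeroExt F (F × F) :=
    aeval ![.inl x + .inr (1, 0), .inl y + .inr (0, 1)]
  have hψ0 : ψ (X 0 - C x) = .inr (1, 0) := by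
    simp [ψ, algHom_C, TrivSqZeroExt.algebraMap_eq_inl]
  have hψ1 : ψ (X 1 - C y) = .inr (0, 1) := by
    simp [ψ, algHom_C, TrivSqZeroExt.algebraMap_eq_inl]
  have hψ : ψ Q.poly = 0 := by
    rw [hv]
    simp only [map_add, map_mul, hψ0, hψ1, pow_two, TrivSqZeroExt.inr_mul_inr, mul_zero,
      add_zero]
  let φ : Q.CoordRing →ₐ[F] TrivSqZeroExt F (F × F) := Ideal.Quotient.liftₐ _ ψ
    ((Ideal.span_singleton_le_iff_mem (RingHom.ker ψ)).mpr hψ)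
  let p : Ideal Q.CoordRing := RingHom.ker ((TrivSqZeroExt.fstHom F F (F × F)).comp φ)
  have : p.IsPrime := RingHom.ker_isPrime _
  have hunit (z : p.primeCompl) : IsUnit (φ z) := by
    rw [TrivSqZeroExt.isUnit_iff_isUnit_fst, isUnit_iff_ne_zero]
    exact z.2
  let Φ : Localization.AtPrime p →ₐ[F] TrivSqZeroExt F (F × F) :=
    IsLocalization.liftAlgHom (M := p.primeCompl) hunit
  let g : MvPolynomial (Fin 2) F →ₐ[F] Localization.AtPrime p :=
    (IsScalarTower.toAlgHom F Q.CoordRing _).comp (Ideal.Quotient.mkₐ F _)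
  have hΦ (z) : Φ (g z) = ψ z := IsLocalization.lift_eq hunit _
  have hg : g Q.poly = 0 :=
    (congrArg (algebraMap Q.CoordRing (Localization.AtPrime p)) CoordRing.mk_poly).trans
      (map_zero _)
  have hrel : Q.a • g (X 0 - C x) ^ 2 + Q.f • (g (X 0 - C x) * g (X 1 - C y)) +
      Q.b • g (X 1 - C y) ^ 2 = 0 := by
    simpa only [map_add, map_mul, map_pow, algHom_C, ← Algebra.smul_def] using
      (congrArg g hv).symm.trans hg
  obtain ⟨ha, hf, hb⟩ := (h p).eq_zero_of_quadratic_relation Φ ((hΦ _).trans hψ0)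
    ((hΦ _).trans hψ1) hrel
  refine poly_injective ?_
  rw [hv, ha, hf, hb]
  simp [poly, zero_def]

theorem disc_ne_zero [NeZero (2 : F)] {Q : TernaryForm F} (hQ : Q ≠ 0)
    (h : ∀ (j : Fin 3) (p : Ideal (Q.chart j).CoordRing) [p.IsPrime],
      IsNormalDomain (Localization.AtPrime p)) : Q.disc ≠ 0 := fun hdisc => by
  obtain ⟨j, x, y, hv⟩ := exists_vertex hdisc
  exact hQ (chart_eq_zero_iff.mp (eq_zero_of_vertex hv (h j)))

end Field

section BaseChange

open CoordRing

variable {F K : Type*} [Field F] [Field K] (φ : F →+* K) (Q : TernaryForm F)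

/-- The map of coordinate rings induced by a field extension. -/
def coordRingMap : Q.CoordRing →+* (Q.map φ).CoordRing :=
  CoordRing.lift ((Ideal.Quotient.mk _).comp (MvPolynomial.map φ)) (by
    rw [RingHom.comp_apply, ← poly_map, mk_poly])

theorem coordRingMap_mk (p : MvPolynomial (Fin 2) F) :
    Q.coordRingMap φ (Ideal.Quotient.mk _ p) = Ideal.Quotient.mk _ (MvPolynomial.map φ p) := rfl

theorem coordRingMap_algebraMap (r : F) :
    Q.coordRingMap φ (algebraMap F _ r) = algebraMap K _ (φ r) :=
  congrArg (Ideal.Quotient.mk (Ideal.span {(Q.map φ).poly})) (MvPolynomial.map_C φ r)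

end BaseChange

theorem isPushout_coordRing {F K : Type u} [Field F] [Field K] (φ : F →+* K) (Q : TernaryForm F) :
    IsPushout (CommRingCat.ofHom (algebraMap F Q.CoordRing)) (CommRingCat.ofHom φ)
      (CommRingCat.ofHom (Q.coordRingMap φ))
      (CommRingCat.ofHom (algebraMap K (Q.map φ).CoordRing)) := by
  have w : CommRingCat.ofHom (algebraMap F Q.CoordRing) ≫ CommRingCat.ofHom (Q.coordRingMap φ) =
      CommRingCat.ofHom φ ≫ CommRingCat.ofHom (algebraMap K (Q.map φ).CoordRing) :=
    CommRingCat.hom_ext (RingHom.ext (Q.coordRingMap_algebraMap φ))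
  let eval (s : PushoutCocone (CommRingCat.ofHom (algebraMap F Q.CoordRing))
      (CommRingCat.ofHom φ)) : MvPolynomial (Fin 2) K →+* s.pt :=
    eval₂Hom s.inr.hom fun i => s.inl.hom (Ideal.Quotient.mk _ (X i))
  have heval (s) : (eval s).comp (MvPolynomial.map φ) =
      s.inl.hom.comp (Ideal.Quotient.mk (Ideal.span {Q.poly})) := by
    refine MvPolynomial.ringHom_ext (fun r => ?_) fun i => by simp [eval]
    rw [RingHom.comp_apply, map_C, coe_eval₂Hom, eval₂_C]
    exact (ConcreteCategory.congr_hom s.condition r).symm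
  refine ⟨⟨w⟩, ⟨PushoutCocone.IsColimit.mk w (fun s => CommRingCat.ofHom
    (CoordRing.lift (eval s) ?_)) (fun s => ?_) (fun s => ?_) fun s m hl hr => ?_⟩⟩
  · rw [poly_map]
    exact (RingHom.congr_fun (heval s) Q.poly).trans
      ((congrArg s.inl.hom CoordRing.mk_poly).trans (map_zero _))
  · exact CommRingCat.hom_ext (Ideal.Quotient.ringHom_ext (heval s))
  · exact CommRingCat.hom_ext (RingHom.ext (eval₂_C _ _))
  · refine CommRingCat.hom_ext (CoordRing.hom_ext (fun r => ?_) fun i => ?_)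
    · exact (ConcreteCategory.congr_hom hr r).trans (eval₂_C _ _ r).symm
    · have h := ConcreteCategory.congr_hom hl (Ideal.Quotient.mk _ (X i))
      rw [CommRingCat.comp_apply, CommRingCat.ofHom_apply, coordRingMap_mk, map_X] at h
      refine h.trans ?_
      rw [CommRingCat.hom_ofHom, CoordRing.lift_mk, eval₂Hom_X']

end TernaryForm

/-! ### The standard charts of projective space -/

theorem eval₂_mul_of_isHomogeneous {σ R S : Type*} [CommSemiring R] [CommSemiring S]
    (f : R →+* S) (u : S) (g : σ → S) {n : ℕ} {a : MvPolynomial σ R} (ha : a.IsHomogeneous n) :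
    a.eval₂ f (fun l => u * g l) = u ^ n * a.eval₂ f g := by
  rw [MvPolynomial.eval₂_eq, MvPolynomial.eval₂_eq, Finset.mul_sum]
  refine Finset.sum_congr rfl fun d hd => ?_
  have h := ha (MvPolynomial.mem_support_iff.mp hd)
  rw [Finsupp.weight_apply] at h
  simp only [Finsupp.sum, Pi.one_apply, smul_eq_mul, mul_one] at h
  simp only [mul_pow, Finset.prod_mul_distrib, Finset.prod_pow_eq_pow_sum, h]
  ring

namespace ProjSpace

variable (N : ℕ) (F : Type u) [Field F]

/-- The coordinate ring of the standard chart `D₊(x_j)`. -/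
abbrev ChartRing (j : Fin (N + 1)) : Type u :=
  HomogeneousLocalization.Away (stdGrading N F) (MvPolynomial.X j)

/-- The constants in the coordinate ring of a standard chart. -/
def chartConst (j : Fin (N + 1)) : F →+* ChartRing N F j :=
  (HomogeneousLocalization.fromZeroRingHom (stdGrading N F) _).comp
    (algebraMap F (stdGrading N F 0))

/-- The function `x_l / x_j` on the chart `D₊(x_j)`. -/
def chartCoord (j l : Fin (N + 1)) : ChartRing N F j :=
  HomogeneousLocalization.Away.mk (stdGrading N F) (X_mem_stdGrading N F j) 1 (MvPolynomial.X l)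
    (by simpa using X_mem_stdGrading N F l)

theorem val_chartConst (j : Fin (N + 1)) (a : F) :
    (chartConst N F j a).val = algebraMap (MvPolynomial (Fin (N + 1)) F) _ (MvPolynomial.C a) :=
  rfl

theorem val_chartCoord (j l : Fin (N + 1)) :
    (chartCoord N F j l).val =
      Localization.mk (MvPolynomial.X l)
        (⟨MvPolynomial.X j ^ 1, 1, rfl⟩ :
          Submonoid.powers (MvPolynomial.X j : MvPolynomial (Fin (N + 1)) F)) :=
  HomogeneousLocalization.Away.val_mk _ _ _ _ _

theorem chartCoord_self (j : Fin (N + 1)) : chartCoord N F j j = 1 := by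
  apply HomogeneousLocalization.val_injective
  rw [val_chartCoord, HomogeneousLocalization.val_one]
  convert Localization.mk_self (⟨MvPolynomial.X j ^ 1, 1, rfl⟩ :
    Submonoid.powers (MvPolynomial.X j : MvPolynomial (Fin (N + 1)) F))
  simp

theorem eval₂_chartCoord (j : Fin (N + 1)) (n : ℕ) (a : MvPolynomial (Fin (N + 1)) F)
    (ha : a.IsHomogeneous n) :
    a.eval₂ (chartConst N F j) (chartCoord N F j) =
      HomogeneousLocalization.Away.mk (stdGrading N F) (X_mem_stdGrading N F j) n a
        (by simpa using ha) := by
  apply HomogeneousLocalization.val_injective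
  rw [HomogeneousLocalization.Away.val_mk]
  have h1 : (a.eval₂ (chartConst N F j) (chartCoord N F j)).val =
      algebraMap (ChartRing N F j) (Localization.Away (MvPolynomial.X j))
        (a.eval₂ (chartConst N F j) (chartCoord N F j)) := rfl
  rw [h1, MvPolynomial.hom_eval₂]
  let u : Localization.Away (MvPolynomial.X j : MvPolynomial (Fin (N + 1)) F) :=
    Localization.mk 1 ⟨MvPolynomial.X j, 1, by simp⟩
  let ψ := algebraMap (MvPolynomial (Fin (N + 1)) F)
    (Localization.Away (MvPolynomial.X j : MvPolynomial (Fin (N + 1)) F))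
  have h2 : (fun l => algebraMap (ChartRing N F j) (Localization.Away (MvPolynomial.X j))
      (chartCoord N F j l)) = fun l => u * ψ (MvPolynomial.X l) := by
    funext l
    change (chartCoord N F j l).val = _
    rw [val_chartCoord, mul_comm, ← Algebra.smul_def, Localization.smul_mk]
    simp
  have h3 : (algebraMap (ChartRing N F j) (Localization.Away (MvPolynomial.X j))).comp
      (chartConst N F j) = ψ.comp MvPolynomial.C := rfl
  rw [h2, h3, eval₂_mul_of_isHomogeneous _ _ _ ha,
    ← MvPolynomial.hom_eval₂, MvPolynomial.eval₂_eta, mul_comm,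
    ← Algebra.smul_def]
  simp only [u, Localization.mk_pow, Localization.smul_mk]
  simp only [one_pow, smul_eq_mul, mul_one]
  rfl

theorem exists_isHomogeneous_eval₂ (j : Fin (N + 1)) (z : ChartRing N F j) :
    ∃ (n : ℕ) (a : MvPolynomial (Fin (N + 1)) F), a.IsHomogeneous n ∧
      a.eval₂ (chartConst N F j) (chartCoord N F j) = z := by
  obtain ⟨n, a, ha, rfl⟩ :=
    HomogeneousLocalization.Away.mk_surjective (stdGrading N F) (X_mem_stdGrading N F j) z
  have ha' : a.IsHomogeneous n := by simpa using ha
  exact ⟨n, a, ha', eval₂_chartCoord N F j n a ha'⟩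

theorem chartRing_hom_ext {R : Type*} [CommRing R] {j : Fin (N + 1)} {φ ψ : ChartRing N F j →+* R}
    (h1 : φ.comp (chartConst N F j) = ψ.comp (chartConst N F j))
    (h2 : ∀ l, φ (chartCoord N F j l) = ψ (chartCoord N F j l)) : φ = ψ := by
  ext z
  obtain ⟨n, a, -, rfl⟩ := exists_isHomogeneous_eval₂ N F j z
  rw [MvPolynomial.hom_eval₂, MvPolynomial.hom_eval₂, h1]
  congr 1
  funext l
  exact h2 l

/-- The ring homomorphism from the coordinate ring of `D₊(x_j)` given by the values of the
coordinates `x_l / x_j`. -/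
def chartLift {R : Type*} [CommRing R] (j : Fin (N + 1)) (φ : F →+* R) (r : Fin (N + 1) → R)
    (hr : r j = 1) : ChartRing N F j →+* R :=
  (Localization.awayLift (MvPolynomial.eval₂Hom φ r) (MvPolynomial.X j) (by simp [hr])).comp
    (algebraMap (ChartRing N F j) (Localization.Away (MvPolynomial.X j)))

variable {N F}

theorem chartLift_chartConst {R : Type*} [CommRing R] (j : Fin (N + 1)) (φ : F →+* R)
    (r : Fin (N + 1) → R) (hr : r j = 1) (a : F) :
    chartLift N F j φ r hr (chartConst N F j a) = φ a := by
  change Localization.awayLift (MvPolynomial.eval₂Hom φ r) _ (by simp [hr])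
    (chartConst N F j a).val = _
  rw [val_chartConst]
  erw [IsLocalization.lift_eq]
  simp

theorem chartLift_chartCoord {R : Type*} [CommRing R] (j : Fin (N + 1)) (φ : F →+* R)
    (r : Fin (N + 1) → R) (hr : r j = 1) (l : Fin (N + 1)) :
    chartLift N F j φ r hr (chartCoord N F j l) = r l := by
  change Localization.awayLift (MvPolynomial.eval₂Hom φ r) _ (by simp [hr])
    (chartCoord N F j l).val = _
  rw [val_chartCoord, Localization.awayLift_mk (v := 1) (hv := by simp [hr])]
  simp

variable (N F)

/-- The standard chart `D₊(x_j)` is affine space. -/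
def chartEquiv (j : Fin (N + 1)) : MvPolynomial (Fin N) F ≃+* ChartRing N F j :=
  RingEquiv.ofRingHom
    (MvPolynomial.eval₂Hom (chartConst N F j) (fun i => chartCoord N F j (j.succAbove i)))
    (chartLift N F j MvPolynomial.C (j.insertNth (α := fun _ => MvPolynomial (Fin N) F)
      1 MvPolynomial.X) (by simp))
    (by
      apply chartRing_hom_ext
      · ext a
        simp [chartLift_chartConst]
      · intro l
        rcases Fin.eq_self_or_eq_succAbove j l with rfl | ⟨i, rfl⟩
        · simp [chartCoord_self]
        · simp [chartLift_chartCoord])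
    (by
      apply MvPolynomial.ringHom_ext
      · intro a
        simp [chartLift_chartConst]
      · intro i
        simp [chartLift_chartCoord])

theorem chartEquiv_C (j : Fin (N + 1)) (a : F) :
    chartEquiv N F j (MvPolynomial.C a) = chartConst N F j a := by
  simp [chartEquiv]

theorem chartEquiv_X (j : Fin (N + 1)) (i : Fin N) :
    chartEquiv N F j (MvPolynomial.X i) = chartCoord N F j (j.succAbove i) := by
  simp [chartEquiv]

theorem chartEquiv_aeval_insertNth (j : Fin (N + 1)) (n : ℕ) (a : MvPolynomial (Fin (N + 1)) F)
    (ha : a.IsHomogeneous n) :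
    chartEquiv N F j (MvPolynomial.aeval
        (j.insertNth (α := fun _ => MvPolynomial (Fin N) F) 1 MvPolynomial.X) a) =
      HomogeneousLocalization.Away.mk (stdGrading N F) (X_mem_stdGrading N F j) n a
        (by simpa using ha) := by
  rw [← eval₂_chartCoord N F j n a ha, MvPolynomial.aeval_def, MvPolynomial.algebraMap_eq]
  have := MvPolynomial.hom_eval₂ a MvPolynomial.C (chartEquiv N F j).toRingHom
    (j.insertNth (α := fun _ => MvPolynomial (Fin N) F) 1 MvPolynomial.X)
  refine Eq.trans this ?_
  congr 1
  · ext a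
    exact congrArg _ (chartEquiv_C N F j a)
  · funext l
    rcases Fin.eq_self_or_eq_succAbove j l with rfl | ⟨i, rfl⟩
    · simp [chartCoord_self]
    · simpa using chartEquiv_X N F j i

/-- The inclusion of the standard chart `D₊(x_j)`. -/
def chartι (j : Fin (N + 1)) : Spec (.of (ChartRing N F j)) ⟶ ProjSpace N F :=
  Proj.awayι (stdGrading N F) (MvPolynomial.X j) (X_mem_stdGrading N F j) Nat.one_pos

instance (j : Fin (N + 1)) : IsOpenImmersion (chartι N F j) :=
  inferInstanceAs (IsOpenImmersion (Proj.awayι _ _ _ _))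

theorem opensRange_chartι (j : Fin (N + 1)) : (chartι N F j).opensRange = (chart N F j).1 :=
  Proj.opensRange_awayι _ _ _ _

theorem chartι_toSpec (j : Fin (N + 1)) :
    chartι N F j ≫ toSpec N F = Spec.map (CommRingCat.ofHom (chartConst N F j)) := by
  unfold chartι toSpec
  erw [Proj.awayι_toSpecZero_assoc]
  rw [← Spec.map_comp]
  rfl

theorem exists_mem_chart (x : ProjSpace N F) : ∃ j, x ∈ (chart N F j).1 := by
  have h : ⨆ j, Proj.basicOpen (stdGrading N F) (MvPolynomial.X j) = ⊤ := by
    apply Proj.iSup_basicOpen_eq_top'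
    · intro j
      exact ⟨1, X_mem_stdGrading N F j⟩
    · rw [eq_top_iff]
      intro p _
      have := MvPolynomial.adjoin_range_X (R := F) (σ := Fin (N + 1))
      have hp : p ∈ Algebra.adjoin F (Set.range (MvPolynomial.X (R := F) (σ := Fin (N + 1)))) := by
        rw [this]; trivial
      induction hp using Algebra.adjoin_induction with
      | mem x hx => exact Algebra.subset_adjoin hx
      | algebraMap r =>
        exact Subalgebra.algebraMap_mem _ (algebraMap F (stdGrading N F 0) r)
      | add x y _ _ hx hy => exact add_mem (hx trivial) (hy trivial)
      | mul x y _ _ hx hy => exact mul_mem (hx trivial) (hy trivial)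
  have hx : x ∈ ⨆ j, Proj.basicOpen (stdGrading N F) (MvPolynomial.X j) := by
    rw [h]; trivial
  exact TopologicalSpace.Opens.mem_iSup.mp hx

theorem exists_chartι_eq (x : ProjSpace N F) : ∃ j z, chartι N F j z = x := by
  obtain ⟨j, hj⟩ := exists_mem_chart N F x
  rw [← opensRange_chartι] at hj
  obtain ⟨z, hz⟩ := hj
  exact ⟨j, z, hz⟩

/-- The cover of projective space by its standard charts. -/
def chartCover : (ProjSpace N F).AffineOpenCover where
  I₀ := Fin (N + 1)
  X j := .of (ChartRing N F j)
  f j := chartι N F j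
  idx x := (exists_chartι_eq N F x).choose
  covers x := (exists_chartι_eq N F x).choose_spec

instance : Algebra.FiniteType (stdGrading N F 0) (MvPolynomial (Fin (N + 1)) F) :=
  have : IsScalarTower F (stdGrading N F 0) (MvPolynomial (Fin (N + 1)) F) :=
    ⟨fun a b c => smul_assoc a b.1 c⟩
  Algebra.FiniteType.of_restrictScalars_finiteType F _ _

theorem algebraMap_stdGrading_bijective :
    Function.Bijective (algebraMap F (stdGrading N F 0)) := by
  constructor
  · intro a b h
    exact MvPolynomial.C_injective _ _ (congrArg Subtype.val h)
  · rintro ⟨p, hp⟩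
    refine ⟨MvPolynomial.coeff 0 p, Subtype.ext ?_⟩
    exact (MvPolynomial.totalDegree_eq_zero_iff_eq_C.mp
      ((MvPolynomial.totalDegree_zero_iff_isHomogeneous _).mpr hp)).symm

instance : IsProper (toSpec N F) := by
  have : IsIso (CommRingCat.ofHom (algebraMap F (stdGrading N F 0))) := by
    exact (RingEquiv.ofBijective _ (algebraMap_stdGrading_bijective N F)).toCommRingCatIso.isIso_hom
  unfold toSpec
  exact inferInstanceAs (IsProper (Proj.toSpecZero (stdGrading N F) ≫ _))

end ProjSpace

/-- The ring homomorphism corresponding to a morphism to an affine scheme. -/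
def toΓ {T : Scheme.{u}} {R : Type u} [CommRing R] (a : T ⟶ Spec (.of R)) : R →+* Γ(T, ⊤) :=
  ((Scheme.ΓSpecIso (.of R)).inv ≫ a.appTop).hom

/-- The morphism to an affine scheme corresponding to a ring homomorphism. -/
def ofΓ {T : Scheme.{u}} {R : Type u} [CommRing R] (ψ : R →+* Γ(T, ⊤)) : T ⟶ Spec (.of R) :=
  T.toSpecΓ ≫ Spec.map (CommRingCat.ofHom ψ)

theorem ofΓ_toΓ {T : Scheme.{u}} {R : Type u} [CommRing R] (a : T ⟶ Spec (.of R)) :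
    ofΓ (toΓ a) = a := by
  unfold ofΓ toΓ
  rw [CommRingCat.ofHom_hom, Spec.map_comp, ← Scheme.toSpecΓ_naturality_assoc,
    ← SpecMap_ΓSpecIso_hom, ← Spec.map_comp]
  simp

theorem toΓ_ofΓ {T : Scheme.{u}} {R : Type u} [CommRing R] (ψ : R →+* Γ(T, ⊤)) :
    toΓ (ofΓ ψ) = ψ := by
  unfold ofΓ toΓ
  rw [Scheme.Hom.comp_appTop, Scheme.toSpecΓ_appTop, Scheme.ΓSpecIso_naturality]
  simp

theorem toΓ_injective {T : Scheme.{u}} {R : Type u} [CommRing R] {a b : T ⟶ Spec (.of R)}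
    (h : toΓ a = toΓ b) : a = b := by
  rw [← ofΓ_toΓ a, h, ofΓ_toΓ]

theorem toΓ_comp {T T' : Scheme.{u}} {R : Type u} [CommRing R] (g : T' ⟶ T)
    (a : T ⟶ Spec (.of R)) : toΓ (g ≫ a) = g.appTop.hom.comp (toΓ a) := rfl

theorem toΓ_comp_specMap {T : Scheme.{u}} {R S : Type u} [CommRing R] [CommRing S]
    (a : T ⟶ Spec (.of S)) (f : R →+* S) :
    toΓ (a ≫ Spec.map (CommRingCat.ofHom f)) = (toΓ a).comp f := by
  unfold toΓ
  rw [Scheme.Hom.comp_appTop, ← Category.assoc, ← Scheme.ΓSpecIso_inv_naturality]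
  rfl

theorem hom_ext_of_forall_exists {T Y : Scheme.{u}} {f g : T ⟶ Y}
    (H : ∀ t : T, ∃ (W : Scheme.{u}) (p : W ⟶ T) (_ : IsOpenImmersion p),
      t ∈ Set.range p ∧ p ≫ f = p ≫ g) : f = g := by
  choose W p hp ht h using H
  let 𝒰 : T.OpenCover := Scheme.openCoverOfIsOpenCover T (fun t => (p t).opensRange)
    (.mk (eq_top_iff.mpr fun t _ => TopologicalSpace.Opens.mem_iSup.mpr ⟨t, ht t⟩))
  refine 𝒰.hom_ext _ _ fun (t : T) => ?_
  change (p t).opensRange.ι ≫ f = (p t).opensRange.ι ≫ g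
  rw [← cancel_epi (p t).isoOpensRange.hom, Scheme.Hom.isoOpensRange_hom_ι_assoc,
    Scheme.Hom.isoOpensRange_hom_ι_assoc, h]

namespace ProjSpace

variable {N : ℕ} {F : Type u} [Field F]

theorem isLocalizationElem_eq_chartCoord (j l : Fin (N + 1)) :
    HomogeneousLocalization.Away.isLocalizationElem (X_mem_stdGrading N F j)
      (X_mem_stdGrading N F l) = chartCoord N F j l := by
  simp [HomogeneousLocalization.Away.isLocalizationElem, chartCoord]

/-- The coordinate ring of the overlap of two standard charts. -/
abbrev OverlapRing (N : ℕ) (F : Type u) [Field F] (j j' : Fin (N + 1)) : Type u :=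
  HomogeneousLocalization.Away (stdGrading N F) (MvPolynomial.X j * MvPolynomial.X j')

/-- The restriction of functions from the first of two charts to their overlap. -/
def overlapLeft (j j' : Fin (N + 1)) : ChartRing N F j →+* OverlapRing N F j j' :=
  HomogeneousLocalization.awayMap (stdGrading N F) (X_mem_stdGrading N F j') rfl

/-- The restriction of functions from the second of two charts to their overlap. -/
def overlapRight (j j' : Fin (N + 1)) : ChartRing N F j' →+* OverlapRing N F j j' :=
  HomogeneousLocalization.awayMap (stdGrading N F) (X_mem_stdGrading N F j) (mul_comm _ _)

theorem overlapLeft_chartCoord (j j' l : Fin (N + 1)) :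
    overlapLeft j j' (chartCoord N F j l) =
      overlapLeft j j' (chartCoord N F j j') * overlapRight j j' (chartCoord N F j' l) := by
  unfold chartCoord overlapLeft overlapRight
  rw [HomogeneousLocalization.awayMap_mk, HomogeneousLocalization.awayMap_mk,
    HomogeneousLocalization.awayMap_mk]
  apply HomogeneousLocalization.val_injective
  rw [HomogeneousLocalization.val_mul, HomogeneousLocalization.Away.val_mk,
    HomogeneousLocalization.Away.val_mk, HomogeneousLocalization.Away.val_mk,
    Localization.mk_mul, Localization.mk_eq_mk_iff, Localization.r_iff_exists]
  refine ⟨1, ?_⟩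
  simp only [OneMemClass.coe_one, Submonoid.coe_mul]
  ring

theorem overlapLeft_comp_chartConst (j j' : Fin (N + 1)) :
    (overlapLeft j j').comp (chartConst N F j) = (overlapRight j j').comp (chartConst N F j') := by
  ext a
  unfold chartConst overlapLeft overlapRight
  simp only [RingHom.comp_apply, HomogeneousLocalization.awayMap_fromZeroRingHom]

theorem exists_lift_overlap {T : Scheme.{u}} {j j' : Fin (N + 1)}
    {a : T ⟶ Spec (.of (ChartRing N F j))} {a' : T ⟶ Spec (.of (ChartRing N F j'))}
    (h : a ≫ chartι N F j = a' ≫ chartι N F j') :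
    ∃ b : T ⟶ Spec (.of (OverlapRing N F j j')),
      a = b ≫ Spec.map (CommRingCat.ofHom (overlapLeft j j')) ∧
        a' = b ≫ Spec.map (CommRingCat.ofHom (overlapRight j j')) := by
  let e := Proj.pullbackAwayιIso (stdGrading N F) (X_mem_stdGrading N F j) Nat.one_pos
    (X_mem_stdGrading N F j') Nat.one_pos rfl
  let c := pullback.lift (f := Proj.awayι (stdGrading N F) (MvPolynomial.X j) _ Nat.one_pos)
    (g := Proj.awayι (stdGrading N F) (MvPolynomial.X j') _ Nat.one_pos) a a' h
  refine ⟨c ≫ e.hom, Eq.trans ?_ (Category.assoc c e.hom _).symm,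
    Eq.trans ?_ (Category.assoc c e.hom _).symm⟩
  · refine (pullback.lift_fst a a' h).symm.trans (congrArg (c ≫ ·) ?_)
    exact (Proj.pullbackAwayιIso_hom_SpecMap_awayMap_left ..).symm
  · refine (pullback.lift_snd a a' h).symm.trans (congrArg (c ≫ ·) ?_)
    exact (Proj.pullbackAwayιIso_hom_SpecMap_awayMap_right ..).symm

theorem specMap_overlap_comp_chartι (j j' : Fin (N + 1)) :
    Spec.map (CommRingCat.ofHom (overlapLeft j j')) ≫ chartι N F j =
      Spec.map (CommRingCat.ofHom (overlapRight j j')) ≫ chartι N F j' := by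
  have hleft := Proj.SpecMap_awayMap_awayι (stdGrading N F) (X_mem_stdGrading N F j) Nat.one_pos
    (X_mem_stdGrading N F j') (rfl : (MvPolynomial.X j * MvPolynomial.X j' : _) = _)
  have hright := Proj.SpecMap_awayMap_awayι (stdGrading N F) (X_mem_stdGrading N F j') Nat.one_pos
    (X_mem_stdGrading N F j) (mul_comm (MvPolynomial.X j) (MvPolynomial.X j'))
  exact hleft.trans hright.symm

theorem exists_overlap_hom {A : Type*} [CommRing A] {j j' : Fin (N + 1)}
    {φ : ChartRing N F j →+* A} {φ' : ChartRing N F j' →+* A}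
    (hconst : φ.comp (chartConst N F j) = φ'.comp (chartConst N F j'))
    (hcoord : ∀ l, φ (chartCoord N F j l) = φ (chartCoord N F j j') * φ' (chartCoord N F j' l)) :
    ∃ ψ : OverlapRing N F j j' →+* A,
      ψ.comp (overlapLeft j j') = φ ∧ ψ.comp (overlapRight j j') = φ' := by
  have hunit : IsUnit (φ (chartCoord N F j j')) :=
    .of_mul_eq_one (φ' (chartCoord N F j' j)) (by rw [← hcoord j, chartCoord_self, map_one])
  let := (overlapLeft (F := F) j j').toAlgebra
  have : IsLocalization.Away (chartCoord N F j j') (OverlapRing N F j j') := by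
    rw [← isLocalizationElem_eq_chartCoord]
    exact HomogeneousLocalization.Away.isLocalization_mul (X_mem_stdGrading N F j)
      (X_mem_stdGrading N F j') rfl one_ne_zero
  let ψ : OverlapRing N F j j' →+* A := IsLocalization.Away.lift (chartCoord N F j j') hunit
  have hleft : ψ.comp (overlapLeft j j') = φ :=
    IsLocalization.Away.lift_comp (chartCoord N F j j') hunit
  refine ⟨ψ, hleft, chartRing_hom_ext _ _ ?_ fun l => hunit.mul_left_cancel ?_⟩
  · rw [← hconst, ← hleft, RingHom.comp_assoc, RingHom.comp_assoc, overlapLeft_comp_chartConst]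
  · rw [← hcoord l, ← hleft]
    simp only [RingHom.comp_apply]
    rw [← map_mul, ← overlapLeft_chartCoord]

theorem comp_chartι_eq_iff {T : Scheme.{u}} {j j' : Fin (N + 1)}
    (a : T ⟶ Spec (.of (ChartRing N F j))) (a' : T ⟶ Spec (.of (ChartRing N F j'))) :
    a ≫ chartι N F j = a' ≫ chartι N F j' ↔
      (toΓ a).comp (chartConst N F j) = (toΓ a').comp (chartConst N F j') ∧
      ∀ l, toΓ a (chartCoord N F j l) = toΓ a (chartCoord N F j j') *
        toΓ a' (chartCoord N F j' l) := by
  refine ⟨fun h => ?_, fun ⟨hconst, hcoord⟩ => ?_⟩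
  · obtain ⟨b, rfl, rfl⟩ := exists_lift_overlap h
    simp only [toΓ_comp_specMap, RingHom.comp_assoc, overlapLeft_comp_chartConst,
      RingHom.comp_apply, ← map_mul, ← overlapLeft_chartCoord, implies_true, and_self]
  · obtain ⟨ψ, hleft, hright⟩ := exists_overlap_hom hconst hcoord
    rw [← ofΓ_toΓ a, ← ofΓ_toΓ a', ← hleft, ← hright]
    simp only [ofΓ, CommRingCat.ofHom_comp, Spec.map_comp, Category.assoc,
      specMap_overlap_comp_chartι]

/-! ### The Segre embedding -/

section Segre

theorem mul_eq_mul_mul_mul_iff {ι κ A : Type*} [CommRing A] {x x' : ι → A} {y y' : κ → A}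
    {i i' : ι} {k k' : κ} (hx : x i = 1) (hy : y k = 1) (hx' : x' i' = 1) (hy' : y' k' = 1) :
    (∀ p q, x p * y q = x i' * y k' * (x' p * y' q)) ↔
      (∀ p, x p = x i' * x' p) ∧ ∀ q, y q = y k' * y' q := by
  refine ⟨fun h => ⟨fun p => ?_, fun q => ?_⟩, fun ⟨h, h'⟩ p q => ?_⟩
  · have hp := h p k
    have hi' := h i' k
    rw [hy, mul_one] at hp hi'
    rw [hx', one_mul] at hi'
    linear_combination hp - x' p * hi'
  · have hq := h i q
    have hk' := h i k'
    rw [hx, one_mul] at hq hk'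
    rw [hy', mul_one] at hk'
    linear_combination hq - y' q * hk'
  · rw [h p, h' q]
    ring

variable (N F) (M : ℕ)

/-- The product of two standard charts. -/
abbrev prodChart (j : Fin (N + 1)) (l : Fin (M + 1)) : Scheme.{u} :=
  pullback (chartι N F j ≫ toSpec N F) (chartι M F l ≫ toSpec M F)

/-- The first projection on a product of standard charts. -/
def prodChartFst (j : Fin (N + 1)) (l : Fin (M + 1)) :
    prodChart N F M j l ⟶ Spec (.of (ChartRing N F j)) :=
  pullback.fst (chartι N F j ≫ toSpec N F) (chartι M F l ≫ toSpec M F)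

/-- The second projection on a product of standard charts. -/
def prodChartSnd (j : Fin (N + 1)) (l : Fin (M + 1)) :
    prodChart N F M j l ⟶ Spec (.of (ChartRing M F l)) :=
  pullback.snd (chartι N F j ≫ toSpec N F) (chartι M F l ≫ toSpec M F)

/-- The inclusion of a product of standard charts. -/
def prodChartι (j : Fin (N + 1)) (l : Fin (M + 1)) :
    prodChart N F M j l ⟶ pullback (toSpec N F) (toSpec M F) :=
  pullback.map _ _ _ _ (chartι N F j) (chartι M F l) (𝟙 _) (Category.comp_id _)
    (Category.comp_id _)

/-- The cover of `ℙᴺ × ℙᴹ` by products of standard charts. -/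
def prodCover : (pullback (toSpec N F) (toSpec M F)).OpenCover :=
  Scheme.Pullback.openCoverOfLeftRight (chartCover N F).openCover (chartCover M F).openCover _ _

instance (j : Fin (N + 1)) (l : Fin (M + 1)) : IsOpenImmersion (prodChartι N F M j l) :=
  (prodCover N F M).map_prop (j, l)

theorem exists_prodChartι_eq (x : ↥(pullback (toSpec N F) (toSpec M F))) :
    ∃ j l, x ∈ Set.range (prodChartι N F M j l) :=
  ⟨((prodCover N F M).idx x).1, ((prodCover N F M).idx x).2, (prodCover N F M).covers x⟩

theorem prodChartι_hom_ext {Y : Scheme.{u}} {f g : pullback (toSpec N F) (toSpec M F) ⟶ Y}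
    (h : ∀ j l, prodChartι N F M j l ≫ f = prodChartι N F M j l ≫ g) : f = g :=
  (prodCover N F M).hom_ext _ _ fun x => h x.1 x.2

theorem exists_glue_prodChart {Y : Scheme.{u}} (f : ∀ j l, prodChart N F M j l ⟶ Y)
    (h : ∀ j l j' l', pullback.fst (prodChartι N F M j l) (prodChartι N F M j' l') ≫ f j l =
      pullback.snd (prodChartι N F M j l) (prodChartι N F M j' l') ≫ f j' l') :
    ∃ g : pullback (toSpec N F) (toSpec M F) ⟶ Y, ∀ j l, prodChartι N F M j l ≫ g = f j l :=
  ⟨(prodCover N F M).glueMorphisms (fun x => f x.1 x.2) fun x y => h x.1 x.2 y.1 y.2,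
    fun j l => (prodCover N F M).ι_glueMorphisms _ _ (j, l)⟩

theorem prodChartι_fst (j : Fin (N + 1)) (l : Fin (M + 1)) :
    prodChartι N F M j l ≫ pullback.fst (toSpec N F) (toSpec M F) =
      prodChartFst N F M j l ≫ chartι N F j :=
  pullback.lift_fst _ _ _

theorem prodChartι_snd (j : Fin (N + 1)) (l : Fin (M + 1)) :
    prodChartι N F M j l ≫ pullback.snd (toSpec N F) (toSpec M F) =
      prodChartSnd N F M j l ≫ chartι M F l :=
  pullback.lift_snd _ _ _

theorem prodChart_const (j : Fin (N + 1)) (l : Fin (M + 1)) :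
    (toΓ (prodChartFst N F M j l)).comp (chartConst N F j) =
      (toΓ (prodChartSnd N F M j l)).comp (chartConst M F l) := by
  rw [← toΓ_comp_specMap, ← toΓ_comp_specMap, ← chartι_toSpec, ← chartι_toSpec]
  exact congrArg toΓ pullback.condition

variable {L : ℕ} (e : Fin (N + 1) × Fin (M + 1) ≃ Fin (L + 1))

/-- The Segre map on a product of standard charts. -/
def segreChart (j : Fin (N + 1)) (l : Fin (M + 1)) :
    prodChart N F M j l ⟶ Spec (.of (ChartRing L F (e (j, l)))) :=
  ofΓ (chartLift L F (e (j, l)) ((toΓ (prodChartFst N F M j l)).comp (chartConst N F j))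
    (fun m => toΓ (prodChartFst N F M j l) (chartCoord N F j (e.symm m).1) *
      toΓ (prodChartSnd N F M j l) (chartCoord M F l (e.symm m).2))
    (by simp [chartCoord_self]))

theorem toΓ_comp_segreChart_const {T : Scheme.{u}} (j : Fin (N + 1)) (l : Fin (M + 1))
    (a : T ⟶ prodChart N F M j l) :
    (toΓ (a ≫ segreChart N F M e j l)).comp (chartConst L F (e (j, l))) =
      (toΓ (a ≫ prodChartFst N F M j l)).comp (chartConst N F j) := by
  rw [toΓ_comp, toΓ_comp, segreChart, toΓ_ofΓ]
  ext c
  simp only [RingHom.comp_apply, chartLift_chartConst]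

theorem toΓ_comp_segreChart_coord {T : Scheme.{u}} (j : Fin (N + 1)) (l : Fin (M + 1))
    (a : T ⟶ prodChart N F M j l) (p : Fin (N + 1)) (q : Fin (M + 1)) :
    toΓ (a ≫ segreChart N F M e j l) (chartCoord L F (e (j, l)) (e (p, q))) =
      toΓ (a ≫ prodChartFst N F M j l) (chartCoord N F j p) *
      toΓ (a ≫ prodChartSnd N F M j l) (chartCoord M F l q) := by
  rw [toΓ_comp, toΓ_comp, toΓ_comp, segreChart, toΓ_ofΓ]
  simp only [RingHom.comp_apply, chartLift_chartCoord, map_mul, Equiv.symm_apply_apply]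

theorem comp_prodChartι_eq_iff {T : Scheme.{u}} (j j' : Fin (N + 1)) (l l' : Fin (M + 1))
    (a : T ⟶ prodChart N F M j l) (b : T ⟶ prodChart N F M j' l') :
    a ≫ prodChartι N F M j l = b ≫ prodChartι N F M j' l' ↔
      (a ≫ prodChartFst N F M j l) ≫ chartι N F j =
          (b ≫ prodChartFst N F M j' l') ≫ chartι N F j' ∧
        (a ≫ prodChartSnd N F M j l) ≫ chartι M F l =
          (b ≫ prodChartSnd N F M j' l') ≫ chartι M F l' := by
  simp only [Category.assoc, ← prodChartι_fst, ← prodChartι_snd]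
  simp only [← Category.assoc]
  refine ⟨fun h => ?_, fun ⟨h, h'⟩ => pullback.hom_ext h h'⟩
  simp only [h, and_self]

theorem comp_segreChart_eq_iff {T : Scheme.{u}} (j j' : Fin (N + 1)) (l l' : Fin (M + 1))
    (a : T ⟶ prodChart N F M j l) (b : T ⟶ prodChart N F M j' l') :
    a ≫ segreChart N F M e j l ≫ chartι L F (e (j, l)) =
        b ≫ segreChart N F M e j' l' ≫ chartι L F (e (j', l')) ↔
      a ≫ prodChartι N F M j l = b ≫ prodChartι N F M j' l' := by
  have hconst {j : Fin (N + 1)} {l : Fin (M + 1)} (a : T ⟶ prodChart N F M j l) :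
      (toΓ (a ≫ prodChartSnd N F M j l)).comp (chartConst M F l) =
        (toΓ (a ≫ prodChartFst N F M j l)).comp (chartConst N F j) := by
    rw [toΓ_comp, toΓ_comp, RingHom.comp_assoc, RingHom.comp_assoc, prodChart_const]
  rw [comp_prodChartι_eq_iff, ← Category.assoc, ← Category.assoc, comp_chartι_eq_iff,
    comp_chartι_eq_iff, comp_chartι_eq_iff, ← e.forall_congr_right, Prod.forall]
  simp only [toΓ_comp_segreChart_const, toΓ_comp_segreChart_coord, hconst]
  rw [mul_eq_mul_mul_mul_iff (by rw [chartCoord_self, map_one])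
    (by rw [chartCoord_self, map_one]) (by rw [chartCoord_self, map_one])
    (by rw [chartCoord_self, map_one])]
  tauto

theorem exists_segre : ∃ g : pullback (toSpec N F) (toSpec M F) ⟶ ProjSpace L F,
    ∀ j l, prodChartι N F M j l ≫ g = segreChart N F M e j l ≫ chartι L F (e (j, l)) :=
  exists_glue_prodChart N F M (fun j l => segreChart N F M e j l ≫ chartι L F (e (j, l)))
    fun j l j' l' => (comp_segreChart_eq_iff N F M e j j' l l' _ _).mpr pullback.condition

/-- The Segre map. -/
def segre : pullback (toSpec N F) (toSpec M F) ⟶ ProjSpace L F :=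
  (exists_segre N F M e).choose

theorem prodChartι_segre (j : Fin (N + 1)) (l : Fin (M + 1)) :
    prodChartι N F M j l ≫ segre N F M e = segreChart N F M e j l ≫ chartι L F (e (j, l)) :=
  (exists_segre N F M e).choose_spec j l

theorem segre_toSpec :
    segre N F M e ≫ toSpec L F = pullback.fst (toSpec N F) (toSpec M F) ≫ toSpec N F := by
  apply prodChartι_hom_ext
  intro j l
  rw [← Category.assoc, prodChartι_segre, Category.assoc, chartι_toSpec, ← Category.assoc,
    prodChartι_fst, Category.assoc, chartι_toSpec]
  apply toΓ_injective
  rw [toΓ_comp_specMap, toΓ_comp_specMap]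
  simpa using toΓ_comp_segreChart_const N F M e j l (𝟙 _)

theorem exists_lift_prodChart {T : Scheme.{u}} (a : T ⟶ pullback (toSpec N F) (toSpec M F))
    (t : T) : ∃ (W : Scheme.{u}) (p : W ⟶ T) (_ : IsOpenImmersion p) (j : Fin (N + 1))
      (l : Fin (M + 1)) (α : W ⟶ prodChart N F M j l),
      t ∈ Set.range p ∧ p ≫ a = α ≫ prodChartι N F M j l := by
  obtain ⟨j, l, h⟩ := exists_prodChartι_eq N F M (a t)
  refine ⟨pullback a (prodChartι N F M j l), pullback.fst _ _, inferInstance, j, l,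
    pullback.snd _ _, ?_, pullback.condition⟩
  rw [IsOpenImmersion.range_pullbackFst]
  exact h

instance mono_segre : Mono (segre N F M e) := by
  constructor
  intro T a b h
  apply hom_ext_of_forall_exists
  intro t
  obtain ⟨W, p, _, j, l, α, ⟨w, rfl⟩, hα⟩ := exists_lift_prodChart N F M a t
  obtain ⟨W', p', _, j', l', β, ⟨w', rfl⟩, hβ⟩ := exists_lift_prodChart N F M (p ≫ b) w
  refine ⟨W', p' ≫ p, inferInstance, ⟨w', by simp⟩, ?_⟩
  rw [Category.assoc, Category.assoc, hα, hβ, ← Category.assoc]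
  refine (comp_segreChart_eq_iff N F M e j j' l l' _ _).mp ?_
  rw [← prodChartι_segre, ← prodChartι_segre, Category.assoc, ← reassoc_of% hα,
    ← reassoc_of% hβ, h]

instance isClosedImmersion_segre : IsClosedImmersion (segre N F M e) := by
  rw [IsClosedImmersion.iff_isProper_and_mono]
  refine ⟨?_, inferInstance⟩
  have : IsProper (segre N F M e ≫ toSpec L F) := by
    rw [segre_toSpec]
    infer_instance
  exact IsProper.of_comp (segre N F M e) (toSpec L F)

end Segre

theorem isAffineOpen_chart (N : ℕ) (F : Type u) [Field F] (j : Fin (N + 1)) :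
    IsAffineOpen (chart N F j).1 :=
  (chart N F j).2

/-- The identification of the coordinate ring of a standard chart with the ring of sections. -/
def chartToSection (N : ℕ) (F : Type u) [Field F] (j : Fin (N + 1)) :
    CommRingCat.of (ChartRing N F j) ⟶ Γ(ProjSpace N F, (chart N F j).1) :=
  Proj.awayToSection (stdGrading N F) (MvPolynomial.X j)

instance (N : ℕ) (F : Type u) [Field F] (j : Fin (N + 1)) : IsIso (chartToSection N F j) :=
  (Proj.basicOpenIsoAway (stdGrading N F) _ (X_mem_stdGrading N F j) Nat.one_pos).isIso_hom

theorem fromSpec_chart (N : ℕ) (F : Type u) [Field F] (j : Fin (N + 1)) :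
    (isAffineOpen_chart N F j).fromSpec = Spec.map (chartToSection N F j) ≫ chartι N F j := by
  rw [← cancel_epi (isAffineOpen_chart N F j).isoSpec.hom, IsAffineOpen.isoSpec_hom,
    IsAffineOpen.toSpecΓ_fromSpec]
  have h : Proj.basicOpenToSpec (stdGrading N F) (MvPolynomial.X j) ≫
      Proj.awayι (stdGrading N F) _ (X_mem_stdGrading N F j) Nat.one_pos =
      (Proj.basicOpen (stdGrading N F) (MvPolynomial.X j)).ι := by
    rw [← Proj.basicOpenIsoSpec_inv_ι, ← Proj.basicOpenIsoSpec_hom _ _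
      (X_mem_stdGrading N F j) Nat.one_pos, Iso.hom_inv_id_assoc]
  rw [← Category.assoc]
  exact h.symm

theorem chartι_preimage_chart (N : ℕ) (F : Type u) [Field F] (j l : Fin (N + 1)) :
    chartι N F j ⁻¹ᵁ (chart N F l).1 = PrimeSpectrum.basicOpen (chartCoord N F j l) := by
  have h := Proj.awayι_preimage_basicOpen (stdGrading N F) (X_mem_stdGrading N F j) Nat.one_pos
    (X_mem_stdGrading N F l) Nat.one_pos
  rw [isLocalizationElem_eq_chartCoord] at h
  exact h

end ProjSpace

/-! ### Plane conics as unions of affine conics -/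

namespace ProjSpace

open MvPolynomial in
theorem exists_chart_of_ker_ideal_eq {N : ℕ} {F : Type u} [Field F] {Z : Scheme.{u}}
    (i : Z ⟶ ProjSpace N F) [IsClosedImmersion i] (j : Fin (N + 1))
    (I : Ideal (MvPolynomial (Fin N) F))
    (hI : i.ker.ideal (chart N F j) =
      I.map ((chartToSection N F j).hom.comp (chartEquiv N F j : _ →+* _))) :
    ∃ (ι : Spec (.of (MvPolynomial (Fin N) F ⧸ I)) ⟶ Z) (_ : IsOpenImmersion ι),
      ι.opensRange = i ⁻¹ᵁ (chart N F j).1 ∧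
      ι ≫ i = Spec.map (CommRingCat.ofHom
        ((Ideal.Quotient.mk I).comp ((chartEquiv N F j).symm : _ →+* _))) ≫ chartι N F j := by
  have hU : IsAffineOpen (i ⁻¹ᵁ (chart N F j).1) := (isAffineOpen_chart N F j).preimage i
  let a : MvPolynomial (Fin N) F →+* Γ(ProjSpace N F, (chart N F j).1) :=
    (chartToSection N F j).hom.comp (chartEquiv N F j : _ →+* _)
  have ha : Function.Bijective a :=
    (ConcreteCategory.bijective_of_isIso (chartToSection N F j)).comp (chartEquiv N F j).bijective
  let φ : MvPolynomial (Fin N) F →+* Γ(Z, i ⁻¹ᵁ (chart N F j).1) :=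
    (i.app (chart N F j).1).hom.comp a
  have hφ : Function.Surjective φ :=
    (i.app_surjective _ (isAffineOpen_chart N F j)).comp ha.2
  have hker : RingHom.ker φ = I :=
    calc RingHom.ker φ = Ideal.comap a (i.ker.ideal (chart N F j)) := by
          rw [Scheme.Hom.ker_apply]; rfl
      _ = I := by rw [hI]; exact Ideal.comap_map_of_bijective _ ha
  let e : (MvPolynomial (Fin N) F ⧸ I) ≃+* Γ(Z, i ⁻¹ᵁ (chart N F j).1) :=
    (Ideal.quotEquivOfEq hker.symm).trans (RingHom.quotientKerEquivOfSurjective hφ)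
  have he (p) : e.symm (φ p) = Ideal.Quotient.mk I p := (e.symm_apply_eq).mpr rfl
  refine ⟨Spec.map e.symm.toCommRingCatIso.hom ≫ hU.fromSpec, inferInstance, ?_, ?_⟩
  · rw [Scheme.Hom.opensRange_comp_of_isIso, IsAffineOpen.opensRange_fromSpec]
  · rw [Category.assoc, ← (isAffineOpen_chart N F j).SpecMap_appLE_fromSpec i hU le_rfl,
      fromSpec_chart, ← Spec.map_comp_assoc, ← Spec.map_comp_assoc]
    congr 2
    ext z
    obtain ⟨p, rfl⟩ := (chartEquiv N F j).surjective z
    rw [show i.appLE (chart N F j).1 (i ⁻¹ᵁ (chart N F j).1) le_rfl = i.app (chart N F j).1 from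
      Scheme.Hom.appLE_eq_app i]
    refine (he p).trans ?_
    simp

end ProjSpace

/-- The `F`-scheme `Z` is the union of the three affine conics given by a nonzero ternary quadratic
form; `ι j` is the inclusion of the chart where the `j`-th homogeneous coordinate is nonzero. -/
structure IsConicAtlas {F : Type u} [Field F] {Z : Scheme.{u}} (s : Z ⟶ Spec (.of F))
    (Q : TernaryForm F) (ι : ∀ j : Fin 3, Spec (.of (Q.chart j).CoordRing) ⟶ Z) : Prop where
  ne_zero : Q ≠ 0
  isOpenImmersion : ∀ j, IsOpenImmersion (ι j)
  ι_comp : ∀ j, ι j ≫ s = Spec.map (CommRingCat.ofHom (algebraMap F (Q.chart j).CoordRing))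
  exists_mem_range : ∀ z : Z, ∃ j, z ∈ Set.range (ι j)
  mem_range : ∀ (j : Fin 3) (i : Fin 2) (p : Spec (.of (Q.chart j).CoordRing)),
    Ideal.Quotient.mk (Ideal.span {(Q.chart j).poly}) (MvPolynomial.X i) ∉ p.asIdeal →
    ι j p ∈ Set.range (ι (j.succAbove i))

open ProjSpace in
theorem IsPlaneConic.exists_isConicAtlas {F : Type u} [Field F] {Z : Scheme.{u}}
    {s : Z ⟶ Spec (.of F)} (h : IsPlaneConic s) : ∃ Q ι, IsConicAtlas s Q ι := by
  obtain ⟨q, hq, i, hq0, hi, his, hker⟩ := h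
  obtain ⟨Q, rfl⟩ := TernaryForm.exists_eq_homogenization hq
  have hchart (j : Fin 3) : dehomogenize 2 F 2 Q.homogenization hq j =
      (chartToSection 2 F j).hom (chartEquiv 2 F j (Q.chart j).poly) := by
    rw [← TernaryForm.aeval_insertNth_homogenization, chartEquiv_aeval_insertNth 2 F j 2 _ hq]
    rfl
  choose ι hι hrange hιi using fun j => exists_chart_of_ker_ideal_eq i j
    (Ideal.span {(Q.chart j).poly}) (by
      rw [hker, hchart, Ideal.map_span, Set.image_singleton]; rfl)
  have mem_range_iff (j) (z : Z) : z ∈ Set.range (ι j) ↔ i z ∈ (chart 2 F j).1 :=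
    SetLike.ext_iff.mp (hrange j) z
  refine ⟨Q, ι, fun hQ => hq0 (hQ ▸ TernaryForm.homogenization_zero), hι,
    fun j => ?_, fun z => ?_, fun j l p hp => ?_⟩
  · rw [← his, ← Category.assoc, hιi, Category.assoc, chartι_toSpec, ← Spec.map_comp]
    congr 1
    ext c
    change Ideal.Quotient.mk _ ((chartEquiv 2 F j).symm (chartConst 2 F j c)) = _
    rw [← chartEquiv_C, RingEquiv.symm_apply_apply]
    rfl
  · simpa only [mem_range_iff] using exists_mem_chart 2 F (i z)
  · rw [mem_range_iff, ← Scheme.Hom.comp_apply, hιi, Scheme.Hom.comp_apply]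
    change _ ∈ chartι 2 F j ⁻¹ᵁ (chart 2 F (j.succAbove l)).1
    rw [chartι_preimage_chart, ← chartEquiv_X]
    change Ideal.Quotient.mk _
      ((chartEquiv 2 F j).symm (chartEquiv 2 F j (MvPolynomial.X l))) ∉ p.asIdeal
    rwa [RingEquiv.symm_apply_apply]

theorem isIntegral_of_iso {X Y : Scheme.{u}} (e : X ≅ Y) [IsIntegral X] : IsIntegral Y := by
  have : Nonempty Y := ⟨e.hom (Classical.arbitrary X)⟩
  exact isIntegral_of_isOpenImmersion e.inv

theorem isReduced_of_forall_exists {Z : Scheme.{u}} {I : Type*} {U : I → Scheme.{u}}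
    (g : ∀ j, U j ⟶ Z) [∀ j, IsOpenImmersion (g j)] [∀ j, IsReduced (U j)]
    (hcov : ∀ z : Z, ∃ j, z ∈ Set.range (g j)) : IsReduced Z := by
  have (z : Z) : _root_.IsReduced (Z.presheaf.stalk z) := by
    obtain ⟨j, u, rfl⟩ := hcov z
    exact isReduced_of_injective _ (ConcreteCategory.bijective_of_isIso ((g j).stalkMap u)).1
  exact isReduced_of_isReduced_stalk Z

theorem isPreirreducible_univ_of_forall_exists {Z : Type*} [TopologicalSpace Z] {I : Type*}
    {A : I → Set Z} (hopen : ∀ j, IsOpen (A j)) (hirr : ∀ j, IsPreirreducible (A j))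
    (hcov : ∀ z : Z, ∃ j, z ∈ A j) (hmeet : ∀ j l, (A j ∩ A l).Nonempty) :
    IsPreirreducible (Set.univ : Set Z) := by
  rintro V W hV hW ⟨v, -, hv⟩ ⟨w, -, hw⟩
  obtain ⟨j, hj⟩ := hcov v
  obtain ⟨l, hl⟩ := hcov w
  obtain ⟨z, -, hzl, hzV⟩ := hirr j (A l) V (hopen l) hV (hmeet j l) ⟨v, hj, hv⟩
  obtain ⟨y, -, hy⟩ := hirr l V W hV hW ⟨z, hzl, hzV⟩ ⟨w, hl, hw⟩
  exact ⟨y, trivial, hy⟩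

theorem isIntegral_of_forall_exists {Z : Scheme.{u}} {I : Type*} [Nonempty I] {U : I → Scheme.{u}}
    (g : ∀ j, U j ⟶ Z) [∀ j, IsOpenImmersion (g j)] [∀ j, IsIntegral (U j)]
    (hcov : ∀ z : Z, ∃ j, z ∈ Set.range (g j))
    (hmeet : ∀ j l, (Set.range (g j) ∩ Set.range (g l)).Nonempty) : IsIntegral Z := by
  have : IsReduced Z := isReduced_of_forall_exists g hcov
  have hpre := isPreirreducible_univ_of_forall_exists (fun j => (g j).opensRange.2) (fun j => by
    change IsPreirreducible (Set.range (g j))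
    rw [← Set.image_univ]
    exact PreirreducibleSpace.isPreirreducible_univ.image _ (g j).continuous.continuousOn)
    hcov hmeet
  have : IrreducibleSpace Z :=
    { toPreirreducibleSpace := ⟨hpre⟩
      toNonempty := (hmeet (Classical.arbitrary I) (Classical.arbitrary I)).to_type }
  exact isIntegral_of_irreducibleSpace_of_isReduced Z

theorem nonempty_stalk_equiv_localization (R : Type u) [CommRing R] (p : Ideal R) [hp : p.IsPrime] :
    Nonempty ((Spec (.of R)).presheaf.stalk ⟨p, hp⟩ ≃+* Localization.AtPrime p) :=
  have : IsLocalization p.primeCompl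
      ((Spec.structureSheaf R).presheaf.stalk (⟨p, hp⟩ : PrimeSpectrum R)) :=
    StructureSheaf.IsLocalization.to_stalk R ⟨p, hp⟩
  ⟨(IsLocalization.algEquiv p.primeCompl
    ((Spec.structureSheaf R).presheaf.stalk (⟨p, hp⟩ : PrimeSpectrum R))
    (Localization.AtPrime p)).toRingEquiv⟩

theorem range_eq_preimage_of_isPullback {P X Y S : Scheme.{u}} {f : P ⟶ X} {g : P ⟶ Y}
    {i : X ⟶ S} {p : Y ⟶ S} [IsOpenImmersion i] (h : IsPullback f g i p) :
    Set.range g = p ⁻¹' Set.range i := by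
  refine Eq.trans ?_ (IsOpenImmersion.range_pullbackSnd i p)
  rw [← h.isoPullback_hom_snd, Scheme.Hom.comp_base, TopCat.coe_comp, Set.range_comp,
    Set.range_eq_univ.mpr h.isoPullback.hom.surjective, Set.image_univ]

namespace IsConicAtlas

variable {F : Type u} [Field F] {Z : Scheme.{u}} {s : Z ⟶ Spec (.of F)} {Q : TernaryForm F}
  {ι : ∀ j : Fin 3, Spec (.of (Q.chart j).CoordRing) ⟶ Z}

theorem disc_ne_zero (hA : IsConicAtlas s Q ι) [NeZero (2 : F)] (hZ : IsNormalScheme Z) :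
    Q.disc ≠ 0 := by
  refine TernaryForm.disc_ne_zero hA.ne_zero fun j p hp => ?_
  let y : Spec (.of (Q.chart j).CoordRing) := ⟨p, hp⟩
  have := hA.isOpenImmersion j
  have e := (asIso ((ι j).stalkMap y)).commRingCatIsoToRingEquiv
  obtain ⟨e'⟩ := nonempty_stalk_equiv_localization (Q.chart j).CoordRing p
  exact (hZ (ι j y)).of_ringEquiv (e.trans e')

theorem isDomain_coordRing_chart (hQ : Q.disc ≠ 0) (j : Fin 3) : IsDomain (Q.chart j).CoordRing :=
  have : (Ideal.span {(Q.chart j).poly}).IsPrime :=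
    TernaryForm.isPrime_span_poly (by rwa [TernaryForm.disc_chart])
  Ideal.Quotient.isDomain _

theorem range_inter_range_nonempty (hA : IsConicAtlas s Q ι) (hQ : Q.disc ≠ 0) (j l : Fin 3) :
    (Set.range (ι j) ∩ Set.range (ι l)).Nonempty := by
  have := isDomain_coordRing_chart hQ j
  let p : Spec (.of (Q.chart j).CoordRing) := ⟨⊥, Ideal.isPrime_bot⟩
  refine ⟨ι j p, ⟨p, rfl⟩, ?_⟩
  rcases Fin.eq_self_or_eq_succAbove j l with rfl | ⟨i, rfl⟩
  · exact ⟨p, rfl⟩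
  · refine hA.mem_range j i p fun (h : _ = 0) => ?_
    have hd : (Q.chart j).disc ≠ 0 := by rwa [TernaryForm.disc_chart]
    exact TernaryForm.mk_X_sub_C_ne_zero hd i 0 (by rwa [map_zero, sub_zero])

theorem nonempty_of_charts (ι : ∀ j, Spec (.of (Q.chart j).CoordRing) ⟶ Z) : Nonempty Z := by
  obtain ⟨j, hj⟩ := Q.exists_not_isUnit_poly
  have : Nontrivial (Q.chart j).CoordRing := by
    apply Ideal.Quotient.nontrivial_iff.mpr
    rwa [Ne, Ideal.span_singleton_eq_top]
  exact ⟨ι j (Classical.arbitrary (PrimeSpectrum (Q.chart j).CoordRing))⟩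

theorem isIntegral (hA : IsConicAtlas s Q ι) (hQ : Q.disc ≠ 0) : IsIntegral Z := by
  have := hA.isOpenImmersion
  have := isDomain_coordRing_chart hQ
  exact isIntegral_of_forall_exists ι hA.exists_mem_range (hA.range_inter_range_nonempty hQ)

theorem exists_chart_of_isPullback (hA : IsConicAtlas s Q ι) {K : Type u} [Field K] {φ : F →+* K}
    {Z' : Scheme.{u}} {w : Z' ⟶ Z} {s' : Z' ⟶ Spec (.of K)}
    (hP : IsPullback w s' s (Spec.map (CommRingCat.ofHom φ))) (j : Fin 3) :
    ∃ (ι' : Spec (.of ((Q.map φ).chart j).CoordRing) ⟶ Z')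
      (c : (Q.chart j).CoordRing →+* ((Q.map φ).chart j).CoordRing),
      (∀ p, c (Ideal.Quotient.mk _ p) = Ideal.Quotient.mk _ (MvPolynomial.map φ p)) ∧
      IsPullback (Spec.map (CommRingCat.ofHom c)) ι' (ι j) w ∧
      ι' ≫ s' =
        Spec.map (CommRingCat.ofHom (algebraMap K ((Q.map φ).chart j).CoordRing)) := by
  rw [TernaryForm.map_chart]
  have hpb := isPullback_SpecMap_of_isPushout _ _ _ _ ((Q.chart j).isPushout_coordRing φ)
  rw [← hA.ι_comp] at hpb
  let ι' : Spec (.of ((Q.chart j).map φ).CoordRing) ⟶ Z' := hP.lift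
    (Spec.map (CommRingCat.ofHom ((Q.chart j).coordRingMap φ)) ≫ ι j)
    (Spec.map (CommRingCat.ofHom (algebraMap K _))) (by rw [Category.assoc, hpb.w])
  have hι' : ι' ≫ s' = Spec.map (CommRingCat.ofHom (algebraMap K _)) := hP.lift_snd _ _ _
  refine ⟨ι', _, (Q.chart j).coordRingMap_mk φ, ?_, hι'⟩
  refine (IsPullback.of_right ?_ (hP.lift_fst _ _ _) hP.flip).flip
  rw [hι']
  exact hpb.flip

theorem exists_of_isPullback (hA : IsConicAtlas s Q ι) {K : Type u} [Field K] {φ : F →+* K}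
    {Z' : Scheme.{u}} {w : Z' ⟶ Z} {s' : Z' ⟶ Spec (.of K)}
    (hP : IsPullback w s' s (Spec.map (CommRingCat.ofHom φ))) :
    ∃ ι', IsConicAtlas s' (Q.map φ) ι' := by
  have := hA.isOpenImmersion
  choose ι' c hc hι' hs' using hA.exists_chart_of_isPullback hP
  have mem_range_iff (j) (z : Z') : z ∈ Set.range (ι' j) ↔ w z ∈ Set.range (ι j) :=
    Set.ext_iff.mp (range_eq_preimage_of_isPullback (hι' j)) z
  refine ⟨ι', fun h => hA.ne_zero ?_, fun j => MorphismProperty.of_isPullback (hι' j) inferInstance,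
    hs', fun z => ?_, fun j i p hp => ?_⟩
  · exact (TernaryForm.map_eq_zero_iff φ.injective).mp h
  · simpa only [mem_range_iff] using hA.exists_mem_range (w z)
  · rw [mem_range_iff, ← Scheme.Hom.comp_apply, ← (hι' j).w, Scheme.Hom.comp_apply]
    refine hA.mem_range j i _ fun h => hp ?_
    have h' : c j (Ideal.Quotient.mk _ (MvPolynomial.X i)) ∈ p.asIdeal := h
    rwa [hc, MvPolynomial.map_X] at h'

end IsConicAtlas

/-! ### Generic points as flat monomorphisms -/

section FlatMono

theorem flat_of_flat_comp_mono {X Y Z : Scheme.{u}} (f : X ⟶ Y) (g : Y ⟶ Z) [Mono g]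
    [hfg : Flat (f ≫ g)] : Flat f :=
  (MorphismProperty.IsStableUnderBaseChange.hasOfPostcompProperty_monomorphisms (P := @Flat)
    ).of_postcomp f g ‹_› hfg

theorem isOpenImmersion_of_isOpenImmersion_comp_mono {X Y Z : Scheme.{u}} (f : X ⟶ Y) (g : Y ⟶ Z)
    [Mono g] [hfg : IsOpenImmersion (f ≫ g)] : IsOpenImmersion f :=
  (MorphismProperty.IsStableUnderBaseChange.hasOfPostcompProperty_monomorphisms
    (P := @IsOpenImmersion)).of_postcomp f g ‹_› hfg

theorem isDominant_of_isOpenImmersion {U X : Scheme.{u}} [Nonempty U] [IrreducibleSpace X]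
    (i : U ⟶ X) [IsOpenImmersion i] : IsDominant i :=
  ⟨i.opensRange.2.dense ⟨i (Classical.arbitrary U), ⟨_, rfl⟩⟩⟩

instance flat_fromSpecStalk (X : Scheme.{u}) (x : X) : Flat (X.fromSpecStalk x) := by
  obtain ⟨_, ⟨U, hU, rfl⟩, hxU, -⟩ := X.isBasis_affineOpens.exists_subset_of_mem_open
    (Set.mem_univ x) isOpen_univ
  have hU : IsAffineOpen U := hU
  rw [← hU.fromSpecStalk_eq_fromSpecStalk hxU, IsAffineOpen.fromSpecStalk]
  have : Flat (Spec.map (X.presheaf.germ U x hxU)) := by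
    rw [Flat.SpecMap_iff]
    let := TopCat.Presheaf.algebra_section_stalk X.presheaf (⟨x, hxU⟩ : U)
    have hloc := hU.isLocalization_stalk ⟨x, hxU⟩
    exact IsLocalization.flat _ (hU.primeIdealOf ⟨x, hxU⟩).asIdeal.primeCompl
  infer_instance

variable {L : Type u} [Field L]

theorem exists_iso_fromSpecStalk {X : Scheme.{u}} (g : Spec (.of L) ⟶ X) [Flat g] [Mono g] :
    ∃ (x : X) (e : X.presheaf.stalk x ≅ .of L),
      Spec.map e.hom ≫ X.fromSpecStalk x = g := by
  let p : Spec (.of L) := Classical.arbitrary _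
  have : Surjective ((Spec (.of L)).fromSpecStalk p) :=
    ⟨fun y => ⟨Classical.arbitrary _, Subsingleton.elim _ _⟩⟩
  have := Flat.isIso_of_surjective_of_mono ((Spec (.of L)).fromSpecStalk p)
  have := isIso_stalkMap_of_flat_of_mono g p
  let t := inv ((Spec (.of L)).fromSpecStalk p) ≫ Spec.map (g.stalkMap p)
  have : IsIso (Spec.preimage t) := by
    rw [ConcreteCategory.isIso_iff_bijective, ← isIso_SpecMap_iff, Spec.map_preimage]
    infer_instance
  refine ⟨g p, asIso (Spec.preimage t), ?_⟩
  rw [asIso_hom, Spec.map_preimage, Category.assoc, Scheme.SpecMap_stalkMap_fromSpecStalk,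
    IsIso.inv_hom_id_assoc]

theorem exists_iso_fromSpecStalk_genericPoint {X : Scheme.{u}} [IsIntegral X]
    (g : Spec (.of L) ⟶ X) [Flat g] [Mono g] :
    ∃ e : X.functionField ≅ .of L,
      Spec.map e.hom ≫ X.fromSpecStalk (genericPoint X) = g := by
  obtain ⟨x, e, he⟩ := exists_iso_fromSpecStalk g
  suffices x = genericPoint X by subst this; exact ⟨e, he⟩
  have hcoheight : (Order.coheight x : WithBot ℕ∞) = 0 := by
    rw [← ringKrullDim_stalk_eq_coheight, ← ringKrullDim_eq_zero_of_field L]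
    exact ringKrullDim_eq_of_ringEquiv e.commRingCatIsoToRingEquiv
  have hmax : IsMax x := Order.coheight_eq_zero.mp (by exact_mod_cast hcoheight)
  have hx := genericPoint_specializes x
  exact (Scheme.le_iff_specializes.mp (hmax (Scheme.le_iff_specializes.mpr hx))).antisymm hx |>.eq

theorem exists_spread_out {S X Y : Scheme.{u}} [IsIntegral X] (sX : X ⟶ S) (sY : Y ⟶ S)
    [LocallyOfFiniteType sY] (gX : Spec (.of L) ⟶ X) [Flat gX] [Mono gX] (gY : Spec (.of L) ⟶ Y)
    (h : gX ≫ sX = gY ≫ sY) :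
    ∃ (U : X.Opens) (g : Spec (.of L) ⟶ U) (f : U.toScheme ⟶ Y),
      g ≫ U.ι = gX ∧ g ≫ f = gY ∧ f ≫ sY = U.ι ≫ sX := by
  obtain ⟨e, he⟩ := exists_iso_fromSpecStalk_genericPoint gX
  obtain ⟨U, hU, f, hf, hfs⟩ := spread_out_of_isGermInjective' sX sY (x := genericPoint X)
    (Spec.map e.inv ≫ gY) (by
      rw [Category.assoc, ← h, ← he]
      rw [Category.assoc, ← Spec.map_comp_assoc, e.hom_inv_id, Spec.map_id, Category.id_comp])
  refine ⟨U, Spec.map e.hom ≫ U.fromSpecStalkOfMem _ hU, f, ?_, ?_, hfs⟩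
  · rw [Category.assoc, Scheme.Opens.fromSpecStalkOfMem_ι, he]
  · rw [Category.assoc, ← hf]
    rw [← Spec.map_comp_assoc, e.inv_hom_id, Spec.map_id, Category.id_comp]

theorem exists_spread_out_section {X Y : Scheme.{u}} [IsIntegral Y] (f : X ⟶ Y)
    [LocallyOfFiniteType f] (gX : Spec (.of L) ⟶ X) [Flat (gX ≫ f)] [Mono (gX ≫ f)] :
    ∃ (V : Y.Opens) (g : Spec (.of L) ⟶ V) (p : V.toScheme ⟶ X),
      g ≫ V.ι = gX ≫ f ∧ g ≫ p = gX ∧ p ≫ f = V.ι := by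
  simpa using exists_spread_out (𝟙 Y) f (gX ≫ f) gX (by simp)

/-- An extension `f : U ⟶ Y` of `gY` to a neighbourhood of the generic point has a section `p` over
an open of `Y`, which in turn has a section `q` over an open of `U`. Both are monomorphisms, so
`q ≫ p` being an open immersion forces `q` to be one. -/
theorem birationalOver_of_flat_mono {S X Y : Scheme.{u}} [IsIntegral X] [IsIntegral Y]
    (sX : X ⟶ S) (sY : Y ⟶ S) [LocallyOfFiniteType sX] [LocallyOfFiniteType sY]
    (gX : Spec (.of L) ⟶ X) [Flat gX] [Mono gX] (gY : Spec (.of L) ⟶ Y) [Flat gY] [Mono gY]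
    (h : gX ≫ sX = gY ≫ sY) : Scheme.BirationalOver sX sY := by
  obtain ⟨U, gU, f, rfl, rfl, hfs⟩ := exists_spread_out sX sY gX gY h
  have : LocallyOfFiniteType (f ≫ sY) := by rw [hfs]; infer_instance
  have := locallyOfFiniteType_of_comp f sY
  have := flat_of_flat_comp_mono gU U.ι
  have := mono_of_mono gU U.ι
  have : Nonempty U := ⟨gU (Classical.arbitrary (PrimeSpectrum L))⟩
  obtain ⟨V, gV, p, hgV, rfl, hpf⟩ := exists_spread_out_section f gU
  have : Flat (gV ≫ V.ι) := by rwa [hgV]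
  have : Mono (gV ≫ V.ι) := by rwa [hgV]
  have : Nonempty V := ⟨gV (Classical.arbitrary (PrimeSpectrum L))⟩
  have : Mono p := by
    have : Mono (p ≫ f) := by rw [hpf]; infer_instance
    exact mono_of_mono p f
  have : LocallyOfFiniteType (p ≫ f) := by rw [hpf]; infer_instance
  have := locallyOfFiniteType_of_comp p f
  obtain ⟨W, gW, q, hgW, rfl, hqp⟩ := exists_spread_out_section p gV
  have : Nonempty W := ⟨gW (Classical.arbitrary (PrimeSpectrum L))⟩
  have : IsOpenImmersion (q ≫ p) := by rw [hqp]; infer_instance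
  have := isOpenImmersion_of_isOpenImmersion_comp_mono q p
  have := isDominant_of_isOpenImmersion (W.ι ≫ U.ι)
  have := isDominant_of_isOpenImmersion (q ≫ V.ι)
  have hW : (q ≫ V.ι) ≫ sY = (W.ι ≫ U.ι) ≫ sX := by
    rw [← hpf, ← hqp]
    simp only [Category.assoc, hfs]
  exact ((W.ι ≫ U.ι).birationalOver sX _ rfl).symm.trans ((q ≫ V.ι).birationalOver sY _ hW)

theorem apply_eq_genericPoint_of_flat_of_mono {X : Scheme.{u}} [IsIntegral X]
    (g : Spec (.of L) ⟶ X) [Flat g] [Mono g] (x : Spec (.of L)) : g x = genericPoint X := by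
  obtain ⟨e, rfl⟩ := exists_iso_fromSpecStalk_genericPoint g
  have : Subsingleton (Spec X.functionField) :=
    inferInstanceAs (Subsingleton (PrimeSpectrum X.functionField))
  rw [Scheme.Hom.comp_apply,
    Subsingleton.elim (Spec.map e.hom x) (IsLocalRing.closedPoint X.functionField)]
  exact Scheme.fromSpecStalk_closedPoint

end FlatMono

section KrullDimension

theorem ringKrullDim_eq_of_isIntegral {A B : Type*} [CommRing A] [CommRing B] [Algebra A B]
    [Algebra.IsIntegral A B] [FaithfulSMul A B] : ringKrullDim B = ringKrullDim A := by
  apply le_antisymm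
  · exact Order.krullDim_le_of_strictMono (PrimeSpectrum.comap (algebraMap A B))
      fun p q hpq => Ideal.IsIntegral.comap_lt_comap (R := A) hpq
  · refine iSup_le fun l => ?_
    obtain ⟨P, hP⟩ := Algebra.IsIntegral.comap_surjective A B l.head
    have : P.asIdeal.LiesOver l.head.asIdeal := ⟨by rw [← hP]; rfl⟩
    obtain ⟨M, hM, -⟩ := Ideal.exists_ltSeries_of_hasGoingUp l P.asIdeal
    rw [← hM]
    exact le_iSup (fun p : LTSeries (PrimeSpectrum B) => (p.length : WithBot ℕ∞)) M

theorem trdeg_fractionField_eq (R A L : Type u) [CommRing R] [IsDomain R] [CommRing A] [IsDomain A]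
    [Field L] [Algebra R A] [Algebra A L] [Algebra R L] [IsScalarTower R A L] [FaithfulSMul R A]
    [IsFractionRing A L] : Algebra.trdeg R L = Algebra.trdeg R A := by
  have : Algebra.IsAlgebraic A L := IsLocalization.isAlgebraic L (nonZeroDivisors A)
  rw [← trdeg_add_eq R A (A := L), trdeg_eq_zero (R := A), add_zero]

theorem ringKrullDim_eq_of_trdeg_eq {k A : Type u} [Field k] [CommRing A] [IsDomain A]
    [Algebra k A] [Algebra.FiniteType k A] {n : ℕ} (hn : Algebra.trdeg k A = n) :
    ringKrullDim A = n := by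
  obtain ⟨m, g, hg, hint⟩ := exists_integral_inj_algHom_of_fg k A
  algebraize [g.toRingHom]
  have : IsScalarTower k (MvPolynomial (Fin m) k) A :=
    IsScalarTower.of_algebraMap_eq fun c => (g.commutes c).symm
  have : FaithfulSMul (MvPolynomial (Fin m) k) A :=
    (faithfulSMul_iff_algebraMap_injective _ _).mpr hg
  have hm : m = n := by
    have h : Algebra.trdeg k A = m := by
      rw [← trdeg_add_eq k (MvPolynomial (Fin m) k) (A := A),
        trdeg_eq_zero (R := MvPolynomial (Fin m) k), MvPolynomial.trdeg_of_isDomain]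
      simp
    exact_mod_cast h.symm.trans hn
  rw [ringKrullDim_eq_of_isIntegral (A := MvPolynomial (Fin m) k),
    MvPolynomial.ringKrullDim_of_isNoetherianRing, ringKrullDim_eq_zero_of_field, hm]
  simp

theorem topologicalKrullDim_eq_of_forall_isAffineOpen {X : Scheme.{u}} [Nonempty X]
    {d : WithBot ℕ∞}
    (h : ∀ U : X.Opens, IsAffineOpen U → (U : Set X).Nonempty → ringKrullDim Γ(X, U) = d) :
    topologicalKrullDim X = d := by
  have hcover (x : X) : ∃ U : X.Opens, IsAffineOpen U ∧ x ∈ U := by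
    obtain ⟨_, ⟨U, hU, rfl⟩, hxU, -⟩ := X.isBasis_affineOpens.exists_subset_of_mem_open
      (Set.mem_univ x) isOpen_univ
    exact ⟨U, hU, hxU⟩
  apply le_antisymm
  · have hpts : topologicalKrullDim X = Order.krullDim X :=
      Order.krullDim_eq_of_orderIso irreducibleSetEquivPoints
    rw [hpts, Order.krullDim_eq_iSup_coheight]
    refine iSup_le fun x => ?_
    obtain ⟨U, hU, hxU⟩ := hcover x
    let := TopCat.Presheaf.algebra_section_stalk X.presheaf (⟨x, hxU⟩ : U)
    have := hU.isLocalization_stalk ⟨x, hxU⟩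
    rw [← ringKrullDim_stalk_eq_coheight, ← h U hU ⟨x, hxU⟩,
      IsLocalization.AtPrime.ringKrullDim_eq_height (hU.primeIdealOf ⟨x, hxU⟩).asIdeal
        (X.presheaf.stalk x)]
    exact Ideal.height_le_ringKrullDim_of_ne_top (Ideal.IsPrime.ne_top inferInstance)
  · obtain ⟨U, hU, hxU⟩ := hcover (Classical.arbitrary X)
    rw [← h U hU ⟨_, hxU⟩, ← PrimeSpectrum.topologicalKrullDim_eq_ringKrullDim]
    exact hU.fromSpec.isOpenEmbedding.isInducing.topologicalKrullDim_le

end KrullDimension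

/-- `L` is the function field of the `k`-scheme `X`, which is meant to be integral. The generic
point is encoded as a flat monomorphism `Spec L ⟶ X` over `k`: this needs no choice of point and is
stable under flat base change. -/
def HasFunctionField {k : Type u} [Field k] (L : Type u) [Field L] [Algebra k L] {X : Scheme.{u}}
    (s : X ⟶ Spec (.of k)) : Prop :=
  ∃ g : Spec (.of L) ⟶ X, Flat g ∧ Mono g ∧ g ≫ s = Spec.map (CommRingCat.ofHom (algebraMap k L))

namespace HasFunctionField

variable {k : Type u} [Field k] {L : Type u} [Field L] [Algebra k L] {X : Scheme.{u}}
  {s : X ⟶ Spec (.of k)}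

theorem of_algEquiv (h : HasFunctionField L s) {L' : Type u} [Field L'] [Algebra k L']
    (e : L ≃ₐ[k] L') : HasFunctionField L' s := by
  obtain ⟨g, _, _, hg⟩ := h
  refine ⟨Spec.map e.toRingEquiv.toCommRingCatIso.hom ≫ g, inferInstance, inferInstance, ?_⟩
  rw [Category.assoc, hg, ← Spec.map_comp]
  congr 1
  ext c
  exact e.commutes c

theorem of_flat_mono {K : Type u} [Field K] [Algebra L K] [Algebra k K] [IsScalarTower k L K]
    {Y : Scheme.{u}} {c : Y ⟶ Spec (.of L)} (h : HasFunctionField K c) (j : Y ⟶ X) [Flat j] [Mono j]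
    (hj : j ≫ s = c ≫ Spec.map (CommRingCat.ofHom (algebraMap k L))) : HasFunctionField K s := by
  obtain ⟨g, _, _, hg⟩ := h
  refine ⟨g ≫ j, inferInstance, inferInstance, ?_⟩
  rw [Category.assoc, hj, reassoc_of% hg, ← Spec.map_comp, ← CommRingCat.ofHom_comp,
    ← IsScalarTower.algebraMap_eq]

theorem birationalOver [IsIntegral X] {Y : Scheme.{u}} [IsIntegral Y] {t : Y ⟶ Spec (.of k)}
    [LocallyOfFiniteType s] [LocallyOfFiniteType t] (hX : HasFunctionField L s)
    (hY : HasFunctionField L t) : Scheme.BirationalOver s t := by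
  obtain ⟨g, _, _, hg⟩ := hX
  obtain ⟨g', _, _, hg'⟩ := hY
  exact birationalOver_of_flat_mono s t g g' (hg.trans hg'.symm)

theorem ringKrullDim_section [IsIntegral X] [LocallyOfFiniteType s] (h : HasFunctionField L s)
    {n : ℕ} (hn : Algebra.trdeg k L = n) {U : X.Opens} (hU : IsAffineOpen U)
    (hne : (U : Set X).Nonempty) : ringKrullDim Γ(X, U) = n := by
  obtain ⟨g, _, _, hg⟩ := h
  obtain ⟨e, rfl⟩ := exists_iso_fromSpecStalk_genericPoint g
  have hx : genericPoint X ∈ U :=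
    ((genericPoint_spec X).mem_open_set_iff U.2).mpr (by simpa using hne)
  have : Nonempty U := ⟨⟨_, hx⟩⟩
  let φ : CommRingCat.of k ⟶ Γ(X, U) := Spec.preimage (hU.fromSpec ≫ s)
  let ψ : Γ(X, U) ⟶ .of L := X.presheaf.germ U (genericPoint X) hx ≫ e.hom
  have hφ : Spec.map φ = hU.fromSpec ≫ s := Spec.map_preimage _
  let := φ.hom.toAlgebra
  let := ψ.hom.toAlgebra
  have : Algebra.FiniteType k Γ(X, U) := by
    have : LocallyOfFiniteType (Spec.map φ) := by rw [hφ]; infer_instance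
    exact (HasRingHomProperty.Spec_iff (P := @LocallyOfFiniteType)).mp this
  have : IsScalarTower k Γ(X, U) L := by
    refine IsScalarTower.of_algebraMap_eq' (congrArg CommRingCat.Hom.hom
      (?_ : CommRingCat.ofHom (algebraMap k L) = φ ≫ ψ))
    apply Spec.map_injective
    rw [← hg, Spec.map_comp, Spec.map_comp, hφ, ← hU.fromSpecStalk_eq_fromSpecStalk hx,
      IsAffineOpen.fromSpecStalk]
    simp only [Category.assoc]
  have : IsFractionRing Γ(X, U) L := by
    have := functionField_isFractionRing_of_isAffineOpen X U hU
    exact IsLocalization.isLocalization_of_algEquiv (nonZeroDivisors Γ(X, U))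
      (S := X.functionField) { e.commRingCatIsoToRingEquiv with commutes' := fun r => rfl }
  exact ringKrullDim_eq_of_trdeg_eq ((trdeg_fractionField_eq k Γ(X, U) L).symm.trans hn)

theorem topologicalKrullDim_eq [IsIntegral X] [LocallyOfFiniteType s] (h : HasFunctionField L s)
    {n : ℕ} (hn : Algebra.trdeg k L = n) : topologicalKrullDim X = n :=
  topologicalKrullDim_eq_of_forall_isAffineOpen fun _ hU hne => h.ringKrullDim_section hn hU hne

end HasFunctionField

/-! ### Dominant morphisms and flatness over curves -/

section Dominant

variable {Y S : Scheme.{u}}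

theorem irreducibleSpace_of_isDominant [IrreducibleSpace Y] (f : Y ⟶ S) [IsDominant f] :
    IrreducibleSpace S := by
  have hirr : IsIrreducible (Set.univ : Set S) := by
    rw [← (Scheme.Hom.denseRange f).closure_range, isIrreducible_iff_closure, ← Set.image_univ]
    exact (IrreducibleSpace.isIrreducible_univ Y).image _ f.continuous.continuousOn
  exact { toPreirreducibleSpace := ⟨hirr.2⟩, toNonempty := hirr.1.to_type }

theorem apply_genericPoint_of_isDominant [IrreducibleSpace Y] [IrreducibleSpace S] (f : Y ⟶ S)
    [IsDominant f] : f (genericPoint Y) = genericPoint S := by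
  have h := (genericPoint_spec Y).image f.continuous
  rw [Set.image_univ, (Scheme.Hom.denseRange f).closure_range] at h
  exact h.eq (genericPoint_spec S)

theorem isDominant_of_apply_eq_genericPoint [IrreducibleSpace S] (f : Y ⟶ S) {y : Y}
    (hy : f y = genericPoint S) : IsDominant f := by
  refine ⟨dense_iff_closure_eq.mpr (Set.eq_univ_of_univ_subset ?_)⟩
  rw [← genericPoint_closure (α := S)]
  exact closure_mono (Set.singleton_subset_iff.mpr ⟨y, hy⟩)

theorem stalkSpecializes_injective [IsIntegral S] {x y : S} (hx : x = genericPoint S)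
    (h : x ⤳ y) : Function.Injective (S.presheaf.stalkSpecializes h).hom := by
  subst hx
  exact FaithfulSMul.algebraMap_injective (S.presheaf.stalk y) S.functionField

theorem stalkMap_injective_of_isDominant [IsIntegral Y] [IsIntegral S] (f : Y ⟶ S) [IsDominant f]
    (y : Y) : Function.Injective (f.stalkMap y).hom := by
  have hgen := apply_genericPoint_of_isDominant f
  have hfield : IsField (S.presheaf.stalk (f (genericPoint Y))) := by
    rw [hgen]
    exact Field.toIsField S.functionField
  let := hfield.toField
  have hcomp : Function.Injective ((f.stalkMap (genericPoint Y)).hom ∘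
      (S.presheaf.stalkSpecializes ((genericPoint_specializes y).map f.continuous)).hom) :=
    (RingHom.injective _).comp (stalkSpecializes_injective hgen _)
  have heq : (f.stalkMap (genericPoint Y)).hom ∘
      (S.presheaf.stalkSpecializes ((genericPoint_specializes y).map f.continuous)).hom =
      (Y.presheaf.stalkSpecializes (genericPoint_specializes y)).hom ∘ (f.stalkMap y).hom :=
    funext fun t => f.stalkSpecializes_stalkMap_apply _ _ (genericPoint_specializes y) t
  rw [heq] at hcomp
  exact hcomp.of_comp

theorem flat_of_isDominant [IsIntegral Y] [IsIntegral S]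
    (hS : ∀ z : S, IsDedekindDomain (S.presheaf.stalk z)) (f : Y ⟶ S) [IsDominant f] : Flat f := by
  refine Flat.of_stalkMap f fun y => ?_
  have := hS (f y)
  let := (f.stalkMap y).hom.toAlgebra
  have : FaithfulSMul (S.presheaf.stalk (f y)) (Y.presheaf.stalk y) :=
    (faithfulSMul_iff_algebraMap_injective _ _).mpr (stalkMap_injective_of_isDominant f y)
  exact (inferInstance : Module.Flat (S.presheaf.stalk (f y)) (Y.presheaf.stalk y))

theorem isIntegral_of_flat (f : Y ⟶ S) [Flat f] [IsReduced S] {T : Scheme.{u}} (g : T ⟶ S)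
    [IsDominant g] [QuasiCompact g] [IsIntegral (pullback f g)] : IsIntegral Y := by
  have : IsSchemeTheoreticallyDominant g := .of_isDominant g
  have : IsReduced Y := IsSchemeTheoreticallyDominant.isReduced (pullback.fst f g)
  have := irreducibleSpace_of_isDominant (pullback.fst f g)
  exact isIntegral_of_irreducibleSpace_of_isReduced Y

end Dominant

theorem isDedekindDomain_of_ringEquiv {A B : Type*} [CommRing A] [CommRing B] [IsDedekindDomain A]
    (e : A ≃+* B) : IsDedekindDomain B := by
  have : IsDomain B := MulEquiv.isDomain A e.symm.toMulEquiv
  let := e.toRingHom.toAlgebra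
  have : IsLocalization (⊥ : Submonoid A) A := IsLocalization.self bot_le
  have : IsLocalization (⊥ : Submonoid A) B :=
    IsLocalization.isLocalization_of_algEquiv (S := A) ⊥ { e with commutes' := fun r => rfl }
  exact IsLocalization.isDedekindDomain A (M := ⊥) bot_le B

namespace ProjSpace

variable (N : ℕ) (F : Type u) [Field F]

instance isDomain_chartRing (j : Fin (N + 1)) : IsDomain (ChartRing N F j) :=
  MulEquiv.isDomain _ (chartEquiv N F j).symm.toMulEquiv

theorem chartCoord_ne_zero (j l : Fin (N + 1)) : chartCoord N F j l ≠ 0 := by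
  rcases Fin.eq_self_or_eq_succAbove j l with rfl | ⟨i, rfl⟩
  · rw [chartCoord_self]
    exact one_ne_zero
  · rw [← chartEquiv_X]
    exact (map_ne_zero_iff _ (chartEquiv N F j).injective).mpr (MvPolynomial.X_ne_zero i)

instance isIntegral : IsIntegral (ProjSpace N F) := by
  refine isIntegral_of_forall_exists (I := Fin (N + 1)) (fun j => chartι N F j) (fun z => ?_)
    fun j l => ?_
  · obtain ⟨j, z, hz⟩ := exists_chartι_eq N F z
    exact ⟨j, z, hz⟩
  · let p : Spec (.of (ChartRing N F j)) := ⟨⊥, Ideal.isPrime_bot⟩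
    have hp : p ∈ chartι N F j ⁻¹ᵁ (chart N F l).1 := by
      rw [chartι_preimage_chart]
      exact chartCoord_ne_zero N F j l
    rw [← opensRange_chartι] at hp
    exact ⟨chartι N F j p, ⟨p, rfl⟩, hp⟩

theorem isDedekindDomain_stalk (z : ProjSpace 1 F) :
    IsDedekindDomain ((ProjSpace 1 F).presheaf.stalk z) := by
  obtain ⟨j, z, rfl⟩ := exists_chartι_eq 1 F z
  have : IsDedekindDomain (ChartRing 1 F j) := isDedekindDomain_of_ringEquiv
    ((MvPolynomial.uniqueAlgEquiv F (Fin 1)).symm.toRingEquiv.trans (chartEquiv 1 F j))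
  obtain ⟨e⟩ := nonempty_stalk_equiv_localization (ChartRing 1 F j) z.asIdeal (hp := z.isPrime)
  exact isDedekindDomain_of_ringEquiv
    ((asIso ((chartι 1 F j).stalkMap z)).commRingCatIsoToRingEquiv.trans e).symm

end ProjSpace

/-! ### Smooth conics -/

section Localization

variable {R S : Type u} [CommRing R] [CommRing S] [Algebra R S]

theorem mono_specMap_of_isLocalization (M : Submonoid R) [IsLocalization M S] :
    Mono (Spec.map (CommRingCat.ofHom (algebraMap R S))) := by
  have : Epi (CommRingCat.ofHom (algebraMap R S)) := IsLocalization.epi M S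
  exact inferInstanceAs (Mono (Scheme.Spec.map (CommRingCat.ofHom (algebraMap R S)).op))

theorem flat_specMap_of_isLocalization (M : Submonoid R) [IsLocalization M S] :
    Flat (Spec.map (CommRingCat.ofHom (algebraMap R S))) := by
  rw [Flat.SpecMap_iff, CommRingCat.hom_ofHom, RingHom.flat_algebraMap_iff]
  exact IsLocalization.flat S M

end Localization

theorem exists_algHom_of_section {F R : Type u} [Field F] [CommRing R] [Algebra F R]
    (τ : Spec (.of F) ⟶ Spec (.of R))
    (hτ : τ ≫ Spec.map (CommRingCat.ofHom (algebraMap F R)) = 𝟙 _) : Nonempty (R →ₐ[F] F) := by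
  have h : CommRingCat.ofHom (algebraMap F R) ≫ Spec.preimage τ = 𝟙 _ := by
    apply Spec.map_injective
    rw [Spec.map_comp, Spec.map_preimage, hτ, Spec.map_id]
  exact ⟨{ (Spec.preimage τ).hom with
    commutes' := DFunLike.congr_fun (CommRingCat.hom_ext_iff.mp h) }⟩

namespace TernaryForm

open MvPolynomial

theorem exists_aeval_poly_eq_zero {F : Type u} [Field F] {Q : TernaryForm F}
    (r : Q.CoordRing →ₐ[F] F) : ∃ x y : F, aeval ![x, y] Q.poly = 0 := by
  let ψ : MvPolynomial (Fin 2) F →ₐ[F] F := r.comp (Ideal.Quotient.mkₐ F _)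
  have hψ : aeval ![ψ (X 0), ψ (X 1)] = ψ := algHom_ext fun i => by fin_cases i <;> simp
  refine ⟨ψ (X 0), ψ (X 1), ?_⟩
  rw [hψ]
  exact (congrArg r CoordRing.mk_poly).trans (map_zero r)

end TernaryForm

/-- The `F`-scheme `Z` is a smooth plane conic. Smoothness is encoded by the discriminant of the
ternary form, which is the right condition in characteristic `2` as well. -/
def IsSmoothConic {F : Type u} [Field F] {Z : Scheme.{u}} (s : Z ⟶ Spec (.of F)) : Prop :=
  ∃ Q ι, IsConicAtlas s Q ι ∧ Q.disc ≠ 0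

namespace IsSmoothConic

variable {F : Type u} [Field F] {Z : Scheme.{u}} {s : Z ⟶ Spec (.of F)}

theorem of_isPlaneConic [NeZero (2 : F)] (h : IsPlaneConic s) (hZ : IsNormalScheme Z) :
    IsSmoothConic s := by
  obtain ⟨Q, ι, hA⟩ := h.exists_isConicAtlas
  exact ⟨Q, ι, hA, hA.disc_ne_zero hZ⟩

theorem of_isPullback (h : IsSmoothConic s) {K : Type u} [Field K] {φ : F →+* K} {Z' : Scheme.{u}}
    {w : Z' ⟶ Z} {s' : Z' ⟶ Spec (.of K)}
    (hP : IsPullback w s' s (Spec.map (CommRingCat.ofHom φ))) : IsSmoothConic s' := by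
  obtain ⟨Q, ι, hA, hQ⟩ := h
  obtain ⟨ι', hA'⟩ := hA.exists_of_isPullback hP
  refine ⟨_, ι', hA', ?_⟩
  rw [TernaryForm.disc_map]
  exact (map_ne_zero φ).mpr hQ

theorem isIntegral (h : IsSmoothConic s) : IsIntegral Z := by
  obtain ⟨Q, ι, hA, hQ⟩ := h
  exact hA.isIntegral hQ

theorem hasFunctionField (h : IsSmoothConic s) (σ : Spec (.of F) ⟶ Z) (hσ : σ ≫ s = 𝟙 _) :
    HasFunctionField (RatFunc F) s := by
  obtain ⟨Q, ι, hA, hQ⟩ := h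
  obtain ⟨j, hj⟩ := hA.exists_mem_range (σ (Classical.arbitrary (PrimeSpectrum F)))
  have := hA.isOpenImmersion j
  have hrange : Set.range σ ⊆ Set.range (ι j) := by
    rintro _ ⟨x, rfl⟩
    rwa [Subsingleton.elim x (Classical.arbitrary (PrimeSpectrum F))]
  let R := (Q.chart j).CoordRing
  have := IsConicAtlas.isDomain_coordRing_chart hQ j
  obtain ⟨r⟩ := exists_algHom_of_section (R := R) (IsOpenImmersion.lift (ι j) σ hrange) (by
    rw [← hA.ι_comp, ← Category.assoc, IsOpenImmersion.lift_fac, hσ])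
  obtain ⟨x, y, hxy⟩ := TernaryForm.exists_aeval_poly_eq_zero r
  obtain ⟨e⟩ := TernaryForm.nonempty_ratFunc_algEquiv (FractionRing R)
    (by rwa [TernaryForm.disc_chart]) hxy
  have := mono_specMap_of_isLocalization (S := FractionRing R) (nonZeroDivisors R)
  have := flat_specMap_of_isLocalization (S := FractionRing R) (nonZeroDivisors R)
  refine HasFunctionField.of_algEquiv ⟨Spec.map (CommRingCat.ofHom (algebraMap R (FractionRing R)))
    ≫ ι j, inferInstance, inferInstance, ?_⟩ e.symm
  rw [Category.assoc, hA.ι_comp, ← Spec.map_comp, ← CommRingCat.ofHom_comp,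
    ← IsScalarTower.algebraMap_eq]

end IsSmoothConic

/-! ### Fibers of conic fibrations -/

/-- The scheme-theoretic fiber over `y` is a smooth conic over the residue field of `y`. -/
def HasSmoothConicFiber {X S : Scheme.{u}} (π : X ⟶ S) (y : S) : Prop :=
  IsSmoothConic (F := S.residueField y) (π.fiberToSpecResidueField y)

section Fibers

variable {X S : Scheme.{u}} {π : X ⟶ S}

theorem exists_specMap_fromSpecResidueField_eq {L : Type u} [Field L] (g : Spec (.of L) ⟶ S)
    (x : Spec (.of L)) :
    ∃ φ : S.residueField (g x) ⟶ .of L, Spec.map φ ≫ S.fromSpecResidueField (g x) = g := by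
  obtain ⟨⟨z, φ⟩, rfl⟩ := (Scheme.SpecToEquivOfField _ _).symm.surjective g
  have hz : (Spec.map φ ≫ S.fromSpecResidueField z) x = z :=
    Scheme.fromSpecResidueField_apply z (Spec.map φ x)
  suffices ∀ z', z' = z → ∃ ψ : S.residueField z' ⟶ .of L,
      Spec.map ψ ≫ S.fromSpecResidueField z' = Spec.map φ ≫ S.fromSpecResidueField z from this _ hz
  rintro _ rfl
  exact ⟨φ, rfl⟩

theorem exists_isPullback_fiber {y : S} {T : Scheme.{u}} {g : T ⟶ S}
    {ψ : T ⟶ Spec (S.residueField y)} (hψ : ψ ≫ S.fromSpecResidueField y = g) {P : Scheme.{u}}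
    {fst : P ⟶ X} {snd : P ⟶ T} (hP : IsPullback fst snd π g) :
    ∃ w : P ⟶ π.fiber y, IsPullback w snd (π.fiberToSpecResidueField y) ψ := by
  have hF : IsPullback (π.fiberι y) (π.fiberToSpecResidueField y) π (S.fromSpecResidueField y) :=
    IsPullback.of_hasPullback _ _
  refine ⟨hF.lift fst (snd ≫ ψ) (by rw [hP.w, Category.assoc, hψ]),
    IsPullback.of_right ?_ (hF.lift_snd _ _ _) hF⟩
  rwa [hF.lift_fst, hψ]

theorem HasSmoothConicFiber.isSmoothConic_of_isPullback {L : Type u} [Field L]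
    {g : Spec (.of L) ⟶ S} {x : Spec (.of L)} (h : HasSmoothConicFiber π (g x)) {P : Scheme.{u}}
    {fst : P ⟶ X} {snd : P ⟶ Spec (.of L)} (hP : IsPullback fst snd π g) : IsSmoothConic snd := by
  obtain ⟨φ, hφ⟩ := exists_specMap_fromSpecResidueField_eq g x
  obtain ⟨w, hw⟩ := exists_isPullback_fiber hφ hP
  exact IsSmoothConic.of_isPullback (φ := φ.hom) h hw

theorem HasSmoothConicFiber.isIntegral_pullback {T : Scheme.{u}} [IsIntegral T] [Flat π]
    {t : T ⟶ S} (h : HasSmoothConicFiber π (t (genericPoint T))) : IsIntegral (pullback t π) := by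
  let γ : Spec (.of (T.residueField (genericPoint T))) ⟶ T :=
    T.fromSpecResidueField (genericPoint T)
  let x : Spec (.of (T.residueField (genericPoint T))) := Classical.arbitrary (PrimeSpectrum _)
  have hγ : γ x = genericPoint T := T.fromSpecResidueField_apply _ x
  have := isDominant_of_apply_eq_genericPoint γ hγ
  have : QuasiCompact γ := ⟨fun _ _ _ => (Set.toFinite _).isCompact⟩
  have hP : IsPullback (pullback.fst (pullback.fst t π) γ ≫ pullback.snd t π)
      (pullback.snd (pullback.fst t π) γ) π (γ ≫ t) :=
    ((IsPullback.of_hasPullback (pullback.fst t π) γ).flip.paste_vert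
      (IsPullback.of_hasPullback t π)).flip
  have h' : HasSmoothConicFiber π ((γ ≫ t) x) := by rwa [Scheme.Hom.comp_apply, hγ]
  have := (h'.isSmoothConic_of_isPullback hP).isIntegral
  exact isIntegral_of_flat (pullback.fst t π) γ

theorem HasSmoothConicFiber.geometricallyIntegral_pullback {k : Type u} [Field k] {T : Scheme.{u}}
    (c : T ⟶ Spec (.of k)) [GeometricallyIntegral c] [IsIntegral T] [Flat π]
    {t : T ⟶ S} (h : HasSmoothConicFiber π (t (genericPoint T))) :
    GeometricallyIntegral (pullback.fst t π ≫ c) := by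
  refine ⟨fun K _ z Y fst snd hY => ?_⟩
  have : IsIntegral (pullback c z) :=
    pullback_of_geometrically GeometricallyIntegral.geometrically_isIntegral K z
  have : Surjective z := ⟨fun y => ⟨Classical.arbitrary (PrimeSpectrum K), Subsingleton.elim _ _⟩⟩
  have h' : HasSmoothConicFiber π ((pullback.fst c z ≫ t) (genericPoint ↥(pullback c z))) := by
    rwa [Scheme.Hom.comp_apply, apply_genericPoint_of_isDominant]
  have := h'.isIntegral_pullback
  let v : Y ⟶ pullback c z := pullback.lift (fst ≫ pullback.fst t π) snd (by
    rw [Category.assoc, hY.w])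
  have hv : IsPullback fst v (pullback.fst t π) (pullback.fst c z) := by
    refine (IsPullback.of_right ?_ (pullback.lift_fst _ _ _)
      (IsPullback.of_hasPullback c z).flip).flip
    rw [pullback.lift_snd]
    exact hY.flip
  have hv' : IsPullback (fst ≫ pullback.snd t π) v π (pullback.fst c z ≫ t) :=
    (hv.flip.paste_vert (IsPullback.of_hasPullback t π)).flip
  exact isIntegral_of_iso (hv'.flip.isoPullback).symm

theorem flat_fromSpecResidueField_genericPoint (S : Scheme.{u}) [IsIntegral S] :
    Flat (S.fromSpecResidueField (genericPoint S)) := by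
  have : IsIso (S.residue (genericPoint S)) := by
    rw [ConcreteCategory.isIso_iff_bijective]
    let : Field (S.presheaf.stalk (genericPoint S)) := inferInstanceAs (Field S.functionField)
    exact ⟨RingHom.injective (S.residue (genericPoint S)).hom, S.residue_surjective _⟩
  unfold Scheme.fromSpecResidueField
  infer_instance

theorem isNormalScheme_fiber_genericPoint [IsIntegral S] (hX : IsNormalScheme X) (π : X ⟶ S) :
    IsNormalScheme (π.fiber (genericPoint S)) := by
  have := flat_fromSpecResidueField_genericPoint S
  have : Flat (π.fiberι (genericPoint S)) :=
    inferInstanceAs (Flat (pullback.fst π (S.fromSpecResidueField (genericPoint S))))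
  exact hX.of_flat_mono (π.fiberι (genericPoint S))

theorem isIso_of_specMap_comp_eq_id {A B : CommRingCat.{u}} (hA : IsField A) [Nontrivial B]
    (φ : A ⟶ B) (t : Spec A ⟶ Spec B) (h : Spec.map φ ≫ t = 𝟙 _) : IsIso (Spec.map φ) := by
  have hsec : Spec.preimage t ≫ φ = 𝟙 _ := by
    apply Spec.map_injective
    rw [Spec.map_comp, Spec.map_preimage, h, Spec.map_id]
  let := hA.toField
  have : IsIso φ := by
    rw [ConcreteCategory.isIso_iff_bijective]
    exact ⟨RingHom.injective φ.hom,
      fun c => ⟨_, DFunLike.congr_fun (CommRingCat.hom_ext_iff.mp hsec) c⟩⟩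
  infer_instance

theorem exists_iso_fiber_of_section {k : Type u} [Field k] {t : S ⟶ Spec (.of k)}
    {g : Spec (.of k) ⟶ S} (hg : g ≫ t = 𝟙 _) (π : X ⟶ S) (x : Spec (.of k)) :
    Nonempty (pullback π g ≅ π.fiber (g x)) := by
  obtain ⟨φ, hφ⟩ := exists_specMap_fromSpecResidueField_eq g x
  have := isIso_of_specMap_comp_eq_id (Field.toIsField (S.residueField (g x))) φ
    (S.fromSpecResidueField (g x) ≫ t) (by rw [reassoc_of% hφ, hg])
  obtain ⟨w, hw⟩ := exists_isPullback_fiber hφ (IsPullback.of_hasPullback π g)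
  have := hw.isIso_fst_of_isIso
  exact ⟨asIso w⟩

end Fibers

theorem ProjSpace.neZero_two_residueField {k : Type u} [Field k] [NeZero (2 : k)] {N : ℕ}
    (y : ProjSpace N k) : NeZero (2 : (ProjSpace N k).residueField y) := by
  let φ : k →+* (ProjSpace N k).residueField y :=
    (Spec.preimage ((ProjSpace N k).fromSpecResidueField y ≫ ProjSpace.toSpec N k)).hom
  have := φ.injective.nontrivial
  refine ⟨?_⟩
  rw [← map_ofNat φ 2]
  exact (map_ne_zero φ).mpr two_ne_zero

namespace IsConicFibration

variable {k : Type u} [Field k] {X : Scheme.{u}} {s : X ⟶ Spec (.of k)} {π : X ⟶ ProjSpace 1 k}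

theorem surjective (h : IsConicFibration s π) : Surjective π := by
  refine ⟨fun y => ?_⟩
  obtain ⟨Q, ι, -⟩ := (h.fiber_isPlaneConic y).exists_isConicAtlas
  obtain ⟨z⟩ := IsConicAtlas.nonempty_of_charts ι
  have hz : π.fiberι y z ∈ π ⁻¹' {y} := by
    rw [← Scheme.Hom.range_fiberι]
    exact ⟨z, rfl⟩
  exact ⟨_, hz⟩

theorem flat (h : IsConicFibration s π) [IsIntegral X] : Flat π := by
  have := h.surjective
  exact flat_of_isDominant (ProjSpace.isDedekindDomain_stalk k) π

variable [NeZero (2 : k)]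

theorem hasSmoothConicFiber_of_isNormalScheme (h : IsConicFibration s π) {y : ProjSpace 1 k}
    (hy : IsNormalScheme (π.fiber y)) : HasSmoothConicFiber π y :=
  have := ProjSpace.neZero_two_residueField y
  IsSmoothConic.of_isPlaneConic (h.fiber_isPlaneConic y) hy

theorem hasSmoothConicFiber_genericPoint (h : IsConicFibration s π) [Smooth s] :
    HasSmoothConicFiber π (genericPoint (ProjSpace 1 k)) :=
  h.hasSmoothConicFiber_of_isNormalScheme
    (isNormalScheme_fiber_genericPoint (isNormalScheme_of_smooth s) π)

theorem hasSmoothConicFiber_of_smooth (h : IsConicFibration s π)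
    {g : Spec (.of k) ⟶ ProjSpace 1 k} (hg : g ≫ ProjSpace.toSpec 1 k = 𝟙 _)
    [Smooth (pullback.snd π g)] (x : Spec (.of k)) : HasSmoothConicFiber π (g x) := by
  obtain ⟨e⟩ := exists_iso_fiber_of_section hg π x
  exact h.hasSmoothConicFiber_of_isNormalScheme
    ((isNormalScheme_of_smooth (pullback.snd π g)).of_flat_mono e.inv)

end IsConicFibration

/-! ### Rational function fields -/

section RationalFunctions

theorem isFractionRing_of_isLocalization {R : Type*} [CommRing R] {M : Submonoid R}
    (hM : M ≤ nonZeroDivisors R) (S T : Type*) [CommRing S] [IsDomain S] [CommRing T] [Algebra R S]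
    [Algebra S T] [Algebra R T] [IsScalarTower R S T] [IsLocalization M S] [IsFractionRing S T] :
    IsFractionRing R T := by
  have hinj := IsLocalization.injective S hM
  have h := IsLocalization.localization_localization_isLocalization_of_has_all_units M
    (nonZeroDivisors S) T fun x hx => hx.mem_nonZeroDivisors
  rwa [le_antisymm (comap_nonZeroDivisors_le_of_injective hinj)
    (nonZeroDivisors_le_comap_nonZeroDivisors_of_injective _ hinj)] at h

attribute [local instance] Polynomial.algebra in
theorem isFractionRing_polynomial_ratFunc (A K : Type*) [CommRing A] [IsDomain A] [Field K]
    [Algebra A K] [IsFractionRing A K] : IsFractionRing (Polynomial A) (RatFunc K) :=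
  have := Polynomial.isLocalization (nonZeroDivisors A) K
  isFractionRing_of_isLocalization (Submonoid.map_le_of_le_comap _
    (nonZeroDivisors_le_comap_nonZeroDivisors_of_injective _ Polynomial.C_injective))
    (Polynomial K) (RatFunc K)

/-- The field of rational functions in `n` variables, as the function field of affine space. -/
abbrev RatFunField (k : Type u) [Field k] (n : ℕ) : Type u :=
  FractionRing (MvPolynomial (Fin n) k)

variable (k : Type u) [Field k]

attribute [local instance] Polynomial.algebra in
theorem nonempty_ratFunc_ratFunField_algEquiv (n : ℕ) :
    Nonempty (RatFunc (RatFunField k n) ≃ₐ[k] RatFunField k (n + 1)) :=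
  have := isFractionRing_polynomial_ratFunc (MvPolynomial (Fin n) k) (RatFunField k n)
  ⟨(IsFractionRing.algEquivOfAlgEquiv (MvPolynomial.finSuccEquiv k n)).symm⟩

theorem trdeg_ratFunField (n : ℕ) : Algebra.trdeg k (RatFunField k n) = n := by
  rw [trdeg_fractionField_eq k (MvPolynomial (Fin n) k), MvPolynomial.trdeg_of_isDomain]
  simp

theorem bijective_algebraMap_ratFunField_zero :
    Function.Bijective (algebraMap k (RatFunField k 0)) := by
  refine ⟨(algebraMap k _).injective, fun z => ?_⟩
  obtain ⟨p, q, -, rfl⟩ := IsFractionRing.div_surjective (A := MvPolynomial (Fin 0) k) z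
  obtain ⟨a, rfl⟩ := MvPolynomial.C_surjective (Fin 0) p
  obtain ⟨b, rfl⟩ := MvPolynomial.C_surjective (Fin 0) q
  exact ⟨a / b, map_div₀ _ a b⟩

theorem isIntegral_affineSpace (n : ℕ) : IsIntegral 𝔸(ULift.{u} (Fin n); Spec (.of k)) :=
  isIntegral_of_iso (AffineSpace.SpecIso (ULift.{u} (Fin n)) (.of k)).symm

theorem hasFunctionField_affineSpace (n : ℕ) : HasFunctionField (RatFunField k n)
    (𝔸(ULift.{u} (Fin n); Spec (.of k)) ↘ Spec (.of k)) := by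
  let R := MvPolynomial (ULift.{u} (Fin n)) k
  let e : R ≃ₐ[k] MvPolynomial (Fin n) k := MvPolynomial.renameEquiv k Equiv.ulift
  have := mono_specMap_of_isLocalization (S := FractionRing R) (nonZeroDivisors R)
  have := flat_specMap_of_isLocalization (S := FractionRing R) (nonZeroDivisors R)
  refine HasFunctionField.of_algEquiv (L := FractionRing R)
    ⟨Spec.map (CommRingCat.ofHom (algebraMap R (FractionRing R))) ≫
      (AffineSpace.SpecIso (ULift.{u} (Fin n)) (.of k)).inv, inferInstance, inferInstance, ?_⟩
    (IsFractionRing.algEquivOfAlgEquiv e)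
  rw [Category.assoc, AffineSpace.SpecIso_inv_over, ← Spec.map_comp]
  rfl

variable {k} {X : Scheme.{u}} {s : X ⟶ Spec (.of k)} {n : ℕ}

theorem HasFunctionField.isRationalOfDim [IsIntegral X] [LocallyOfFiniteType s]
    (h : HasFunctionField (RatFunField k n) s) : IsRationalOfDim s n :=
  have := isIntegral_affineSpace k n
  h.birationalOver (hasFunctionField_affineSpace k n)

end RationalFunctions

/-- The generic fiber of the pullback of `π` along `f ≫ π` has a section induced by `f`, and a
smooth conic with a rational point is rational. -/
theorem HasSmoothConicFiber.hasFunctionField_pullback {k L : Type u} [Field k] [Field L]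
    [Algebra k L] {X S T : Scheme.{u}} [IsIntegral T] {π : X ⟶ S} {c : T ⟶ Spec (.of k)}
    (hT : HasFunctionField L c) (f : T ⟶ X)
    (h : HasSmoothConicFiber π ((f ≫ π) (genericPoint T))) :
    HasFunctionField (RatFunc L) (pullback.fst (f ≫ π) π ≫ c) := by
  obtain ⟨g, _, _, hg⟩ := hT
  let p := pullback.fst (f ≫ π) π
  have hP : IsPullback (pullback.fst p g ≫ pullback.snd (f ≫ π) π) (pullback.snd p g) π
      (g ≫ f ≫ π) :=
    ((IsPullback.of_hasPullback p g).flip.paste_vert (IsPullback.of_hasPullback (f ≫ π) π)).flip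
  let x : Spec (.of L) := Classical.arbitrary (PrimeSpectrum L)
  have hgen : HasSmoothConicFiber π ((g ≫ f ≫ π) x) := by
    rwa [Scheme.Hom.comp_apply, apply_eq_genericPoint_of_flat_of_mono g]
  have hfib : HasFunctionField (RatFunc L) (pullback.snd p g) :=
    (hgen.isSmoothConic_of_isPullback hP).hasFunctionField (hP.lift (g ≫ f) (𝟙 _) (by simp))
      (hP.lift_snd _ _ _)
  refine hfib.of_flat_mono (pullback.fst p g) ?_
  rw [pullback.condition_assoc, hg]

section Projective

variable {k : Type u} [Field k]

theorem IsProjectiveScheme.isProper {X : Scheme.{u}} {s : X ⟶ Spec (.of k)}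
    (h : IsProjectiveScheme s) : IsProper s := by
  obtain ⟨N, i, hi, rfl⟩ := h
  infer_instance

theorem IsProjectiveScheme.comp_isClosedImmersion {X Y : Scheme.{u}} {s : X ⟶ Spec (.of k)}
    (h : IsProjectiveScheme s) (i : Y ⟶ X) [IsClosedImmersion i] : IsProjectiveScheme (i ≫ s) := by
  obtain ⟨N, j, hj, rfl⟩ := h
  exact ⟨N, i ≫ j, inferInstance, Category.assoc _ _ _⟩

theorem isClosedImmersion_of_isProper_comp_of_mono {X Y S : Scheme.{u}} (q : X ⟶ Y) [Mono q]
    (p : Y ⟶ S) [IsSeparated p] [IsProper (q ≫ p)] : IsClosedImmersion q :=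
  (IsClosedImmersion.iff_isProper_and_mono q).mpr ⟨.of_comp q p, inferInstance⟩

theorem IsProjectiveScheme.isVariety {X : Scheme.{u}} {s : X ⟶ Spec (.of k)}
    (h : IsProjectiveScheme s) (hg : GeometricallyIntegral s) : IsVariety s :=
  have := h.isProper
  ⟨hg, inferInstance, inferInstance, inferInstance⟩

variable {C X S : Scheme.{u}} (σ : S ⟶ Spec (.of k)) [IsSeparated σ] (t : C ⟶ S) (π : X ⟶ S)

theorem IsProjectiveScheme.pullback (hC : IsProjectiveScheme (t ≫ σ))
    (hX : IsProjectiveScheme (π ≫ σ)) :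
    IsProjectiveScheme (pullback.fst t π ≫ t ≫ σ) := by
  have := hC.isProper
  have := hX.isProper
  have : IsProper π := .of_comp π σ
  obtain ⟨N, i, hi, his⟩ := hC
  obtain ⟨M, j, hj, hjs⟩ := hX
  let q : Limits.pullback t π ⟶ Limits.pullback (ProjSpace.toSpec N k) (ProjSpace.toSpec M k) :=
    pullback.lift (pullback.fst t π ≫ i) (pullback.snd t π ≫ j) (by
      rw [Category.assoc, his, Category.assoc, hjs, pullback.condition_assoc])
  have hq₁ : q ≫ pullback.fst _ _ = pullback.fst t π ≫ i := pullback.lift_fst _ _ _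
  have hq₂ : q ≫ pullback.snd _ _ = pullback.snd t π ≫ j := pullback.lift_snd _ _ _
  have hqs : q ≫ pullback.fst _ _ ≫ ProjSpace.toSpec N k = pullback.fst t π ≫ t ≫ σ := by
    rw [reassoc_of% hq₁, his]
  have : Mono q := by
    refine ⟨fun a b hab => pullback.hom_ext ?_ ?_⟩
    · rw [← cancel_mono i, Category.assoc, Category.assoc, ← hq₁, reassoc_of% hab]
    · rw [← cancel_mono j, Category.assoc, Category.assoc, ← hq₂, reassoc_of% hab]
  have : IsProper (q ≫ pullback.fst _ _ ≫ ProjSpace.toSpec N k) := by rw [hqs]; infer_instance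
  have := isClosedImmersion_of_isProper_comp_of_mono q (pullback.fst _ _ ≫ ProjSpace.toSpec N k)
  let e : Fin (N + 1) × Fin (M + 1) ≃ Fin (N * M + N + M + 1) :=
    finProdFinEquiv.trans (finCongr (by ring))
  refine ⟨N * M + N + M, q ≫ ProjSpace.segre N k M e, inferInstance, ?_⟩
  rw [Category.assoc, ProjSpace.segre_toSpec, hqs]

theorem isProjectiveMorphism_pullback_snd (hC : IsProjectiveScheme (t ≫ σ)) :
    IsProjectiveMorphism (π ≫ σ) (pullback.snd t π) := by
  have := hC.isProper
  have : IsProper t := .of_comp t σ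
  obtain ⟨N, i, hi, his⟩ := hC
  let q : Limits.pullback t π ⟶ Limits.pullback (π ≫ σ) (ProjSpace.toSpec N k) :=
    pullback.lift (pullback.snd t π) (pullback.fst t π ≫ i) (by
      rw [Category.assoc, his, pullback.condition_assoc])
  have hq₁ : q ≫ pullback.fst _ _ = pullback.snd t π := pullback.lift_fst _ _ _
  have hq₂ : q ≫ pullback.snd _ _ = pullback.fst t π ≫ i := pullback.lift_snd _ _ _
  have : Mono q := by
    refine ⟨fun a b hab => pullback.hom_ext ?_ ?_⟩
    · rw [← cancel_mono i, Category.assoc, Category.assoc, ← hq₂, reassoc_of% hab]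
    · rw [← hq₁, reassoc_of% hab]
  have : IsProper (q ≫ pullback.fst _ _) := by rw [hq₁]; infer_instance
  exact ⟨N, q, isClosedImmersion_of_isProper_comp_of_mono q (pullback.fst _ _), hq₁⟩

end Projective

/-! ### Intersection numbers of disjoint fibers -/

section Intersection

theorem isReduced_image {X Y : Scheme.{u}} (f : X ⟶ Y) [QuasiCompact f] [IsReduced X] :
    IsReduced f.image := by
  have (v : f.image) : _root_.IsReduced (f.image.presheaf.stalk v) := by
    obtain ⟨_, ⟨U, hU, rfl⟩, hvU : v ∈ f.imageι ⁻¹ᵁ U, -⟩ :=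
      Y.isBasis_affineOpens.exists_subset_of_mem_open (Set.mem_univ (f.imageι v)) isOpen_univ
    have hW : IsAffineOpen (f.imageι ⁻¹ᵁ U) := IsAffineOpen.preimage hU f.imageι
    have hred : _root_.IsReduced Γ(f.image, f.imageι ⁻¹ᵁ U) :=
      isReduced_of_injective (f.toImage.app (f.imageι ⁻¹ᵁ U)).hom (f.toImage_app_injective ⟨U, hU⟩)
    let := TopCat.Presheaf.algebra_section_stalk f.image.presheaf (⟨v, hvU⟩ : f.imageι ⁻¹ᵁ U)
    have := hW.isLocalization_stalk ⟨v, hvU⟩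
    exact isReduced_localizationPreserves (hW.primeIdealOf ⟨v, hvU⟩).asIdeal.primeCompl _ hred
  exact isReduced_of_isReduced_stalk _

theorem exists_isIntegral_range_eq_closure (D : Scheme.{u}) (z : D) :
    ∃ (V : Scheme.{u}) (j : V ⟶ D), IsIntegral V ∧ IsClosedImmersion j ∧
      Set.range j = closure {z} := by
  let γ : Spec (.of (D.residueField z)) ⟶ D := D.fromSpecResidueField z
  have : QuasiCompact γ := ⟨fun _ _ _ => (Set.toFinite _).isCompact⟩
  have hr : Set.range γ.imageι = closure {z} := by
    rw [← D.range_fromSpecResidueField z, ← Scheme.Hom.support_ker]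
    exact Scheme.IdealSheafData.range_subschemeι _
  have := isReduced_image γ
  have := irreducibleSpace_of_isDominant γ.toImage
  exact ⟨γ.image, γ.imageι, isIntegral_of_irreducibleSpace_of_isReduced _, inferInstance, hr⟩

theorem isLocalEquation_one {E S : Scheme.{u}} (i : E ⟶ S) [QuasiCompact i]
    (hi : IsClosed (Set.range i)) {x : S} (hx : x ∉ Set.range i) : IsLocalEquation i x 1 := by
  obtain ⟨_, ⟨U, hU, rfl⟩, hxU, hUE⟩ := S.isBasis_affineOpens.exists_subset_of_mem_open
    (show x ∈ (Set.range i)ᶜ from hx) hi.isOpen_compl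
  have hempty : i ⁻¹ᵁ U = ⊥ :=
    TopologicalSpace.Opens.ext (Set.eq_empty_of_forall_notMem fun e he => hUE he ⟨e, rfl⟩)
  have : Subsingleton Γ(E, i ⁻¹ᵁ U) := by
    rw [hempty]
    infer_instance
  refine ⟨⟨U, hU⟩, hxU, 1, one_mem _, ?_, map_one _⟩
  rw [Scheme.Hom.ker_apply, Ideal.span_singleton_one, Ideal.eq_top_iff_one, RingHom.mem_ker]
  exact Subsingleton.elim _ _

theorem ord_one {V : Scheme.{u}} [IsIntegral V] [IsLocallyNoetherian V] (x : V) :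
    V.ord (1 : V.functionField) x = 0 := by
  have : Nonempty (⊤ : V.Opens) := ⟨⟨x, trivial⟩⟩
  have h := Scheme.ord_of_isUnit (X := V) (U := ⊤) (f := 1) isUnit_one (x := x) trivial
  rwa [map_one] at h

theorem isDegreeOnCurve_zero {E S V : Scheme.{u}} (i : E ⟶ S) (j : V ⟶ S) [IsIntegral V]
    [IsLocallyNoetherian V] [QuasiCompact i] (hi : IsClosed (Set.range i))
    (hd : Disjoint (Set.range j) (Set.range i)) : IsDegreeOnCurve i j 0 := by
  have hx (x : V) : IsLocalEquation i (j x) 1 :=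
    isLocalEquation_one i hi (hd.notMem_of_mem_left ⟨x, rfl⟩)
  refine ⟨1, fun _ => 1, hx _, fun x => ⟨1, hx x, ?_⟩, ?_⟩
  · rw [map_one, Units.val_one, one_mul]
  · simp only [Units.val_one, map_one]
    exact (finsum_eq_zero_of_forall_eq_zero ord_one).symm

theorem isIntersectionNumber_zero {D E S : Scheme.{u}} (i₁ : D ⟶ S) (i₂ : E ⟶ S)
    [IsLocallyNoetherian D] [QuasiCompact i₂] (hi : IsClosed (Set.range i₂))
    (hd : Disjoint (Set.range i₁) (Set.range i₂)) : IsIntersectionNumber i₁ i₂ 0 := by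
  refine ⟨fun _ => 0, fun Z => ?_, by simp⟩
  have hZ : IsIrreducible (Z : Set D) := Z.2.1
  have hZc : IsClosed (Z : Set D) := isClosed_of_mem_irreducibleComponents _ Z.2
  obtain ⟨V, j, hV, hj, hr⟩ := exists_isIntegral_range_eq_closure D hZ.genericPoint
  have hn : IsLocallyNoetherian V := LocallyOfFiniteType.isLocallyNoetherian j
  refine ⟨V, hV, hn, j, 0, hj, by rw [hr, hZ.closure_genericPoint hZc],
    isDegreeOnCurve_zero i₂ (j ≫ i₁) hi (hd.mono_left ?_), by simp⟩
  rintro _ ⟨x, rfl⟩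
  exact ⟨j x, rfl⟩

theorem isIntersectionNumber_fiber_zero {X S₁ S₂ : Scheme.{u}} (p : X ⟶ S₁) (q : X ⟶ S₂)
    [LocallyOfFiniteType p] (P : S₁) (Q : S₂) (hQ : IsClosed {Q})
    (h : ∀ x, p x = P → q x ≠ Q) : IsIntersectionNumber (p.fiberι P) (q.fiberι Q) 0 := by
  have : LocallyOfFiniteType (p.fiberToSpecResidueField P) :=
    inferInstanceAs (LocallyOfFiniteType (pullback.snd _ _))
  have : IsLocallyNoetherian (p.fiber P) :=
    LocallyOfFiniteType.isLocallyNoetherian (p.fiberToSpecResidueField P)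
  have : QuasiCompact (S₂.fromSpecResidueField Q) := ⟨fun _ _ _ => (Set.toFinite _).isCompact⟩
  have : QuasiCompact (q.fiberι Q) := inferInstanceAs (QuasiCompact (pullback.fst _ _))
  refine isIntersectionNumber_zero _ _ ?_ ?_
  · rw [Scheme.Hom.range_fiberι]
    exact hQ.preimage q.continuous
  · rw [Scheme.Hom.range_fiberι, Scheme.Hom.range_fiberι, Set.disjoint_left]
    exact h

end Intersection

section GeometricFibers

variable {k : Type u} [Field k] {X : Scheme.{u}} {s : X ⟶ Spec (.of k)}

theorem exists_isClosed_geometricPoint {S : Scheme.{u}} (t : S ⟶ Spec (.of k))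
    [LocallyOfFiniteType t] {Z : Set S} (hZ : IsLocallyClosed Z) (hne : Z.Nonempty) :
    ∃ P : ↥(pullback t (specAlgClosure k)), IsClosed {P} ∧
      pullback.fst t (specAlgClosure k) P ∈ Z := by
  have : Surjective (specAlgClosure k) :=
    ⟨fun y => ⟨Classical.arbitrary (PrimeSpectrum (AlgebraicClosure k)), Subsingleton.elim _ _⟩⟩
  have : JacobsonSpace ↥(pullback t (specAlgClosure k)) :=
    LocallyOfFiniteType.jacobsonSpace (pullback.snd _ _)
  let p := pullback.fst t (specAlgClosure k)
  obtain ⟨P, hPZ, hP⟩ :=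
    nonempty_inter_closedPoints (hne.preimage p.surjective) (hZ.preimage p.continuous)
  exact ⟨P, hP, hPZ⟩

section GeomMap

variable {Y : Scheme.{u}} {t : Y ⟶ Spec (.of k)} {π : X ⟶ Y} (h : π ≫ t = s)

theorem fst_geomMap_apply (x : ↥(pullback s (specAlgClosure k))) :
    pullback.fst t (specAlgClosure k) (geomMap s t π h x) =
      π (pullback.fst s (specAlgClosure k) x) := by
  rw [← Scheme.Hom.comp_apply, ← Scheme.Hom.comp_apply, geomMap, pullback.map, pullback.lift_fst]

theorem locallyOfFiniteType_geomMap [LocallyOfFiniteType s] :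
    LocallyOfFiniteType (geomMap s t π h) := by
  have hsnd : geomMap s t π h ≫ pullback.snd _ _ = pullback.snd s (specAlgClosure k) := by
    rw [geomMap, pullback.map, pullback.lift_snd, Category.comp_id]
  have : LocallyOfFiniteType (geomMap s t π h ≫ pullback.snd _ _) := by
    rw [hsnd]
    infer_instance
  exact locallyOfFiniteType_of_comp _ (pullback.snd t (specAlgClosure k))

end GeomMap

namespace FibersMeetPositively

variable [LocallyOfFiniteType s] {π₁ π₂ : X ⟶ ProjSpace 1 k} {h₁ : IsConicFibration s π₁}
  {h₂ : IsConicFibration s π₂}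

theorem exists_apply_mem_and_apply_mem (hpos : FibersMeetPositively h₁ h₂)
    {Z₁ Z₂ : Set (ProjSpace 1 k)} (hZ₁ : IsLocallyClosed Z₁) (hne₁ : Z₁.Nonempty)
    (hZ₂ : IsLocallyClosed Z₂) (hne₂ : Z₂.Nonempty) : ∃ x : X, π₁ x ∈ Z₁ ∧ π₂ x ∈ Z₂ := by
  obtain ⟨P, hP, hPZ⟩ := exists_isClosed_geometricPoint (ProjSpace.toSpec 1 k) hZ₁ hne₁
  obtain ⟨Q, hQ, hQZ⟩ := exists_isClosed_geometricPoint (ProjSpace.toSpec 1 k) hZ₂ hne₂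
  by_contra! hdisj
  have := locallyOfFiniteType_geomMap h₁.comp_toSpec
  refine (hpos P Q hP hQ 0 (isIntersectionNumber_fiber_zero _ _ P Q hQ ?_)).false
  rintro x rfl rfl
  rw [fst_geomMap_apply] at hPZ hQZ
  exact hdisj _ hPZ hQZ

theorem isDominant (hpos : FibersMeetPositively h₁ h₂) {C : Scheme.{u}} (f : C ⟶ X)
    {y : ProjSpace 1 k} (hy : IsClosed {y}) (hf : π₁ ⁻¹' {y} ⊆ Set.range f) :
    IsDominant (f ≫ π₂) := by
  by_contra hdom
  have hne : (closure (Set.range (f ≫ π₂)))ᶜ.Nonempty :=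
    Set.nonempty_compl.mpr fun h => hdom ⟨dense_iff_closure_eq.mpr h⟩
  obtain ⟨x, hx, hx'⟩ := hpos.exists_apply_mem_and_apply_mem hy.isLocallyClosed
    (Set.singleton_nonempty y) isClosed_closure.isOpen_compl.isLocallyClosed hne
  obtain ⟨c, rfl⟩ := hf hx
  exact hx' (subset_closure ⟨c, Scheme.Hom.comp_apply _ _ _⟩)

end FibersMeetPositively

end GeometricFibers

/-! ### The iterated fiber products -/

section Stages

variable {k : Type u} [Field k] {X : Scheme.{u}} {s : X ⟶ Spec (.of k)}

variable (s) in
/-- The properties of `f : C ⟶ X` which are propagated along the fiber products: `C` is projective,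
geometrically integral and has the function field of `𝔸ⁿ`. -/
structure IsRationalStage {C : Scheme.{u}} (f : C ⟶ X) (n : ℕ) : Prop where
  isProjective : IsProjectiveScheme (f ≫ s)
  geometricallyIntegral : GeometricallyIntegral (f ≫ s)
  hasFunctionField : HasFunctionField (RatFunField k n) (f ≫ s)

theorem isRationalStage_zero (hX : IsProjectiveScheme s) (P₀ : Spec (.of k) ⟶ X)
    (hP₀ : P₀ ≫ s = 𝟙 _) : IsRationalStage s P₀ 0 := by
  have := isClosedImmersion_of_comp_eq_id s P₀ hP₀
  refine ⟨hX.comp_isClosedImmersion P₀, ?_, ?_⟩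
  · rw [hP₀]
    refine ⟨fun K _ z Y fst snd hY => ?_⟩
    have : IsIso snd := hY.isIso_snd_of_isIso
    exact isIntegral_of_iso (asIso snd).symm
  · have : IsIso (CommRingCat.ofHom (algebraMap k (RatFunField k 0))) :=
      (ConcreteCategory.isIso_iff_bijective _).mpr (bijective_algebraMap_ratFunField_zero k)
    refine ⟨Spec.map (CommRingCat.ofHom (algebraMap k (RatFunField k 0))), inferInstance,
      inferInstance, ?_⟩
    rw [hP₀, Category.comp_id]

namespace IsRationalStage

variable {C : Scheme.{u}} {f : C ⟶ X} {n : ℕ} {π : X ⟶ ProjSpace 1 k}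

theorem isIntegral (h : IsRationalStage s f n) : IsIntegral C :=
  have := h.geometricallyIntegral
  GeometricallyIntegral.isIntegral_of_subsingleton (f ≫ s)

theorem isRationalOfDim (h : IsRationalStage s f n) : IsRationalOfDim (f ≫ s) n :=
  have := h.isIntegral
  have := h.isProjective.isProper
  h.hasFunctionField.isRationalOfDim

theorem topologicalKrullDim_eq (h : IsRationalStage s f n) : topologicalKrullDim C = n :=
  have := h.isIntegral
  have := h.isProjective.isProper
  h.hasFunctionField.topologicalKrullDim_eq (trdeg_ratFunField k n)

theorem isProjective_comp_toSpec (h : IsRationalStage s f n) (hπ : IsConicFibration s π) :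
    IsProjectiveScheme ((f ≫ π) ≫ ProjSpace.toSpec 1 k) := by
  rw [Category.assoc, hπ.comp_toSpec]
  exact h.isProjective

theorem pullback (h : IsRationalStage s f n) (hπ : IsConicFibration s π) [IsIntegral X]
    [IsIntegral C] (hX : IsProjectiveScheme s)
    (hsm : HasSmoothConicFiber π ((f ≫ π) (genericPoint C))) :
    IsRationalStage s (pullback.snd (f ≫ π) π) (n + 1) := by
  have hcomp : pullback.snd (f ≫ π) π ≫ s = pullback.fst (f ≫ π) π ≫ f ≫ s := by
    rw [← hπ.comp_toSpec, ← pullback.condition_assoc, Category.assoc]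
  have := hπ.flat
  have := h.geometricallyIntegral
  refine ⟨?_, ?_, ?_⟩ <;> rw [hcomp]
  · have hp := (h.isProjective_comp_toSpec hπ).pullback (ProjSpace.toSpec 1 k) (f ≫ π) π
      (by rwa [hπ.comp_toSpec])
    rwa [Category.assoc, hπ.comp_toSpec] at hp
  · exact hsm.geometricallyIntegral_pullback (f ≫ s)
  · obtain ⟨e⟩ := nonempty_ratFunc_ratFunField_algEquiv k n
    exact (hsm.hasFunctionField_pullback h.hasFunctionField f).of_algEquiv e

theorem isProjectiveMorphism_snd (h : IsRationalStage s f n) (hπ : IsConicFibration s π) :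
    IsProjectiveMorphism s (pullback.snd (f ≫ π) π) := by
  have hp := isProjectiveMorphism_pullback_snd (ProjSpace.toSpec 1 k) (f ≫ π) π
    (h.isProjective_comp_toSpec hπ)
  rwa [hπ.comp_toSpec] at hp

theorem flat_snd (h : IsRationalStage s f n) [IsDominant (f ≫ π)] :
    Flat (pullback.snd (f ≫ π) π) :=
  have := h.isIntegral
  have := flat_of_isDominant (ProjSpace.isDedekindDomain_stalk k) (f ≫ π)
  inferInstance

theorem surjective_snd (h : IsRationalStage s f n) (hπ : IsConicFibration s π)
    [IsDominant (f ≫ π)] : Surjective (pullback.snd (f ≫ π) π) := by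
  have := (h.isProjective_comp_toSpec hπ).isProper
  have : IsProper (f ≫ π) := .of_comp _ (ProjSpace.toSpec 1 k)
  have : Surjective (f ≫ π) := by
    refine ⟨Set.range_eq_univ.mp ?_⟩
    rw [← (Scheme.Hom.isClosedMap (f ≫ π)).isClosed_range.closure_eq,
      (Scheme.Hom.denseRange (f ≫ π)).closure_range]
  infer_instance

theorem isDominant_snd_comp (h : IsRationalStage s f n) (hπ : IsConicFibration s π)
    [IsDominant (f ≫ π)] {π' : X ⟶ ProjSpace 1 k} (hπ' : IsConicFibration s π') :
    IsDominant (Limits.pullback.snd (f ≫ π) π ≫ π') :=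
  have := h.surjective_snd hπ
  have := hπ'.surjective
  inferInstance

end IsRationalStage

theorem FibersMeetPositively.isDominant_snd_comp [LocallyOfFiniteType s]
    {π₁ π₂ : X ⟶ ProjSpace 1 k} {h₁ : IsConicFibration s π₁} {h₂ : IsConicFibration s π₂}
    (hpos : FibersMeetPositively h₁ h₂) {P₀ : Spec (.of k) ⟶ X} (hP₀ : P₀ ≫ s = 𝟙 _) :
    IsDominant (pullback.snd (P₀ ≫ π₁) π₁ ≫ π₂) := by
  have := isClosedImmersion_of_comp_eq_id (ProjSpace.toSpec 1 k) (P₀ ≫ π₁)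
    (by rw [Category.assoc, h₁.comp_toSpec, hP₀])
  let x : Spec (.of k) := Classical.arbitrary (PrimeSpectrum k)
  have hr : Set.range (P₀ ≫ π₁) = {(P₀ ≫ π₁) x} :=
    (Set.range_eq_singleton_iff).mpr fun x' => congrArg _ (Subsingleton.elim x' x)
  refine hpos.isDominant (pullback.snd (P₀ ≫ π₁) π₁) (y := (P₀ ≫ π₁) x) ?_ ?_
  · rw [← hr]
    exact (P₀ ≫ π₁).isClosedEmbedding.isClosed_range
  · rw [Scheme.Pullback.range_snd, hr]

section Iteration

variable [NeZero (2 : k)] [IsIntegral X] {π₁ π₂ : X ⟶ ProjSpace 1 k}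
  {P₀ : Spec (.of k) ⟶ X}

theorem isRationalStage_one (hX : IsProjectiveScheme s) (h₁ : IsConicFibration s π₁)
    (hP₀ : P₀ ≫ s = 𝟙 _) (hsmooth : Smooth (pullback.snd π₁ (P₀ ≫ π₁))) :
    IsRationalStage s (pullback.snd (P₀ ≫ π₁) π₁) 1 :=
  (isRationalStage_zero hX P₀ hP₀).pullback h₁ hX
    (h₁.hasSmoothConicFiber_of_smooth (by rw [Category.assoc, h₁.comp_toSpec, hP₀]) _)

variable [Smooth s]

theorem IsRationalStage.pullback_of_isDominant {C : Scheme.{u}} {f : C ⟶ X} {n : ℕ}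
    {π : X ⟶ ProjSpace 1 k} (h : IsRationalStage s f n) (hπ : IsConicFibration s π)
    (hX : IsProjectiveScheme s) [IsDominant (f ≫ π)] :
    IsRationalStage s (Limits.pullback.snd (f ≫ π) π) (n + 1) := by
  have := h.isIntegral
  refine h.pullback hπ hX ?_
  rw [apply_genericPoint_of_isDominant (f ≫ π)]
  exact hπ.hasSmoothConicFiber_genericPoint

theorem isRationalStage_auxF_succ (hX : IsProjectiveScheme s) (h₁ : IsConicFibration s π₁)
    (h₂ : IsConicFibration s π₂) (hpos : FibersMeetPositively h₁ h₂) (hP₀ : P₀ ≫ s = 𝟙 _)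
    (hsmooth : Smooth (pullback.snd π₁ (P₀ ≫ π₁))) (n : ℕ) :
    IsRationalStage s (auxF π₁ π₂ P₀ (n + 1)) (n + 1) ∧
      IsDominant (auxF π₁ π₂ P₀ (n + 1) ≫ if Odd (n + 2) then π₁ else π₂) := by
  have hfib (m : ℕ) : IsConicFibration s (if Odd m then π₁ else π₂) := by split <;> assumption
  induction n with
  | zero => exact ⟨isRationalStage_one hX h₁ hP₀ hsmooth, hpos.isDominant_snd_comp hP₀⟩
  | succ n ih =>
    obtain ⟨hstage, hdom⟩ := ih
    exact ⟨hstage.pullback_of_isDominant (hfib (n + 2)) hX,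
      hstage.isDominant_snd_comp (hfib (n + 2)) (hfib (n + 3))⟩

end Iteration

end Stages

end ConicFibrations

end

open ConicFibrations in
theorem proposition3p3_general {k : Type u} [Field k] [NeZero (2 : k)] {X : Scheme.{u}}
    [IsIntegral X] (s : X ⟶ Spec (.of k)) [Smooth s] (hX : IsProjectiveScheme s)
    (π₁ π₂ : X ⟶ ProjSpace 1 k) (h₁ : IsConicFibration s π₁) (h₂ : IsConicFibration s π₂)
    (hpos : FibersMeetPositively h₁ h₂) (P₀ : Spec (.of k) ⟶ X)
    (hP₀ : P₀ ≫ s = 𝟙 (Spec (.of k))) (hsmooth : Smooth (pullback.snd π₁ (P₀ ≫ π₁))) :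
    (∀ n : ℕ, 2 ≤ n → Flat (auxF π₁ π₂ P₀ n) ∧ IsProjectiveMorphism s (auxF π₁ π₂ P₀ n) ∧
      Surjective (auxF π₁ π₂ P₀ n)) ∧
    (∀ n : ℕ, GeometricallyIntegral (auxF π₁ π₂ P₀ n ≫ s) ∧
      topologicalKrullDim (auxC π₁ π₂ P₀ n) = n) ∧
    (∀ n : ℕ, IsVariety (auxF π₁ π₂ P₀ n ≫ s) ∧ IsProjectiveScheme (auxF π₁ π₂ P₀ n ≫ s) ∧
      IsRationalOfDim (auxF π₁ π₂ P₀ n ≫ s) n) := by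
  have hsucc := isRationalStage_auxF_succ hX h₁ h₂ hpos hP₀ hsmooth
  have hstage : ∀ n, IsRationalStage s (auxF π₁ π₂ P₀ n) n
    | 0 => isRationalStage_zero hX P₀ hP₀
    | n + 1 => (hsucc n).1
  refine ⟨fun n hn => ?_,
    fun n => ⟨(hstage n).geometricallyIntegral, (hstage n).topologicalKrullDim_eq⟩,
    fun n => ⟨(hstage n).isProjective.isVariety (hstage n).geometricallyIntegral,
      (hstage n).isProjective, (hstage n).isRationalOfDim⟩⟩
  obtain ⟨m, rfl⟩ := Nat.exists_eq_add_of_le' hn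
  have hfib : IsConicFibration s (if Odd (m + 2) then π₁ else π₂) := by split <;> assumption
  obtain ⟨hm, hdom⟩ := hsucc m
  exact ⟨hm.flat_snd, hm.isProjectiveMorphism_snd hfib, hm.surjective_snd hfib⟩

theorem proposition3p3 {k : Type u} [Field k] [CharZero k] {X : Scheme.{u}}
    (s : X ⟶ Spec (.of k)) (hX : ConicFibrations.IsSmoothProjectiveSurface s)
    (π₁ π₂ : X ⟶ ConicFibrations.ProjSpace 1 k)
    (h₁ : ConicFibrations.IsConicFibration s π₁) (h₂ : ConicFibrations.IsConicFibration s π₂)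
    (hpos : ConicFibrations.FibersMeetPositively h₁ h₂)
    (P₀ : Spec (.of k) ⟶ X) (hP₀ : P₀ ≫ s = 𝟙 (Spec (.of k)))
    (hsmooth : Smooth (pullback.snd π₁ (P₀ ≫ π₁))) :
    (∀ n : ℕ, 2 ≤ n →
      Flat (ConicFibrations.auxF π₁ π₂ P₀ n) ∧
      ConicFibrations.IsProjectiveMorphism s (ConicFibrations.auxF π₁ π₂ P₀ n) ∧
      Surjective (ConicFibrations.auxF π₁ π₂ P₀ n)) ∧
    (∀ n : ℕ,
      GeometricallyIntegral (ConicFibrations.auxF π₁ π₂ P₀ n ≫ s) ∧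
      topologicalKrullDim (ConicFibrations.auxC π₁ π₂ P₀ n) = n) ∧
    (∀ n : ℕ,
      ConicFibrations.IsVariety (ConicFibrations.auxF π₁ π₂ P₀ n ≫ s) ∧
      ConicFibrations.IsProjectiveScheme (ConicFibrations.auxF π₁ π₂ P₀ n ≫ s) ∧
      ConicFibrations.IsRationalOfDim (ConicFibrations.auxF π₁ π₂ P₀ n ≫ s) n) :=
  have := hX.smooth
  have := hX.isVariety.geometricallyIntegral
  have : IsIntegral X := GeometricallyIntegral.isIntegral_of_subsingleton s
  proposition3p3_general s hX.projective π₁ π₂ h₁ h₂ hpos P₀ hP₀ hsmooth
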